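/- **Setting.** Let $\mathfrak g$ be a finite-dimensional simple Lie algebra over $\mathbb C$ with a non-degenerate symmetric invariant bilinear form $(\cdot,\cdot)$ and a Cartan subalgebra $\mathfrak h$, and let $n\ge 2$. For $p\ge 0$ put $A_p=\mathbb C[t_1^{\pm1},\dots,t_p^{\pm1}]$, and $A=A_n$. Let $Z=\Omega_A/dA$ be the space spanned by the symbols $t^mK_i$ ($m\in\mathbb Z^n$, $1\le i\le n$) with relations $\sum_i m_i\,t^mK_i=0$, and write $d(t^r)t^s=\sum_i r_i\,t^{r+s}K_i$. Let $D$ be the span of $d_1,\dots,d_n$. The toroidal Lie algebra is $\tau=\mathfrak g\otimes A\oplus Z\oplus D$ with, writing $X(r)=X\otimes t^r$, $$[X(r),Y(s)]=[X,Y](r+s)+(X,Y)\,d(t^r)t^s,\quad [Z,\mathfrak g\otimes A\oplus Z]=0,\quad [d_i,X(r)]=r_iX(r),\quad [d_i,t^mK_j]=m_i\,t^mK_j,\quad [d_i,d_j]=0 .$$ Let $\tilde{\mathfrak h}=\mathfrak h\oplus\sum_i\mathbb CK_i\oplus D$. Each $B\in GL(n,\mathbb Z)$ gives an automorphism of $\tau$,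 also written $B$: $X(r)\mapsto X(Br)$, $d(t^r)t^s\mapsto d(t^{Br})t^{Bs}$, $(d_1,\dots,d_n)^T\mapsto B^{-1}(d_1,\dots,d_n)^T$. Let $\mathfrak g_{\rm aff}=\mathfrak g\otimes\mathbb C[t_n^{\pm1}]\oplus\mathbb CK_n$ be the affine Lie algebra, with $K_n$ central and $[X(r),Y(s)]=[X,Y](r+s)+(X,Y)\,r\,\delta_{r+s,0}K_n$, and let $J=\mathfrak g_{\rm aff}\otimes A_{n-1}$ with $[X\otimes f,Y\otimes g]=[X,Y]\otimes fg$. In $J\oplus D$ the space $D$ is abelian and acts on $J$ by the degree derivations: $d_i$ by that of $t_i$ on $A_{n-1}$ for $i<n$, and $d_n$ by that of $t_n$ on $\mathfrak g_{\rm aff}$. Put $\mathfrak h_0=\mathfrak h\oplus\mathbb CK_n\oplus D$ and $\mathfrak h_{n-1}=\mathfrak h\oplus\mathbb CK_n\oplus\mathbb Cd_n$. There is a Lie algebra homomorphism $\varphi:\tau\to J\oplus D$ given by $X\otimes t^r\mapsto (X\otimes t_n^{r_n})\otimes t_1^{r_1}\cdots t_{n-1}^{r_{n-1}}$; $t^mK_i\mapsto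 0$ if $i<n$ or $m_n\ne0$; $t^mK_n\mapsto K_n\otimes t^m$ if $m_n=0$; $d_i\mapsto d_i$. A module *has finite-dimensional weight spaces* with respect to one of the spaces $\tilde{\mathfrak h},\mathfrak h_0,\mathfrak h_{n-1}$ if it is the sum of its weight spaces for that space, and all of these are finite-dimensional. A *central operator* on a $J\oplus D$-module is an operator obtained from the scalars and the actions of the elements $K_n\otimes t^m$, $m\in\mathbb Z^{n-1}$ (which span the centre of $J$), by sums, products and inverses; an operator $z$ *has degree* $m\in\mathbb Z^n$ if $[d_i,z]=m_iz$ for all $i$. For $\alpha\in\mathbb C^{n-1}$ and a $J\oplus\mathbb Cd_n$-module $U$, let $(U\otimes A_{n-1},\pi(\alpha))$ be the $J\oplus D$-module spanned by the $v(k)=v\otimes t^k$ ($v\in U$, $k\in\mathbb Z^{n-1}$) with $$(X\otimes t^m)\,v(k)=\big((X\otimes t^m)v\big)(m+k)\ (X\in\mathfrak g_{\rm aff}),\qquad d_n\,v(k)=(d_nv)(k),\qquad d_i\,v(k)=(\alpha_i+k_i)\,v(k)\ (i<n).$$ Call a $J\oplus D$-module $V$ *standard* if it is irreducible, has finite-dimensional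 weight spaces with respect to $\mathfrak h_0$, and admits non-zero central operators $z_1,\dots,z_{n-1}$ of degrees $(k_1,0,\dots,0),\dots,(0,\dots,0,k_{n-1},0)$ with all $k_i$ non-zero integers. **Theorem.** 1. Let $V$ be a standard $J\oplus D$-module. Then there is a $J\oplus\mathbb Cd_n$-submodule $W\subset V$ such that $V/W$ is an irreducible $J\oplus\mathbb Cd_n$-module with finite-dimensional weight spaces with respect to $\mathfrak h_{n-1}$. For every such $W$, with $V_1=V/W$: * for each $m\in\mathbb Z^{n-1}$, the element $K_n\otimes t^m$ acts on $V_1$ by a scalar, and this scalar is non-zero if $K_n\otimes t^m$ acts non-trivially on $V$; * there is $\alpha\in\mathbb C^{n-1}$ such that $V$ is isomorphic to a component of $(V_1\otimes A_{n-1},\pi(\alpha))$; that is, $(V_1\otimes A_{n-1},\pi(\alpha))$ is the direct sum of finitely many irreducible $J\oplus D$-submodules, one of which is isomorphic to $V$. 2. Let $V$ be an irreducible $\tau$-module with finite-dimensional weight spaces with respect to $\tilde{\mathfrak h}$ on which some $t^mK_i$ acts non-trivially. Then there are $B\in GL(n,\mathbb Z)$ and a structure of a standard $J\oplus D$-module on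 the vector space $V$ such that, for all $x\in\tau$ and $v\in V$, the action of $B(x)$ on $v$ in the $\tau$-module $V$ equals the action of $\varphi(x)$ on $v$ in the $J\oplus D$-module $V$. -/

import Mathlib

open scoped TensorProduct DirectSum

set_option linter.unusedSectionVars false

noncomputable section

namespace ToroidalLie

universe u v

/-- A non-degenerate symmetric invariant bilinear form on a complex Lie algebra. -/
structure InvForm (𝔤 : Type u) [LieRing 𝔤] [LieAlgebra ℂ 𝔤] where
  form : LinearMap.BilinForm ℂ 𝔤
  symm : form.IsSymm
  invariant : form.lieInvariant 𝔤
  nondegenerate : form.Nondegenerate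

section Tensor

variable (P : Type*) (M : Type*) [AddCommGroup M] [Module ℂ M]

/-- The vector space `M ⊗ ℂ[P]`; for `P = ℤ^m` this is `M ⊗ A_m` with `A_m` the ring of Laurent
polynomials in `m` variables. -/
def LoopSpace : Type _ := AddMonoidAlgebra ℂ P ⊗[ℂ] M

namespace LoopSpace

instance : AddCommGroup (LoopSpace P M) :=
  inferInstanceAs (AddCommGroup (AddMonoidAlgebra ℂ P ⊗[ℂ] M))

instance : Module ℂ (LoopSpace P M) :=
  inferInstanceAs (Module ℂ (AddMonoidAlgebra ℂ P ⊗[ℂ] M))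

variable {P M}

/-- The map `v ↦ v(r) = v ⊗ t^r`. -/
def of (r : P) : M →ₗ[ℂ] LoopSpace P M :=
  TensorProduct.mk ℂ (AddMonoidAlgebra ℂ P) M (AddMonoidAlgebra.single r 1)

/-- The linear map on `M ⊗ ℂ[P]` with prescribed values `v(r) ↦ f r v`. -/
def lift {N : Type*} [AddCommGroup N] [Module ℂ N] :
    (P → M →ₗ[ℂ] N) →ₗ[ℂ] (LoopSpace P M →ₗ[ℂ] N) where
  toFun f := TensorProduct.lift ((AddMonoidAlgebra.basis P ℂ).constr ℂ f)
  map_add' f g := by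
    rw [map_add]
    exact TensorProduct.ext' fun a x => rfl
  map_smul' c f := by
    rw [map_smul]
    exact TensorProduct.ext' fun a x => rfl

@[simp] lemma lift_of {N : Type*} [AddCommGroup N] [Module ℂ N] (f : P → M →ₗ[ℂ] N) (r : P)
    (v : M) : lift f (of r v) = f r v := by
  have h := (AddMonoidAlgebra.basis P ℂ).constr_basis ℂ f r
  rw [AddMonoidAlgebra.basis_apply] at h
  change TensorProduct.lift ((AddMonoidAlgebra.basis P ℂ).constr ℂ f)
    (AddMonoidAlgebra.single r 1 ⊗ₜ v) = f r v
  rw [TensorProduct.lift.tmul, h]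

@[ext] lemma hom_ext {N : Type*} [AddCommGroup N] [Module ℂ N] {f g : LoopSpace P M →ₗ[ℂ] N}
    (h : ∀ r, f ∘ₗ of r = g ∘ₗ of r) : f = g := by
  refine TensorProduct.ext (AddMonoidAlgebra.lhom_ext' fun r => LinearMap.ext_ring ?_)
  exact h r

end LoopSpace

end Tensor

section LoopAlgebra

variable (P : Type*) [AddCommGroup P] (L : Type*) [LieRing L] [LieAlgebra ℂ L]

/-- The Lie algebra `L ⊗ ℂ[P]`, with bracket `[X(r), Y(s)] = [X, Y](r + s)`. -/
def Loop : Type _ := LieAlgebra.loopAlgebra ℂ P L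

namespace Loop

instance : LieRing (Loop P L) := inferInstanceAs (LieRing (LieAlgebra.loopAlgebra ℂ P L))

instance : LieAlgebra ℂ (Loop P L) :=
  inferInstanceAs (LieAlgebra ℂ (LieAlgebra.loopAlgebra ℂ P L))

variable {P L}

/-- The map `X ↦ X(r) = X ⊗ t^r`. -/
def of (r : P) : L →ₗ[ℂ] Loop P L :=
  TensorProduct.mk ℂ (AddMonoidAlgebra ℂ P) L (AddMonoidAlgebra.single r 1)

/-- The linear map on `L ⊗ ℂ[P]` with prescribed values `X(r) ↦ f r X`. -/
def lift {N : Type*} [AddCommGroup N] [Module ℂ N] :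
    (P → L →ₗ[ℂ] N) →ₗ[ℂ] (Loop P L →ₗ[ℂ] N) :=
  LoopSpace.lift

@[simp] lemma lift_of {N : Type*} [AddCommGroup N] [Module ℂ N] (f : P → L →ₗ[ℂ] N) (r : P)
    (v : L) : lift f (of r v) = f r v :=
  LoopSpace.lift_of f r v

@[ext] lemma hom_ext {N : Type*} [AddCommGroup N] [Module ℂ N] {f g : Loop P L →ₗ[ℂ] N}
    (h : ∀ r, f ∘ₗ of r = g ∘ₗ of r) : f = g :=
  LoopSpace.hom_ext h

@[simp] lemma of_lie_of (r s : P) (X Y : L) : ⁅of r X, of s Y⁆ = of (r + s) ⁅X, Y⁆ := by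
  change (⁅(AddMonoidAlgebra.single r 1 ⊗ₜ X : AddMonoidAlgebra ℂ P ⊗[ℂ] L),
    (AddMonoidAlgebra.single s 1 ⊗ₜ Y : AddMonoidAlgebra ℂ P ⊗[ℂ] L)⁆) =
    AddMonoidAlgebra.single (r + s) 1 ⊗ₜ ⁅X, Y⁆
  simp

end Loop

/-- The bracket of a Lie algebra as a bilinear map. -/
def brk (K : Type*) [LieRing K] [LieAlgebra ℂ K] : K →ₗ[ℂ] K →ₗ[ℂ] K :=
  LinearMap.mk₂ ℂ (fun x y => ⁅x, y⁆) (fun _ _ _ => add_lie _ _ _) (fun _ _ _ => smul_lie _ _ _)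
    (fun _ _ _ => lie_add _ _ _) (fun _ _ _ => lie_smul _ _ _)

@[simp] lemma brk_apply {K : Type*} [LieRing K] [LieAlgebra ℂ K] (x y : K) :
    brk K x y = ⁅x, y⁆ := rfl

variable {P}

/-- The derivation `X(r) ↦ f(r) X(r)` of `L ⊗ ℂ[P]`. -/
def Loop.der (f : P →+ ℂ) : LieDerivation ℂ (Loop P L) (Loop P L) where
  toLinearMap := Loop.lift fun r => f r • Loop.of r
  leibniz' a b := by
    have : (brk (Loop P L)).compr₂ (Loop.lift fun r => f r • Loop.of r) =
        (brk (Loop P L)).compl₂ (Loop.lift fun r => f r • Loop.of r) -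
        ((brk (Loop P L)).compl₂ (Loop.lift fun r => f r • Loop.of r)).flip := by
      ext r X s Y
      simp only [LinearMap.coe_comp, Function.comp_apply, LinearMap.compr₂_apply, brk_apply,
        Loop.of_lie_of, Loop.lift_of, map_add, LinearMap.smul_apply, LinearMap.sub_apply,
        LinearMap.compl₂_apply, LinearMap.flip_apply, lie_smul]
      rw [← lie_skew X Y, add_comm s r, map_neg, smul_neg, smul_neg, add_smul]; abel
    exact congrArg (fun g => g a b) this

@[simp] lemma Loop.der_of (f : P →+ ℂ) (r : P) (X : L) :
    Loop.der L f (Loop.of r X) = f r • Loop.of r X :=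
  Loop.lift_of _ r X

variable {L}

/-- The derivation `X(r) ↦ (D X)(r)` of `L ⊗ ℂ[P]` for a derivation `D` of `L`. -/
def Loop.mapDer (D : LieDerivation ℂ L L) : LieDerivation ℂ (Loop P L) (Loop P L) where
  toLinearMap := Loop.lift fun r => Loop.of r ∘ₗ D.toLinearMap
  leibniz' a b := by
    have : (brk (Loop P L)).compr₂ (Loop.lift fun r => Loop.of r ∘ₗ D.toLinearMap) =
        (brk (Loop P L)).compl₂ (Loop.lift fun r => Loop.of r ∘ₗ D.toLinearMap) -
        ((brk (Loop P L)).compl₂ (Loop.lift fun r => Loop.of r ∘ₗ D.toLinearMap)).flip := by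
      ext r X s Y
      simp [add_comm s r]
    exact congrArg (fun g => g a b) this

@[simp] lemma Loop.mapDer_of (D : LieDerivation ℂ L L) (r : P) (X : L) :
    Loop.mapDer D (Loop.of r X) = Loop.of r (D X) :=
  Loop.lift_of _ r X

end LoopAlgebra

section Extension

/-- The data `κ(r, s)` of a central extension of `𝔤 ⊗ ℂ[P]` with bracket
`[X(r), Y(s)] = [X, Y](r + s) + (X, Y) κ(r, s)`. -/
structure Twist (P C : Type*) [AddCommGroup P] [AddCommGroup C] where
  κ : P → P → C
  skew : ∀ r s, κ r s = -κ s r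
  cyclic : ∀ r s u, κ (r + s) u + κ (s + u) r + κ (u + r) s = 0

variable {𝔤 : Type u} [LieRing 𝔤] [LieAlgebra ℂ 𝔤] (F : InvForm 𝔤)
variable {P C : Type*} [AddCommGroup P] [AddCommGroup C] [Module ℂ C] (t : Twist P C)

/-- The bilinear map `(X(r), Y(s)) ↦ (X, Y) κ(r, s)` on the loop algebra `𝔤 ⊗ ℂ[P]`. -/
def cochain : Loop P 𝔤 →ₗ[ℂ] Loop P 𝔤 →ₗ[ℂ] C :=
  Loop.lift fun r => Loop.lift ∘ₗ LinearMap.pi fun s =>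
    F.form.compr₂ (LinearMap.toSpanSingleton ℂ C (t.κ r s))

@[simp] lemma cochain_of (r s : P) (X Y : 𝔤) :
    cochain F t (Loop.of r X) (Loop.of s Y) = F.form X Y • t.κ r s := by
  simp [cochain]

lemma cochain_skew (x y : Loop P 𝔤) : cochain F t x y = -cochain F t y x := by
  have : cochain F t = -(cochain F t).flip := by
    ext r X s Y
    simp
    rw [t.skew, F.symm.eq X Y]
    simp
  exact congrArg (fun f => f x y) this

lemma cochain_self (x : Loop P 𝔤) : cochain F t x x = 0 := by
  have h := cochain_skew F t x x
  have h2 : (2 : ℂ) • cochain F t x x = 0 := by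
    rw [two_smul]; nth_rewrite 1 [h]; simp
  simpa using h2

/-- The 2-cochain with values in the trivial module `C`. -/
def trivCochain : LieModule.Cohomology.twoCochain ℂ (Loop P 𝔤)
    (TrivialLieModule ℂ (Loop P 𝔤) C) :=
  ⟨(cochain F t).compr₂ (TrivialLieModule.equiv ℂ _ C).symm.toLinearMap,
    fun x => by simp [cochain_self]⟩

@[simp] lemma trivCochain_apply (x y : Loop P 𝔤) :
    trivCochain F t x y = (TrivialLieModule.equiv ℂ _ C).symm (cochain F t x y) := rfl

/-- The 2-cocycle of the central extension. -/
def cocycle : LieModule.Cohomology.twoCocycle ℂ (Loop P 𝔤)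
    (TrivialLieModule ℂ (Loop P 𝔤) C) where
  val := trivCochain F t
  property := by
    apply (LieModule.Cohomology.mem_twoCocycle_iff ..).mpr
    ext r X s Y w Z
    have cyc : ∀ X Y Z : 𝔤, F.form ⁅X, Y⁆ Z = F.form ⁅Y, Z⁆ X := by
      intro X Y Z
      rw [F.symm.eq ⁅Y, Z⁆ X, ← lie_skew, map_neg, LinearMap.neg_apply, F.invariant, neg_neg]
    have key : F.form ⁅X, Z⁆ Y • t.κ (r + w) s =
        F.form ⁅X, Y⁆ Z • t.κ (r + s) w + F.form ⁅Y, Z⁆ X • t.κ (s + w) r := by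
      have h := t.cyclic r s w
      rw [add_comm w r] at h
      rw [← cyc X Y Z, ← smul_add, eq_neg_of_add_eq_zero_left h, ← lie_skew X Z, map_neg,
        LinearMap.neg_apply, cyc Z X Y, neg_smul, smul_neg]
    have key' := congrArg (TrivialLieModule.equiv ℂ (Loop P 𝔤) C).symm key
    rw [map_add] at key'
    simpa [trivial_lie_zero, sub_eq_zero, neg_add_eq_iff_eq_add, ← map_smul, -map_smul] using key'

/-- The central extension `𝔤 ⊗ ℂ[P] ⊕ C` with bracket
`[X(r) + c, Y(s) + c'] = [X, Y](r + s) + (X, Y) κ(r, s)`. -/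
abbrev CentralExt : Type _ := LieAlgebra.ofTwoCocycle (cocycle F t)

namespace CentralExt

/-- The linear inclusion of `𝔤 ⊗ ℂ[P]` in the central extension. -/
def loop : Loop P 𝔤 →ₗ[ℂ] CentralExt F t where
  toFun x := LieAlgebra.ofProd (cocycle F t) (x, 0)
  map_add' x y := by rw [← LieAlgebra.of_add]; simp
  map_smul' a x := by simp [← LieAlgebra.of_smul]

/-- The inclusion of the central part `C`. -/
def cen : C →ₗ[ℂ] CentralExt F t where
  toFun c := LieAlgebra.ofProd (cocycle F t) (0, (TrivialLieModule.equiv ℂ _ C).symm c)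
  map_add' x y := by rw [← LieAlgebra.of_add]; simp
  map_smul' a x := by simp [← LieAlgebra.of_smul]

/-- The projection to `𝔤 ⊗ ℂ[P]`. -/
def fst : CentralExt F t →ₗ[ℂ] Loop P 𝔤 where
  toFun x := ((LieAlgebra.ofProd (cocycle F t)).symm x).1
  map_add' x y := by simp
  map_smul' a x := by simp

/-- The linear projection to `C`. -/
def snd : CentralExt F t →ₗ[ℂ] C where
  toFun x := TrivialLieModule.equiv ℂ _ C ((LieAlgebra.ofProd (cocycle F t)).symm x).2
  map_add' x y := by simp
  map_smul' a x := by simp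

variable {F t} in
@[ext high] lemma ext_fst_snd {x y : CentralExt F t} (h₁ : fst F t x = fst F t y)
    (h₂ : snd F t x = snd F t y) : x = y :=
  (LieAlgebra.ofProd (cocycle F t)).symm.injective (Prod.ext h₁ h₂)

@[simp] lemma fst_loop (x : Loop P 𝔤) : fst F t (loop F t x) = x := rfl
@[simp] lemma snd_loop (x : Loop P 𝔤) : snd F t (loop F t x) = 0 := rfl
@[simp] lemma fst_cen (c : C) : fst F t (cen F t c) = 0 := rfl
@[simp] lemma snd_cen (c : C) : snd F t (cen F t c) = c := rfl

@[simp] lemma fst_lie (x y : CentralExt F t) :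
    fst F t ⁅x, y⁆ = ⁅fst F t x, fst F t y⁆ := rfl

@[simp] lemma snd_lie (x y : CentralExt F t) :
    snd F t ⁅x, y⁆ = cochain F t (fst F t x) (fst F t y) := by
  have : snd F t ⁅x, y⁆ = cochain F t (fst F t x) (fst F t y) + 0 - 0 := rfl
  simpa using this

/-- The derivation of the central extension that is `X(r) ↦ f(r) X(r)` on the loop part and `δ` on
the central part. -/
def der (f : P →+ ℂ) (δ : C →ₗ[ℂ] C) (h : ∀ r s, δ (t.κ r s) = f (r + s) • t.κ r s) :
    LieDerivation ℂ (CentralExt F t) (CentralExt F t) where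
  toLinearMap := loop F t ∘ₗ (Loop.der 𝔤 f).toLinearMap ∘ₗ fst F t + cen F t ∘ₗ δ ∘ₗ snd F t
  leibniz' a b := by
    apply ext_fst_snd
    · simp
    · have : (cochain F t).compr₂ δ = (cochain F t).compl₂ (Loop.der 𝔤 f).toLinearMap -
          ((cochain F t).compl₂ (Loop.der 𝔤 f).toLinearMap).flip := by
        ext r X s Y
        simp [h]
        rw [t.skew s r, F.symm.eq Y X]
        simp only [smul_neg, sub_neg_eq_add, smul_smul, ← add_smul]
        congr 1; ring
      have := congrArg (fun g => g (fst F t a) (fst F t b)) this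
      simpa using this

@[simp] lemma fst_der (f : P →+ ℂ) (δ : C →ₗ[ℂ] C) (h) (x : CentralExt F t) :
    fst F t (der F t f δ h x) = Loop.der 𝔤 f (fst F t x) := by
  change fst F t (loop F t (Loop.der 𝔤 f (fst F t x)) + cen F t (δ (snd F t x))) = _
  simp

@[simp] lemma snd_der (f : P →+ ℂ) (δ : C →ₗ[ℂ] C) (h) (x : CentralExt F t) :
    snd F t (der F t f δ h x) = δ (snd F t x) := by
  change snd F t (loop F t (Loop.der 𝔤 f (fst F t x)) + cen F t (δ (snd F t x))) = _
  simp

end CentralExt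

end Extension
/-- The space `D` spanned by the degree derivations `d₁, …, d_n`, an abelian Lie algebra; the
function `a` stands for `∑ aᵢ dᵢ`. -/
def Der (n : ℕ) : Type := Fin n → ℂ

namespace Der

variable {n : ℕ}

instance : AddCommGroup (Der n) := inferInstanceAs (AddCommGroup (Fin n → ℂ))
instance : Module ℂ (Der n) := inferInstanceAs (Module ℂ (Fin n → ℂ))

instance : LieRing (Der n) where
  bracket _ _ := 0
  add_lie _ _ _ := (add_zero 0).symm
  lie_add _ _ _ := (add_zero 0).symm
  lie_self _ := rfl
  leibniz_lie _ _ _ := (add_zero 0).symm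

instance : LieAlgebra ℂ (Der n) where
  lie_smul c _ _ := (smul_zero c).symm

lemma lie_eq_zero (a b : Der n) : ⁅a, b⁆ = 0 := rfl

/-- The derivation `dᵢ`. -/
def d (i : Fin n) : Der n := (Pi.single i 1 : Fin n → ℂ)

/-- The coefficient of `dᵢ`. -/
def coeff (i : Fin n) : Der n →ₗ[ℂ] ℂ := (LinearMap.proj i : (Fin n → ℂ) →ₗ[ℂ] ℂ)

@[simp] lemma coeff_d (i j : Fin n) : coeff i (d j) = if i = j then 1 else 0 := by
  change (Pi.single j 1 : Fin n → ℂ) i = _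
  simp [Pi.single_apply]

/-- The degree `∑ aᵢ rᵢ` of `t^r` with respect to `∑ aᵢ dᵢ`. -/
def deg (a : Der n) : (Fin n → ℤ) →+ ℂ where
  toFun r := ∑ i, coeff i a * r i
  map_zero' := by simp
  map_add' r s := by simp [mul_add, Finset.sum_add_distrib]

lemma deg_apply (a : Der n) (r : Fin n → ℤ) : deg a r = ∑ i, coeff i a * r i := rfl

@[simp] lemma deg_add (a b : Der n) (r : Fin n → ℤ) : deg (a + b) r = deg a r + deg b r := by
  simp [deg_apply, add_mul, Finset.sum_add_distrib]

@[simp] lemma deg_smul (c : ℂ) (a : Der n) (r : Fin n → ℤ) : deg (c • a) r = c * deg a r := by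
  simp [deg_apply, mul_assoc, Finset.mul_sum]

end Der

section DerHom

variable {N : ℕ} {L : Type*} [LieRing L] [LieAlgebra ℂ L]

/-- The part `∑_{i ≤ N} aᵢ dᵢ` of `∑_{i ≤ N+1} aᵢ dᵢ`. -/
def Der.init : Der (N + 1) →ₗ[ℂ] Der N where
  toFun a := fun i => Der.coeff i.castSucc a
  map_add' _ _ := rfl
  map_smul' _ _ := rfl

lemma Loop.der_ext {P : Type*} [AddCommGroup P] {D₁ D₂ : LieDerivation ℂ (Loop P L) (Loop P L)}
    (h : ∀ r X, D₁ (Loop.of r X) = D₂ (Loop.of r X)) : D₁ = D₂ := by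
  have : D₁.toLinearMap = D₂.toLinearMap := Loop.hom_ext fun r => LinearMap.ext fun X => h r X
  exact LieDerivation.ext fun x => congrArg (fun g => g x) this

/-- The derivation of `L ⊗ A_N` by which `∑ aᵢ dᵢ` acts. -/
def Loop.derOp (D : LieDerivation ℂ L L) (a : Der (N + 1)) :
    LieDerivation ℂ (Loop (Fin N → ℤ) L) (Loop (Fin N → ℤ) L) :=
  Loop.der L (Der.deg (Der.init a)) + Der.coeff (Fin.last N) a • Loop.mapDer D

@[simp] lemma Loop.derOp_of (D : LieDerivation ℂ L L) (a : Der (N + 1)) (r : Fin N → ℤ) (X : L) :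
    Loop.derOp D a (Loop.of r X) = Der.deg (Der.init a) r • Loop.of r X +
      Der.coeff (Fin.last N) a • Loop.of r (D X) := by
  simp [Loop.derOp]

/-- The action of `D` on `L ⊗ A_N`: `d₁, …, d_N` act by the degree derivations of `A_N`, and the
last one acts by a given derivation of `L`. -/
def Loop.derHom (D : LieDerivation ℂ L L) :
    Der (N + 1) →ₗ⁅ℂ⁆ LieDerivation ℂ (Loop (Fin N → ℤ) L) (Loop (Fin N → ℤ) L) where
  toFun := Loop.derOp D
  map_add' a b := Loop.der_ext fun r X => by
    simp only [Loop.derOp_of, map_add, Der.deg_add, add_smul, LieDerivation.add_apply]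
    abel
  map_smul' c a := Loop.der_ext fun r X => by
    simp [mul_smul]
  map_lie' {a b} := Loop.der_ext fun r X => by
    rw [Der.lie_eq_zero, LieDerivation.lie_apply]
    simp only [Loop.derOp_of, map_add, map_smul, smul_add, smul_smul, map_zero, zero_smul,
      Der.deg_apply, zero_mul, Finset.sum_const_zero, add_zero]
    simp only [mul_comm]
    abel

end DerHom

section Toroidal

/-- The space `Z = Ω_A / dA`, spanned by the `t^m Kᵢ` with the relations `∑ mᵢ t^m Kᵢ = 0`. -/
abbrev KDiff (n : ℕ) : Type :=
  ((Fin n → ℤ) →₀ (Fin n → ℂ)) ⧸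
    Submodule.span ℂ (Set.range fun m : Fin n → ℤ => Finsupp.single m fun i => (m i : ℂ))

namespace KDiff

variable {n : ℕ}

/-- The element `∑ vᵢ t^m Kᵢ` of `Z`. -/
def of (m : Fin n → ℤ) : (Fin n → ℂ) →ₗ[ℂ] KDiff n :=
  Submodule.mkQ _ ∘ₗ Finsupp.lsingle m

/-- The element `t^m Kᵢ`. -/
def K (m : Fin n → ℤ) (i : Fin n) : KDiff n := of m (Pi.single i 1)

lemma of_self (m : Fin n → ℤ) : of m (fun i => (m i : ℂ)) = 0 :=
  (Submodule.Quotient.mk_eq_zero _).mpr (Submodule.subset_span ⟨m, rfl⟩)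

/-- The linear map on `Z` induced by maps that respect the relations. -/
def lift {M : Type*} [AddCommGroup M] [Module ℂ M] (f : (Fin n → ℤ) → (Fin n → ℂ) →ₗ[ℂ] M)
    (h : ∀ m, f m (fun i => (m i : ℂ)) = 0) : KDiff n →ₗ[ℂ] M :=
  Submodule.liftQ _ (Finsupp.lsum ℂ f) <| by
    rw [Submodule.span_le]
    rintro _ ⟨m, rfl⟩
    simpa using h m

@[simp] lemma lift_of {M : Type*} [AddCommGroup M] [Module ℂ M]
    (f : (Fin n → ℤ) → (Fin n → ℂ) →ₗ[ℂ] M) (h) (m : Fin n → ℤ) (v : Fin n → ℂ) :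
    lift f h (of m v) = f m v := by
  change Finsupp.lsum ℂ f (Finsupp.single m v) = _
  simp

@[ext high] lemma hom_ext {M : Type*} [AddCommGroup M] [Module ℂ M] {f g : KDiff n →ₗ[ℂ] M}
    (h : ∀ m v, f (of m v) = g (of m v)) : f = g := by
  refine Submodule.linearMap_qext _ (Finsupp.lhom_ext fun m v => h m v)

/-- The action of `∑ aᵢ dᵢ` on `Z`: multiplication of `t^m Kᵢ` by `∑ aⱼ mⱼ`. -/
def deg (a : Der n) : KDiff n →ₗ[ℂ] KDiff n :=
  lift (fun m => Der.deg a m • of m) fun m => by simp [of_self]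

@[simp] lemma deg_of (a : Der n) (m : Fin n → ℤ) (v : Fin n → ℂ) :
    deg a (of m v) = Der.deg a m • of m v := by simp [deg]

end KDiff

/-- The cocycle data `κ(r, s) = d(t^r) t^s = ∑ rᵢ t^{r+s} Kᵢ`. -/
def torTwist (n : ℕ) : Twist (Fin n → ℤ) (KDiff n) where
  κ r s := KDiff.of (r + s) fun i => (r i : ℂ)
  skew r s := by
    have h := KDiff.of_self (r + s)
    rw [eq_neg_iff_add_eq_zero, add_comm s r, ← map_add, ← h]
    congr 1; ext i; simp
  cyclic r s u := by
    have h := KDiff.of_self (r + s + u)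
    rw [show s + u + r = r + s + u by abel, show u + r + s = r + s + u by abel, ← map_add,
      ← map_add, ← smul_zero (2 : ℂ), ← h, ← map_smul]
    congr 1; ext i; simp; ring

variable {𝔤 : Type u} [LieRing 𝔤] [LieAlgebra ℂ 𝔤] (F : InvForm 𝔤) (n N : ℕ)

/-- The Lie algebra `𝔤 ⊗ A ⊕ Z`. -/
abbrev TorCore : Type u := CentralExt F (torTwist n)

/-- The action of `D` on `𝔤 ⊗ A ⊕ Z` by degree derivations. -/
def torDer : Der n →ₗ⁅ℂ⁆ LieDerivation ℂ (TorCore F n) (TorCore F n) where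
  toFun a := CentralExt.der F (torTwist n) (Der.deg a) (KDiff.deg a) fun r s => by
    simp [torTwist]
  map_add' a b := by
    have h₁ : (Loop.der 𝔤 (Der.deg (a + b))).toLinearMap =
        (Loop.der 𝔤 (Der.deg a)).toLinearMap + (Loop.der 𝔤 (Der.deg b)).toLinearMap := by
      ext r X; simp [add_smul]
    have h₂ : KDiff.deg (a + b) = KDiff.deg a + KDiff.deg b := by
      ext m v; simp [add_smul]
    ext x
    · simpa using congrArg (fun g => g (CentralExt.fst F (torTwist n) x)) h₁
    · simpa using congrArg (fun g => g (CentralExt.snd F (torTwist n) x)) h₂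
  map_smul' c a := by
    have h₁ : (Loop.der 𝔤 (Der.deg (c • a))).toLinearMap =
        c • (Loop.der 𝔤 (Der.deg a)).toLinearMap := by
      ext r X; simp [mul_smul]
    have h₂ : KDiff.deg (c • a) = c • KDiff.deg a := by
      ext m v; simp [mul_smul]
    ext x
    · simpa using congrArg (fun g => g (CentralExt.fst F (torTwist n) x)) h₁
    · simpa using congrArg (fun g => g (CentralExt.snd F (torTwist n) x)) h₂
  map_lie' {a b} := by
    have h₁ : (Loop.der 𝔤 (Der.deg a)).toLinearMap ∘ₗ (Loop.der 𝔤 (Der.deg b)).toLinearMap =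
        (Loop.der 𝔤 (Der.deg b)).toLinearMap ∘ₗ (Loop.der 𝔤 (Der.deg a)).toLinearMap := by
      ext r X; simp [smul_smul, mul_comm]
    have h₂ : KDiff.deg a ∘ₗ KDiff.deg b = KDiff.deg b ∘ₗ KDiff.deg a := by
      ext m v; simp [smul_smul, mul_comm]
    have h₀ : (Loop.der 𝔤 (Der.deg (0 : Der n))).toLinearMap = 0 := by
      ext r X; simp [Der.deg_apply]
    have h₀' : KDiff.deg (0 : Der n) = 0 := by
      ext m v; simp [Der.deg_apply]
    ext x
    · have h := congrArg (fun g => g (CentralExt.fst F (torTwist n) x)) h₁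
      have h' := congrArg (fun g => g (CentralExt.fst F (torTwist n) x)) h₀
      simp at h h'
      simp [Der.lie_eq_zero, LieDerivation.lie_apply, h, h']
    · have h := congrArg (fun g => g (CentralExt.snd F (torTwist n) x)) h₂
      have h' := congrArg (fun g => g (CentralExt.snd F (torTwist n) x)) h₀'
      simp at h h'
      simp [Der.lie_eq_zero, LieDerivation.lie_apply, h, h']

/-- The toroidal Lie algebra `τ = 𝔤 ⊗ A ⊕ Z ⊕ D`. -/
abbrev Toroidal : Type u := TorCore F n ⋊⁅torDer F n⁆ Der n

namespace Toroidal

variable {n}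

/-- The element `X(r) = X ⊗ t^r` of `τ`. -/
def X (r : Fin n → ℤ) (x : 𝔤) : Toroidal F n :=
  ⟨CentralExt.loop F (torTwist n) (Loop.of r x), 0⟩

/-- The element `t^m Kᵢ` of `τ`. -/
def K (m : Fin n → ℤ) (i : Fin n) : Toroidal F n :=
  ⟨CentralExt.cen F (torTwist n) (KDiff.K m i), 0⟩

/-- The element `dᵢ` of `τ`. -/
def d (i : Fin n) : Toroidal F n := ⟨0, Der.d i⟩

/-- The Cartan subalgebra of `τ` spanned by `h`, the `Kᵢ` and the `dᵢ`. -/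
def cartan (H : LieSubalgebra ℂ 𝔤) : Submodule ℂ (Toroidal F n) :=
  Submodule.span ℂ ({y | ∃ x ∈ H, y = X F 0 x} ∪ Set.range (K F 0) ∪ Set.range (d F))

end Toroidal

/-- The cocycle data of the affine Lie algebra: `κ(r, s) = r δ_{r+s,0}`. -/
def affTwist : Twist ℤ ℂ where
  κ r s := if r + s = 0 then (r : ℂ) else 0
  skew r s := by
    rw [add_comm s r]
    split_ifs with h
    · rw [← Int.cast_neg]; congr 1; omega
    · simp
  cyclic r s u := by
    rw [show s + u + r = r + s + u by ring, show u + r + s = r + s + u by ring]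
    split_ifs with h
    · rw [← Int.cast_add, ← Int.cast_add, ← Int.cast_zero]; congr 1; omega
    · simp

/-- The affine Lie algebra `𝔤_aff = 𝔤 ⊗ ℂ[t, t⁻¹] ⊕ ℂ K`. -/
abbrev Affine : Type u := CentralExt F affTwist

/-- The degree derivation `t d/dt` of the affine Lie algebra. -/
def affDer : LieDerivation ℂ (Affine F) (Affine F) :=
  CentralExt.der F affTwist (Int.castAddHom ℂ) 0 fun r s => by
    by_cases h : r + s = 0 <;> simp [affTwist, h]

/-- The Lie algebra `J = 𝔤_aff ⊗ A_N` (with `N = n - 1`). -/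
abbrev LoopAffine : Type u := Loop (Fin N → ℤ) (Affine F)

/-- The action of `D` on `J`: `d₁, …, d_N` are the degree derivations of `A_N`, and the last one is
the degree derivation of `𝔤_aff`. -/
def jDer : Der (N + 1) →ₗ⁅ℂ⁆ LieDerivation ℂ (LoopAffine F N) (LoopAffine F N) :=
  Loop.derHom (affDer F)

/-- The Lie algebra `J ⊕ D`. -/
abbrev JD : Type u := LoopAffine F N ⋊⁅jDer F N⁆ Der (N + 1)

namespace JD

variable {N}

/-- The element `(X ⊗ t_n^k) ⊗ t^m` of `J ⊕ D`. -/
def X (m : Fin N → ℤ) (k : ℤ) (x : 𝔤) : JD F N :=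
  ⟨Loop.of m (CentralExt.loop F affTwist (Loop.of k x)), 0⟩

/-- The element `K_n ⊗ t^m` of `J ⊕ D`. These elements span the centre of `J`. -/
def K (m : Fin N → ℤ) : JD F N := ⟨Loop.of m (CentralExt.cen F affTwist 1), 0⟩

/-- The element `dᵢ` of `J ⊕ D`. -/
def d (i : Fin (N + 1)) : JD F N := ⟨0, Der.d i⟩

/-- The Cartan subalgebra `h₀` of `J ⊕ D`, spanned by `h`, `K_n` and `d₁, …, d_n`. -/
def cartan (H : LieSubalgebra ℂ 𝔤) : Submodule ℂ (JD F N) :=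
  Submodule.span ℂ ({y | ∃ x ∈ H, y = X F 0 0 x} ∪ {K F 0} ∪ Set.range (d F))

variable (N)

/-- The subalgebra `J ⊕ ℂ d_n` of `J ⊕ D`. -/
def sub : LieSubalgebra ℂ (JD F N) where
  carrier := {x | ∀ i : Fin N, Der.coeff i.castSucc x.right = 0}
  add_mem' {x y} hx hy i := by
    simp only [LieAlgebra.SemiDirectSum.add_eq_mk, map_add, hx i, hy i, add_zero]
  zero_mem' i := by simp
  smul_mem' c x hx i := by
    simp only [LieAlgebra.SemiDirectSum.smul_eq_mk, map_smul, hx i, smul_zero]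
  lie_mem' {x y} _ _ i := by
    simp only [LieAlgebra.SemiDirectSum.lie_eq_mk, Der.lie_eq_zero, map_zero]

/-- The inclusion of `J` in `J ⊕ ℂ d_n`. -/
def inclJ : LoopAffine F N →ₗ[ℂ] sub F N where
  toFun x := ⟨⟨x, 0⟩, fun i => by simp⟩
  map_add' x y := by ext <;> simp
  map_smul' c x := by ext <;> simp

/-- The element `d_n` of `J ⊕ ℂ d_n`. -/
def dLast : sub F N := ⟨d F (Fin.last N), fun i => by simp [d, Fin.castSucc_ne_last]⟩

/-- The Cartan subalgebra `h_{n-1}` of `J ⊕ ℂ d_n`, spanned by `h`, `K_n` and `d_n`. -/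
def subCartan (H : LieSubalgebra ℂ 𝔤) : Submodule ℂ (sub F N) :=
  (cartan F H).comap (sub F N).toSubmodule.subtype

end JD

end Toroidal

section LoopModule

variable {𝔤 : Type u} [LieRing 𝔤] [LieAlgebra ℂ 𝔤] (F : InvForm 𝔤) {N : ℕ} (α : Fin N → ℂ)
variable (U : Type v) [AddCommGroup U] [Module ℂ U]

/-- The `J ⊕ D`-module `(U ⊗ A_{n-1}, π(α))` attached to a `J ⊕ ℂ d_n`-module `U` (`N = n - 1`):
`X(m) v(k) = (X(m) v)(m + k)` for `X ∈ 𝔤_aff`, `d_n v(k) = (d_n v)(k)` and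
`dᵢ v(k) = (αᵢ + kᵢ) v(k)` for `i < n`. -/
def LoopModule (_F : InvForm 𝔤) {N : ℕ} (_α : Fin N → ℂ) (U : Type v) [AddCommGroup U]
    [Module ℂ U] : Type v :=
  LoopSpace (Fin N → ℤ) U

namespace LoopModule

instance : AddCommGroup (LoopModule F α U) := inferInstanceAs (AddCommGroup (LoopSpace _ U))
instance : Module ℂ (LoopModule F α U) := inferInstanceAs (Module ℂ (LoopSpace _ U))

variable [LieRingModule (JD.sub F N) U] [LieModule ℂ (JD.sub F N) U]

/-- The action of `J ⊕ ℂ d_n` on `U` as a linear map. -/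
def act : JD.sub F N →ₗ[ℂ] U →ₗ[ℂ] U :=
  LinearMap.mk₂ ℂ (fun x v => ⁅x, v⁆) (fun _ _ _ => add_lie _ _ _) (fun _ _ _ => smul_lie _ _ _)
    (fun _ _ _ => lie_add _ _ _) (fun _ _ _ => lie_smul _ _ _)

@[simp] lemma act_apply (x : JD.sub F N) (v : U) : act F U x v = ⁅x, v⁆ := rfl

/-- The action of `J` on `U ⊗ A_N`. -/
def actJ : LoopAffine F N →ₗ[ℂ] LoopSpace (Fin N → ℤ) U →ₗ[ℂ] LoopSpace (Fin N → ℤ) U :=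
  Loop.lift fun m => LoopSpace.lift ∘ₗ LinearMap.pi fun k =>
    LinearMap.compRight ℂ (LoopSpace.of (m + k)) ∘ₗ act F U ∘ₗ JD.inclJ F N ∘ₗ Loop.of m

@[simp] lemma actJ_of (m k : Fin N → ℤ) (x : Affine F) (v : U) :
    actJ F U (Loop.of m x) (LoopSpace.of k v) =
      LoopSpace.of (m + k) ⁅JD.inclJ F N (Loop.of m x), v⁆ := by
  simp [actJ]

/-- The action of `D` on `U ⊗ A_N`. -/
def actD : Der (N + 1) →ₗ[ℂ] LoopSpace (Fin N → ℤ) U →ₗ[ℂ] LoopSpace (Fin N → ℤ) U where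
  toFun a := LoopSpace.lift fun k =>
    (∑ i : Fin N, Der.coeff i.castSucc a * (α i + k i)) • LoopSpace.of k +
      Der.coeff (Fin.last N) a • LoopSpace.of k ∘ₗ act F U (JD.dLast F N)
  map_add' a b := by
    ext k v
    simp [add_mul, Finset.sum_add_distrib, add_smul]
    abel
  map_smul' c a := by
    ext k v
    simp [mul_assoc, ← Finset.mul_sum, mul_smul]

@[simp] lemma actD_of (a : Der (N + 1)) (k : Fin N → ℤ) (v : U) :
    actD F α U a (LoopSpace.of k v) =
      (∑ i : Fin N, Der.coeff i.castSucc a * (α i + k i)) • LoopSpace.of k v +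
      Der.coeff (Fin.last N) a • LoopSpace.of k ⁅JD.dLast F N, v⁆ := by
  simp [actD]

lemma inclJ_lie (m m' : Fin N → ℤ) (x y : Affine F) (v : U) :
    ⁅JD.inclJ F N (Loop.of (m + m') ⁅x, y⁆), v⁆ =
      ⁅JD.inclJ F N (Loop.of m x), ⁅JD.inclJ F N (Loop.of m' y), v⁆⁆ -
        ⁅JD.inclJ F N (Loop.of m' y), ⁅JD.inclJ F N (Loop.of m x), v⁆⁆ := by
  rw [← lie_lie]
  congr 1
  apply Subtype.ext
  simp [JD.inclJ]

lemma dLast_lie (m : Fin N → ℤ) (x : Affine F) (v : U) :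
    ⁅JD.inclJ F N (Loop.of m (affDer F x)), v⁆ =
      ⁅JD.dLast F N, ⁅JD.inclJ F N (Loop.of m x), v⁆⁆ -
        ⁅JD.inclJ F N (Loop.of m x), ⁅JD.dLast F N, v⁆⁆ := by
  rw [← lie_lie]
  congr 1
  have : Der.deg (Der.init (Der.d (Fin.last N))) m = 0 := by
    rw [Der.deg_apply]
    refine Finset.sum_eq_zero fun i _ => ?_
    have : Der.coeff i (Der.init (Der.d (Fin.last N))) =
      Der.coeff i.castSucc (Der.d (Fin.last N)) := rfl
    rw [this, Der.coeff_d, if_neg (Fin.castSucc_ne_last i), zero_mul]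
  have h : jDer F N (Der.d (Fin.last N)) (Loop.of m x) = Loop.of m (affDer F x) := by
    have : jDer F N (Der.d (Fin.last N)) = Loop.derOp (affDer F) (Der.d (Fin.last N)) := rfl
    rw [this, Loop.derOp_of]
    simp [*]
  apply Subtype.ext
  change (⟨Loop.of m (affDer F x), 0⟩ : JD F N) = ⟨⁅(0 : LoopAffine F N), Loop.of m x⁆ +
    jDer F N (Der.d (Fin.last N)) (Loop.of m x) - jDer F N 0 0, 0⟩
  rw [h]
  simp

lemma actJ_lie (x y : LoopAffine F N) (w : LoopSpace (Fin N → ℤ) U) :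
    actJ F U ⁅x, y⁆ w = actJ F U x (actJ F U y w) - actJ F U y (actJ F U x w) := by
  have : (brk (LoopAffine F N)).compr₂ (actJ F U) =
      LinearMap.mk₂ ℂ (fun x y => actJ F U x ∘ₗ actJ F U y - actJ F U y ∘ₗ actJ F U x)
        (by intros; ext; simp; abel) (by intros; ext; simp [smul_sub])
        (by intros; ext; simp; abel) (by intros; ext; simp [smul_sub]) := by
    ext m x m' y k v
    simp [inclJ_lie, add_assoc, add_left_comm m' m k]
  exact congrArg (fun g => g x y w) this

lemma actD_comm (a b : Der (N + 1)) (w : LoopSpace (Fin N → ℤ) U) :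
    actD F α U a (actD F α U b w) = actD F α U b (actD F α U a w) := by
  have : actD F α U a ∘ₗ actD F α U b = actD F α U b ∘ₗ actD F α U a := by
    ext k v
    simp only [LinearMap.comp_apply, actD_of, map_add, map_smul, smul_add, smul_smul]
    simp only [mul_comm]
    abel
  exact congrArg (fun g => g w) this

lemma actJ_der (a : Der (N + 1)) (x : LoopAffine F N) (w : LoopSpace (Fin N → ℤ) U) :
    actJ F U (jDer F N a x) w = actD F α U a (actJ F U x w) - actJ F U x (actD F α U a w) := by
  have : actJ F U ∘ₗ (jDer F N a).toLinearMap =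
      LinearMap.mk₂ ℂ (fun x w => actD F α U a (actJ F U x w) - actJ F U x (actD F α U a w))
        (by intros; simp; abel) (by intros; simp [smul_sub])
        (by intros; simp; abel) (by intros; simp [smul_sub]) := by
    ext m x k v
    have h : ∑ i : Fin N, Der.coeff i.castSucc a * (α i + ((m + k) i : ℤ)) =
        Der.deg (Der.init a) m + ∑ i : Fin N, Der.coeff i.castSucc a * (α i + k i) := by
      rw [Der.deg_apply, ← Finset.sum_add_distrib]
      refine Finset.sum_congr rfl fun i _ => ?_
      have : Der.coeff i (Der.init a) = Der.coeff i.castSucc a := rfl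
      rw [this, Pi.add_apply, Int.cast_add]
      ring
    simp only [LinearMap.comp_apply, LieDerivation.coeFn_coe, jDer, Loop.derHom,
      LieHom.coe_mk, Loop.derOp_of, map_add, map_smul, LinearMap.add_apply, LinearMap.smul_apply,
      actJ_of, LinearMap.mk₂_apply, actD_of, dLast_lie, smul_sub, map_sub, h, add_smul]
    abel
  exact congrArg (fun g => g x w) this

/-- The action of `J ⊕ D` on `U ⊗ A_N`. -/
def actL : JD F N →ₗ[ℂ] LoopSpace (Fin N → ℤ) U →ₗ[ℂ] LoopSpace (Fin N → ℤ) U :=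
  actJ F U ∘ₗ LieAlgebra.SemiDirectSum.projl (jDer F N) +
    actD F α U ∘ₗ (LieAlgebra.SemiDirectSum.projr (jDer F N)).toLinearMap

lemma actL_apply (x : JD F N) (w : LoopSpace (Fin N → ℤ) U) :
    actL F α U x w = actJ F U x.left w + actD F α U x.right w := rfl

lemma actL_lie (x y : JD F N) (w : LoopSpace (Fin N → ℤ) U) :
    actL F α U x (actL F α U y w) = actL F α U ⁅x, y⁆ w + actL F α U y (actL F α U x w) := by
  have h : actL F α U ⁅x, y⁆ w = actJ F U ⁅x.left, y.left⁆ w + actJ F U (jDer F N x.right y.left) w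
      - actJ F U (jDer F N y.right x.left) w := by
    simp [actL_apply, Der.lie_eq_zero]
  rw [h, actJ_lie, actJ_der F α U, actJ_der F α U]
  simp only [actL_apply, map_add, actD_comm F α U x.right y.right]
  abel

instance : LieRingModule (JD F N) (LoopModule F α U) where
  bracket x w := actL F α U x w
  add_lie x y w := congrArg (fun g => g w) (map_add (actL F α U) x y)
  lie_add x w w' := map_add (actL F α U x) w w'
  leibniz_lie x y w := actL_lie F α U x y w

instance : LieModule ℂ (JD F N) (LoopModule F α U) where
  smul_lie c x w := congrArg (fun g => g w) (map_smul (actL F α U) c x)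
  lie_smul c x w := map_smul (actL F α U x) c w

end LoopModule

end LoopModule

section Homs

/-- A Lie algebra homomorphism on the central extension `𝔤 ⊗ ℂ[P] ⊕ C`, given on the two summands. -/
def CentralExt.hom {𝔤 : Type*} [LieRing 𝔤] [LieAlgebra ℂ 𝔤] (F : InvForm 𝔤) {P C : Type*}
    [AddCommGroup P] [AddCommGroup C] [Module ℂ C] (t : Twist P C) {L : Type*} [LieRing L]
    [LieAlgebra ℂ L] (a : Loop P 𝔤 →ₗ[ℂ] L) (b : C →ₗ[ℂ] L)
    (hb : ∀ (c : C) (y : L), ⁅b c, y⁆ = 0)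
    (h : ∀ r s X Y, ⁅a (Loop.of r X), a (Loop.of s Y)⁆ =
      a (Loop.of (r + s) ⁅X, Y⁆) + F.form X Y • b (t.κ r s)) :
    CentralExt F t →ₗ⁅ℂ⁆ L where
  toLinearMap := a ∘ₗ fst F t + b ∘ₗ snd F t
  map_lie' {x y} := by
    have hb' : ∀ c y, ⁅y, b c⁆ = 0 := fun c y => by rw [← lie_skew, hb, neg_zero]
    have : (brk (Loop P 𝔤)).compr₂ a + (cochain F t).compr₂ b = (brk L).compl₁₂ a a := by
      ext r X s Y
      simp [h]
    have h' := congrArg (fun g => g (fst F t x) (fst F t y)) this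
    simp only [LinearMap.add_apply, LinearMap.compr₂_apply, brk_apply,
      LinearMap.compl₁₂_apply] at h'
    simp [hb, hb', h']

/-- A homomorphism of semidirect sums, given on the two summands. -/
def semiHom {K K' D D' : Type*} [LieRing K] [LieAlgebra ℂ K] [LieRing K'] [LieAlgebra ℂ K']
    [LieRing D] [LieAlgebra ℂ D] [LieRing D'] [LieAlgebra ℂ D']
    (ψ : D →ₗ⁅ℂ⁆ LieDerivation ℂ K K) (ψ' : D' →ₗ⁅ℂ⁆ LieDerivation ℂ K' K')
    (f : K →ₗ⁅ℂ⁆ K') (g : D →ₗ⁅ℂ⁆ D') (h : ∀ d x, f (ψ d x) = ψ' (g d) (f x)) :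
    (K ⋊⁅ψ⁆ D) →ₗ⁅ℂ⁆ (K' ⋊⁅ψ'⁆ D') where
  toFun x := ⟨f x.left, g x.right⟩
  map_add' x y := by simp
  map_smul' c x := by simp
  map_lie' {x y} := by simp [h]

variable {𝔤 : Type u} [LieRing 𝔤] [LieAlgebra ℂ 𝔤] (F : InvForm 𝔤)

lemma CentralExt.cen_lie {P C : Type*} [AddCommGroup P] [AddCommGroup C] [Module ℂ C]
    (t : Twist P C) (c : C) (y : CentralExt F t) : ⁅cen F t c, y⁆ = 0 := by
  ext <;> simp

@[simp] lemma CentralExt.hom_loop {P C : Type*} [AddCommGroup P] [AddCommGroup C] [Module ℂ C]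
    (t : Twist P C) {L : Type*} [LieRing L] [LieAlgebra ℂ L] (a : Loop P 𝔤 →ₗ[ℂ] L) (b : C →ₗ[ℂ] L)
    (hb h) (x : Loop P 𝔤) : CentralExt.hom F t a b hb h (loop F t x) = a x := by
  change a (fst F t (loop F t x)) + b (snd F t (loop F t x)) = _
  simp

@[simp] lemma CentralExt.hom_cen {P C : Type*} [AddCommGroup P] [AddCommGroup C] [Module ℂ C]
    (t : Twist P C) {L : Type*} [LieRing L] [LieAlgebra ℂ L] (a : Loop P 𝔤 →ₗ[ℂ] L) (b : C →ₗ[ℂ] L)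
    (hb h) (c : C) : CentralExt.hom F t a b hb h (cen F t c) = b c := by
  change a (fst F t (cen F t c)) + b (snd F t (cen F t c)) = _
  simp

lemma torDer_loop (n : ℕ) (a : Der n) (r : Fin n → ℤ) (X : 𝔤) :
    torDer F n a (CentralExt.loop F _ (Loop.of r X)) =
      Der.deg a r • CentralExt.loop F _ (Loop.of r X) := by
  ext <;> simp [torDer]

lemma torDer_cen (n : ℕ) (a : Der n) (m : Fin n → ℤ) (v : Fin n → ℂ) :
    torDer F n a (CentralExt.cen F _ (KDiff.of m v)) =
      Der.deg a m • CentralExt.cen F _ (KDiff.of m v) := by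
  ext <;> simp [torDer]

/-- Two linear maps on `𝔤 ⊗ A ⊕ Z` that agree on the `X(r)` and on `Z` are equal. -/
lemma torCore_ext {n : ℕ} {M : Type*} [AddCommGroup M] [Module ℂ M] {f g : TorCore F n →ₗ[ℂ] M}
    (h₁ : ∀ r X, f (CentralExt.loop F _ (Loop.of r X)) = g (CentralExt.loop F _ (Loop.of r X)))
    (h₂ : ∀ m v, f (CentralExt.cen F _ (KDiff.of m v)) = g (CentralExt.cen F _ (KDiff.of m v)))
    (x : TorCore F n) : f x = g x := by
  have e₁ : f ∘ₗ CentralExt.loop F _ = g ∘ₗ CentralExt.loop F _ :=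
    Loop.hom_ext fun r => LinearMap.ext fun X => h₁ r X
  have e₂ : f ∘ₗ CentralExt.cen F _ = g ∘ₗ CentralExt.cen F _ := KDiff.hom_ext h₂
  have hx : x = CentralExt.loop F _ (CentralExt.fst F _ x) +
      CentralExt.cen F _ (CentralExt.snd F _ x) := by ext <;> simp
  rw [hx, map_add, map_add]
  exact congrArg₂ (· + ·) (congrArg (fun g => g (CentralExt.fst F _ x)) e₁)
    (congrArg (fun g => g (CentralExt.snd F _ x)) e₂)

/-- The map `φ` on `𝔤 ⊗ A`. -/
def phiLoop (N : ℕ) : Loop (Fin (N + 1) → ℤ) 𝔤 →ₗ[ℂ] LoopAffine F N :=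
  Loop.lift fun r => Loop.of (fun i => r i.castSucc) ∘ₗ CentralExt.loop F affTwist ∘ₗ
    Loop.of (r (Fin.last N))

@[simp] lemma phiLoop_of (N : ℕ) (r : Fin (N + 1) → ℤ) (X : 𝔤) :
    phiLoop F N (Loop.of r X) = Loop.of (fun i => r i.castSucc)
      (CentralExt.loop F affTwist (Loop.of (r (Fin.last N)) X)) :=
  Loop.lift_of _ r X

/-- The map `φ` on `Z`. -/
def phiCen (N : ℕ) : KDiff (N + 1) →ₗ[ℂ] LoopAffine F N :=
  KDiff.lift (fun m => if m (Fin.last N) = 0 then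
      Loop.of (fun i => m i.castSucc) ∘ₗ CentralExt.cen F affTwist ∘ₗ LinearMap.proj (Fin.last N)
    else 0) fun m => by
      split_ifs with h
      · simp [h]
      · rfl

lemma phiCen_of (N : ℕ) (m : Fin (N + 1) → ℤ) (v : Fin (N + 1) → ℂ) :
    phiCen F N (KDiff.of m v) = if m (Fin.last N) = 0 then
      Loop.of (fun i => m i.castSucc) (CentralExt.cen F affTwist (v (Fin.last N))) else 0 := by
  rw [phiCen, KDiff.lift_of]
  split_ifs <;> rfl

/-- The restriction of `φ` to `𝔤 ⊗ A ⊕ Z`. -/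
def phiCore (N : ℕ) : TorCore F (N + 1) →ₗ⁅ℂ⁆ LoopAffine F N :=
  CentralExt.hom F (torTwist (N + 1)) (phiLoop F N) (phiCen F N)
    (fun c y => by
      have h : (brk (LoopAffine F N)) ∘ₗ phiCen F N = 0 := by
        refine KDiff.hom_ext fun m v => Loop.hom_ext fun s => LinearMap.ext fun y => ?_
        change ⁅phiCen F N (KDiff.of m v), Loop.of s y⁆ = 0
        rw [phiCen_of]
        split_ifs with h
        · rw [Loop.of_lie_of, CentralExt.cen_lie, map_zero]
        · rw [zero_lie]
      exact congrArg (fun g => g c y) h)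
    (fun r s X Y => by
      have h : ⁅CentralExt.loop F affTwist (Loop.of (r (Fin.last N)) X),
          CentralExt.loop F affTwist (Loop.of (s (Fin.last N)) Y)⁆ =
          CentralExt.loop F affTwist (Loop.of (r (Fin.last N) + s (Fin.last N)) ⁅X, Y⁆) +
          CentralExt.cen F affTwist
            (F.form X Y • affTwist.κ (r (Fin.last N)) (s (Fin.last N))) := by
        ext <;> simp
      have e : ((fun i => r i.castSucc) + fun i => s i.castSucc : Fin N → ℤ) =
        fun i => (r + s) i.castSucc := rfl
      have e' : (torTwist (N + 1)).κ r s = KDiff.of (r + s) fun i => (r i : ℂ) := rfl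
      have e'' : affTwist.κ (r (Fin.last N)) (s (Fin.last N)) =
        if r (Fin.last N) + s (Fin.last N) = 0 then (r (Fin.last N) : ℂ) else 0 := rfl
      rw [phiLoop_of, phiLoop_of, phiLoop_of, Loop.of_lie_of, h, e, map_add, e', phiCen_of, e'',
        map_smul, map_smul, Pi.add_apply]
      split_ifs <;> simp)

lemma phiCore_loop (N : ℕ) (x : Loop (Fin (N + 1) → ℤ) 𝔤) :
    phiCore F N (CentralExt.loop F _ x) = phiLoop F N x :=
  CentralExt.hom_loop F _ _ _ _ _ x

lemma phiCore_cen (N : ℕ) (x : KDiff (N + 1)) :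
    phiCore F N (CentralExt.cen F _ x) = phiCen F N x :=
  CentralExt.hom_cen F _ _ _ _ _ x

/-- The homomorphism `φ : τ → J ⊕ D`:
`X ⊗ t^r ↦ (X ⊗ t_n^{r_n}) ⊗ t₁^{r₁} ⋯ t_{n-1}^{r_{n-1}}`, `t^m K_i ↦ 0` for `i < n` or `m_n ≠ 0`,
`t^m K_n ↦ K_n ⊗ t^m` for `m_n = 0`, and `d_i ↦ d_i` (with `n = N + 1`). -/
def phi (N : ℕ) : Toroidal F (N + 1) →ₗ⁅ℂ⁆ JD F N :=
  semiHom (torDer F (N + 1)) (jDer F N) (phiCore F N) LieHom.id fun a x => by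
    have hd : ∀ r : Fin (N + 1) → ℤ, Der.deg a r = Der.deg (Der.init a) (fun i => r i.castSucc) +
        Der.coeff (Fin.last N) a * r (Fin.last N) := by
      intro r
      rw [Der.deg_apply, Der.deg_apply, Fin.sum_univ_castSucc]
      rfl
    have hj : jDer F N a = Loop.derOp (affDer F) a := rfl
    have hl : ∀ (k : ℤ) (X : 𝔤), affDer F (CentralExt.loop F affTwist (Loop.of k X)) =
        (k : ℂ) • CentralExt.loop F affTwist (Loop.of k X) := by
      intro k X; ext <;> simp [affDer]
    have hc : ∀ c, affDer F (CentralExt.cen F affTwist c) = 0 := by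
      intro c; ext <;> simp [affDer]
    refine torCore_ext F (f := (phiCore F N).toLinearMap ∘ₗ (torDer F (N + 1) a).toLinearMap)
      (g := (jDer F N a).toLinearMap ∘ₗ (phiCore F N).toLinearMap) (fun r X => ?_)
      (fun m v => ?_) x
    · simp only [LinearMap.comp_apply, LieDerivation.coeFn_coe, LieHom.coe_toLinearMap,
        torDer_loop, map_smul, phiCore_loop, phiLoop_of, hj, Loop.derOp_of, hl,
        smul_smul, ← add_smul, hd]
    · simp only [LinearMap.comp_apply, LieDerivation.coeFn_coe, LieHom.coe_toLinearMap,
        torDer_cen, map_smul, phiCore_cen, phiCen_of, hj, hd]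
      split_ifs with h
      · simp [Loop.derOp_of, hc, h]
      · simp

variable {n : ℕ} (B : Matrix.GeneralLinearGroup (Fin n) ℤ)

lemma castVec_mulVec (m : Fin n → ℤ) :
    (B.1.map (Int.cast : ℤ → ℂ)).mulVec (fun i => (m i : ℂ)) =
      fun i => ((B.1.mulVec m i : ℤ) : ℂ) := by
  ext i
  simp [Matrix.mulVec, dotProduct]

/-- The map `X(r) ↦ X(B r)`. -/
def glLoop : Loop (Fin n → ℤ) 𝔤 →ₗ[ℂ] TorCore F n :=
  Loop.lift fun r => CentralExt.loop F (torTwist n) ∘ₗ Loop.of (B.1.mulVec r)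

@[simp] lemma glLoop_of (r : Fin n → ℤ) (X : 𝔤) :
    glLoop F B (Loop.of r X) = CentralExt.loop F (torTwist n) (Loop.of (B.1.mulVec r) X) :=
  Loop.lift_of _ r X

/-- The map `∑ vᵢ t^m Kᵢ ↦ ∑ (B v)ᵢ t^{B m} Kᵢ`, that is, `d(t^r) t^s ↦ d(t^{B r}) t^{B s}`. -/
def glCen : KDiff n →ₗ[ℂ] KDiff n :=
  KDiff.lift (fun m => KDiff.of (B.1.mulVec m) ∘ₗ (B.1.map (Int.cast : ℤ → ℂ)).mulVecLin) fun m => by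
    rw [LinearMap.comp_apply, Matrix.mulVecLin_apply, castVec_mulVec, KDiff.of_self]

@[simp] lemma glCen_of (m : Fin n → ℤ) (v : Fin n → ℂ) :
    glCen B (KDiff.of m v) =
      KDiff.of (B.1.mulVec m) ((B.1.map (Int.cast : ℤ → ℂ)).mulVec v) := by
  simp [glCen]

/-- The restriction to `𝔤 ⊗ A ⊕ Z` of the automorphism of `τ` attached to `B`. -/
def glCore : TorCore F n →ₗ⁅ℂ⁆ TorCore F n :=
  CentralExt.hom F (torTwist n) (glLoop F B) (CentralExt.cen F (torTwist n) ∘ₗ glCen B)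
    (fun c y => CentralExt.cen_lie F _ _ _)
    (fun r s X Y => by
      have e : ∀ r s : Fin n → ℤ, (torTwist n).κ r s = KDiff.of (r + s) fun i => (r i : ℂ) :=
        fun _ _ => rfl
      rw [LinearMap.comp_apply, glLoop_of, glLoop_of, glLoop_of, e, glCen_of, castVec_mulVec,
        Matrix.mulVec_add]
      ext <;> simp [e])

lemma glCore_loop (x : Loop (Fin n → ℤ) 𝔤) :
    glCore F B (CentralExt.loop F _ x) = glLoop F B x :=
  CentralExt.hom_loop F _ _ _ _ _ x

lemma glCore_cen (x : KDiff n) :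
    glCore F B (CentralExt.cen F _ x) = CentralExt.cen F _ (glCen B x) :=
  CentralExt.hom_cen F _ _ _ _ _ x

/-- The action `dᵢ ↦ ∑ⱼ (B⁻¹)ᵢⱼ dⱼ` of `B` on `D`. -/
def glDer : Der n →ₗ⁅ℂ⁆ Der n where
  toLinearMap :=
    ((B⁻¹.1.map (Int.cast : ℤ → ℂ)).vecMulLinear : (Fin n → ℂ) →ₗ[ℂ] (Fin n → ℂ))
  map_lie' {_ _} := map_zero
    ((B⁻¹.1.map (Int.cast : ℤ → ℂ)).vecMulLinear : (Fin n → ℂ) →ₗ[ℂ] (Fin n → ℂ))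

lemma vecMul_dotProduct_mulVec (a : Fin n → ℂ) (r : Fin n → ℤ) :
    Matrix.vecMul a (B⁻¹.1.map (Int.cast : ℤ → ℂ)) ⬝ᵥ (fun i => ((B.1.mulVec r i : ℤ) : ℂ)) =
      a ⬝ᵥ fun i => (r i : ℂ) := by
  have h₂ : B⁻¹.1.map (Int.cast : ℤ → ℂ) * B.1.map (Int.cast : ℤ → ℂ) = 1 := by
    have h := congrArg (fun M : Matrix (Fin n) (Fin n) ℤ => M.map (Int.castRingHom ℂ)) B.inv_mul
    simp only [Matrix.map_mul] at h
    exact h.trans (Matrix.map_one _ (map_zero _) (map_one _))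
  rw [← castVec_mulVec, ← Matrix.dotProduct_mulVec, Matrix.mulVec_mulVec, h₂, Matrix.one_mulVec]

lemma deg_glDer (a : Der n) (r : Fin n → ℤ) : Der.deg (glDer B a) (B.1.mulVec r) = Der.deg a r :=
  vecMul_dotProduct_mulVec B a r

/-- The automorphism of `τ` attached to `B ∈ GL(n, ℤ)`: `X(r) ↦ X(B r)`,
`d(t^r) t^s ↦ d(t^{B r}) t^{B s}`, and `(d₁, …, d_n)ᵀ ↦ B⁻¹ (d₁, …, d_n)ᵀ`. -/
def gl : Toroidal F n →ₗ⁅ℂ⁆ Toroidal F n :=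
  semiHom (torDer F n) (torDer F n) (glCore F B) (glDer B) fun a x => by
    refine torCore_ext F (f := (glCore F B).toLinearMap ∘ₗ (torDer F n a).toLinearMap)
      (g := (torDer F n (glDer B a)).toLinearMap ∘ₗ (glCore F B).toLinearMap) (fun r X => ?_)
      (fun m v => ?_) x
    · simp only [LinearMap.comp_apply, LieDerivation.coeFn_coe, LieHom.coe_toLinearMap,
        torDer_loop, map_smul, glCore_loop, glLoop_of, deg_glDer]
    · simp only [LinearMap.comp_apply, LieDerivation.coeFn_coe, LieHom.coe_toLinearMap,
        torDer_cen, map_smul, glCore_cen, glCen_of, deg_glDer]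

end Homs

section Weights

variable {L : Type*} [LieRing L] [LieAlgebra ℂ L] (T : Submodule ℂ L)
variable (V : Type*) [AddCommGroup V] [Module ℂ V] [LieRingModule L V] [LieModule ℂ L V]

/-- The weight space `{v | h v = χ(h) v for all h ∈ T}`. -/
def wtSpace (χ : T →ₗ[ℂ] ℂ) : Submodule ℂ V where
  carrier := {v | ∀ h : T, ⁅(h : L), v⁆ = χ h • v}
  add_mem' {v w} hv hw h := by rw [lie_add, hv h, hw h, smul_add]
  zero_mem' h := by simp
  smul_mem' c v hv h := by rw [lie_smul, hv h, smul_comm]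

/-- `V` is the sum of its weight spaces with respect to `T`, and these are finite-dimensional. -/
def HasFiniteWeights : Prop :=
  (⨆ χ : T →ₗ[ℂ] ℂ, wtSpace T V χ) = ⊤ ∧ ∀ χ : T →ₗ[ℂ] ℂ, FiniteDimensional ℂ (wtSpace T V χ)

end Weights

section JDModules

variable {𝔤 : Type u} [LieRing 𝔤] [LieAlgebra ℂ 𝔤] (F : InvForm 𝔤) (N : ℕ)
variable (H : LieSubalgebra ℂ 𝔤)
variable (V : Type v) [AddCommGroup V] [Module ℂ V] [LieRingModule (JD F N) V]
  [LieModule ℂ (JD F N) V]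

variable {V} in
/-- The central operators on a `J ⊕ D`-module: the operators obtained from the scalars and the
central elements `K_n ⊗ t^m` of `J` by sums, products and inverses. -/
inductive IsCentralOp : Module.End ℂ V → Prop
  | scalar (c : ℂ) : IsCentralOp (algebraMap ℂ (Module.End ℂ V) c)
  | central (m : Fin N → ℤ) : IsCentralOp (LieModule.toEnd ℂ (JD F N) V (JD.K F m))
  | add {S T : Module.End ℂ V} : IsCentralOp S → IsCentralOp T → IsCentralOp (S + T)
  | mul {S T : Module.End ℂ V} : IsCentralOp S → IsCentralOp T → IsCentralOp (S * T)
  | inv {S T : Module.End ℂ V} : IsCentralOp S → S * T = 1 → T * S = 1 → IsCentralOp T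

variable {V} in
/-- The operator `z` has degree `m ∈ ℤ^n`, that is, `[dᵢ, z] = mᵢ z` for all `i`. -/
def HasDegree (z : Module.End ℂ V) (m : Fin (N + 1) → ℤ) : Prop :=
  ∀ (i : Fin (N + 1)) (v : V), ⁅JD.d F i, z v⁆ = z ⁅JD.d F i, v⁆ + (m i : ℂ) • z v

/-- `V` is an irreducible `J ⊕ D`-module with finite-dimensional weight spaces with respect to `h₀`,
and there are non-zero central operators `z₁, …, z_{n-1}` on `V` of degrees
`(k₁, 0, …, 0), …, (0, …, 0, k_{n-1}, 0)` with non-zero integers `kᵢ`. -/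
structure IsStandard : Prop where
  irreducible : LieModule.IsIrreducible ℂ (JD F N) V
  finiteWeights : HasFiniteWeights (JD.cartan F H (N := N)) V
  centralOps : ∃ (k : Fin N → ℤ) (z : Fin N → Module.End ℂ V), ∀ i,
    k i ≠ 0 ∧ IsCentralOp F N (z i) ∧ z i ≠ 0 ∧ HasDegree F N (z i) (Pi.single i.castSucc (k i))

variable {V} in
/-- `W` is a maximal `J ⊕ ℂ d_n`-submodule of `V` such that the irreducible `J ⊕ ℂ d_n`-module
`V / W` has finite-dimensional weight spaces with respect to `h_{n-1}`. -/
structure IsGoodMaximal (W : LieSubmodule ℂ (JD.sub F N) V) : Prop where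
  irreducible : LieModule.IsIrreducible ℂ (JD.sub F N) (V ⧸ W)
  finiteWeights : HasFiniteWeights (JD.subCartan F N H) (V ⧸ W)

/-- The central element `K_n ⊗ t^m` of `J`, as an element of `J ⊕ ℂ d_n`. -/
def JD.subK {N : ℕ} (m : Fin N → ℤ) : JD.sub F N :=
  JD.inclJ F N (Loop.of m (CentralExt.cen F affTwist 1))

/-- `V` is isomorphic to a component of the `L`-module `M`: there is a decomposition of `M` as a
finite direct sum of irreducible submodules, one of which is isomorphic to `V`. -/
def IsComponent (L : Type*) [LieRing L] [LieAlgebra ℂ L] (V M : Type*)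
    [AddCommGroup V] [Module ℂ V] [LieRingModule L V] [LieModule ℂ L V]
    [AddCommGroup M] [Module ℂ M] [LieRingModule L M] [LieModule ℂ L M] : Prop :=
  ∃ (p : ℕ) (S : Fin p → LieSubmodule ℂ L M),
    (∀ j, LieModule.IsIrreducible ℂ L (S j)) ∧
    DirectSum.IsInternal (fun j => (S j).toSubmodule) ∧
    ∃ j, Nonempty (V ≃ₗ⁅ℂ, L⁆ S j)

end JDModules

end ToroidalLie
end

open ToroidalLie

/-! Modules over `J ⊕ D`. On an irreducible module a non-zero operator that commutes with `J` and
only shifts degrees is bijective, because its kernel and range are submodules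
(`bijective_of_lie_eq`). So the `zᵢ` generate a commutative group of invertible operators. The
eigenvalues of `d₁, …, d_{n-1}` on `V` lie in one coset `α + ℤ^{n-1}`, and this grading is periodic
along a sublattice of finite index. Imposing `zᵢ = 1` kills no homogeneous vector
(`exists_projection`), so the sum of the ranges of `zᵢ - 1` is a proper `J ⊕ ℂ d_n`-submodule. One
homogeneous vector generates `V` over `J ⊕ ℂ d_n`, hence Zorn gives a maximal `W` above that sum.
Modulo `W` every degree can be moved into a finite box, which bounds the weight spaces of `V / W`.
For an arbitrary good `W`, Schur's lemma makes central operators scalar on `V / W`, and invertible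
ones non-zero scalars. The maps `f_l : v ↦ v̄(j + l)`, for `v` of degree `j`, embed `V` in the loop
module up to a shift of degree by `l`. Their images are simple, `f_0` is a genuine module map, and
the `l` in a finite box already exhaust the loop module. A finite sum of simple submodules is a
direct sum of some of them, among which the image of `f_0` may be kept. Modules over `τ`. Take `h`
in the Cartan subalgebra with `(h, h) = 1`. Then `[h(r), h(s)] = ∑ rᵢ t^{r+s} Kᵢ`, and each such
central operator is zero or invertible. Let `Λ` be the saturation of the subgroup generated by the
degrees of the non-zero ones. Two facts carry the reduction. If `∑ rᵢ t^m Kᵢ` acts non-trivially,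
then `r ∉ Λ`: otherwise a Weyl pair would act on a periodic chain of finite-dimensional weight
spaces, which a trace computation forbids (`eq_bot_of_weyl`, `nsmul_notMem_periods`). And `ℤ^n / Λ`
has rank one: two independent directions would give infinitely many commuting oscillators, and
products of two of them, applied to a common eigenvector of the number operators, would fill a
single weight space with infinitely many independent vectors (`false_of_independent`). Hence `Λ` is
the kernel of a surjective linear form, and some `B ∈ GL(n, ℤ)` turns this form into the last
coordinate (`exists_gl`). The action twisted by `B` then does not see the kernel of `φ` and descends
to `J ⊕ D`; multiples of the first `n - 1` basis vectors are degrees of invertible central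
operators. -/

noncomputable section

namespace ToroidalLie

universe u v

/-! ### Simultaneous eigenspaces and direct sum decompositions -/

section Eigen

variable {ι V : Type*} [AddCommGroup V] [Module ℂ V]

/-- The simultaneous eigenspace of a family of operators. -/
def simEigen (f : ι → Module.End ℂ V) (β : ι → ℂ) : Submodule ℂ V where
  carrier := {v | ∀ i, f i v = β i • v}
  add_mem' {v w} hv hw i := by rw [map_add, hv i, hw i, smul_add]
  zero_mem' i := by simp
  smul_mem' c v hv i := by rw [map_smul, hv i, smul_comm]

/-- Induction on the number of eigenvalue systems: if `β` and `β₀` differ at `i`, applying `f i - β₀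
i` to the relation removes the `β₀`-term and multiplies the `β`-term by a non-zero number. -/
lemma simEigen_sum_eq_zero (f : ι → Module.End ℂ V) (s : Finset (ι → ℂ)) :
    ∀ v : (ι → ℂ) → V, (∀ β ∈ s, v β ∈ simEigen f β) → ∑ β ∈ s, v β = 0 → ∀ β ∈ s, v β = 0 := by
  classical
  induction s using Finset.induction_on with
  | empty => simp
  | insert β₀ s hβ₀ ih =>
    intro v hv hs
    have key : ∀ β ∈ s, v β = 0 := by
      intro β hβ
      have hne : β ≠ β₀ := fun h => hβ₀ (h ▸ hβ)
      obtain ⟨i, hi⟩ := Function.ne_iff.mp hne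
      have h := ih (fun γ => (γ i - β₀ i) • v γ)
        (fun γ hγ => Submodule.smul_mem _ _ (hv γ (Finset.mem_insert_of_mem hγ))) (by
          have e : f i (∑ γ ∈ insert β₀ s, v γ) - β₀ i • ∑ γ ∈ insert β₀ s, v γ = 0 := by
            rw [hs]; simp
          rw [map_sum, Finset.smul_sum, ← Finset.sum_sub_distrib,
            Finset.sum_insert hβ₀, hv β₀ (Finset.mem_insert_self _ _) i, sub_self, zero_add] at e
          rw [← e]
          refine Finset.sum_congr rfl fun γ hγ => ?_
          rw [hv γ (Finset.mem_insert_of_mem hγ) i, sub_smul]) β hβ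
      exact (smul_eq_zero.mp h).resolve_left (sub_ne_zero.mpr hi)
    intro β hβ
    rcases Finset.mem_insert.mp hβ with rfl | h
    · rw [Finset.sum_insert hβ₀, Finset.sum_eq_zero key, add_zero] at hs
      exact hs
    · exact key β h

lemma iSupIndep_simEigen (f : ι → Module.End ℂ V) : iSupIndep (simEigen f) := by
  rw [iSupIndep_iff_finsetSum_eq_zero_imp_eq_zero]
  intro s v hv hs
  exact simEigen_sum_eq_zero f s v hv hs

/-- If the submodules `A i ≤ E i` span and the `E i` are independent, then `A i = E i`. -/
lemma eq_of_iSupIndep_of_iSup_eq_top {κ : Type*} {A E : κ → Submodule ℂ V} (hE : iSupIndep E)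
    (hA : ∀ i, A i ≤ E i) (h : ⨆ i, A i = ⊤) (i : κ) : E i = A i := by
  refine le_antisymm ?_ (hA i)
  have h1 : (⊤ : Submodule ℂ V) ≤ A i ⊔ ⨆ (j) (_ : j ≠ i), E j := by
    rw [← h]
    refine iSup_le fun j => ?_
    by_cases hj : j = i
    · subst hj; exact le_sup_left
    · exact (hA j).trans (le_sup_of_le_right (le_iSup₂_of_le j hj le_rfl))
  -- The modular law for `A i ≤ E i`; by independence the second term on the right is zero.
  have h2 : E i ≤ A i ⊔ (E i ⊓ ⨆ (j) (_ : j ≠ i), E j) := by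
    intro x hx
    obtain ⟨a, ha, b, hb, rfl⟩ := Submodule.mem_sup.mp (h1 (Submodule.mem_top (x := x)))
    refine Submodule.mem_sup.mpr ⟨a, ha, b, ⟨?_, hb⟩, rfl⟩
    have := (E i).sub_mem hx (hA i ha)
    simpa using this
  rw [(hE i).eq_bot, sup_bot_eq] at h2
  exact h2

/-- Linear maps prescribed on the components of a direct sum decomposition glue. -/
lemma exists_linearMap_of_isInternal {κ N : Type*} [AddCommGroup N] [Module ℂ N]
    {A : κ → Submodule ℂ V} (hi : iSupIndep A) (h : ⨆ i, A i = ⊤) (g : κ → V →ₗ[ℂ] N) :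
    ∃ f : V →ₗ[ℂ] N, ∀ i, ∀ v ∈ A i, f v = g i v := by
  classical
  have hint : DirectSum.IsInternal A :=
    (DirectSum.isInternal_submodule_iff_iSupIndep_and_iSup_eq_top A).mpr ⟨hi, h⟩
  let e := LinearEquiv.ofBijective (DirectSum.coeLinearMap A) hint
  refine ⟨DirectSum.toModule ℂ κ N (fun i => g i ∘ₗ (A i).subtype) ∘ₗ e.symm.toLinearMap,
    fun i v hv => ?_⟩
  have : e.symm v = DirectSum.lof ℂ κ (fun i => A i) i ⟨v, hv⟩ := by
    rw [LinearEquiv.symm_apply_eq]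
    exact (DirectSum.coeLinearMap_lof A i ⟨v, hv⟩).symm
  simp [this]

end Eigen

/-! ### Irreducible modules and Schur's lemma -/

section Irreducible

variable {L : Type*} [LieRing L] [LieAlgebra ℂ L]
variable {V : Type*} [AddCommGroup V] [Module ℂ V] [LieRingModule L V] [LieModule ℂ L V]

/-- The map `x ↦ ⁅x, v⁆`. -/
def lieAct (L : Type*) [LieRing L] [LieAlgebra ℂ L] {V : Type*} [AddCommGroup V] [Module ℂ V]
    [LieRingModule L V] [LieModule ℂ L V] (v : V) : L →ₗ[ℂ] V where
  toFun x := ⁅x, v⁆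
  map_add' x y := add_lie x y v
  map_smul' c x := smul_lie c x v

/-- A Lie submodule with given underlying subspace. -/
def lieSubmoduleOf (U : Submodule ℂ V) (h : ∀ (x : L), ∀ v ∈ U, ⁅x, v⁆ ∈ U) : LieSubmodule ℂ L V :=
  { U with lie_mem := fun {x v} hv => h x v hv }

/-- The form in which irreducibility is used below: `U` is a plain subspace, so kernels, ranges and
preimages under maps that are not module homomorphisms qualify. -/
lemma eq_top_of_lie_mem (hV : LieModule.IsIrreducible ℂ L V) (U : Submodule ℂ V)
    (h : ∀ (x : L), ∀ v ∈ U, ⁅x, v⁆ ∈ U) {v : V} (hv : v ∈ U) (hv0 : v ≠ 0) : U = ⊤ := by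
  rcases eq_bot_or_eq_top (lieSubmoduleOf U h) with hb | ht
  · have : v ∈ lieSubmoduleOf U h := hv
    rw [hb, LieSubmodule.mem_bot] at this
    exact absurd this hv0
  · rw [eq_top_iff]
    intro w _
    have : w ∈ lieSubmoduleOf U h := by rw [ht]; trivial
    exact this

/-- A non-zero operator on an irreducible module that commutes with the action up to multiples of
itself is bijective. -/
lemma bijective_of_lie_eq (hV : LieModule.IsIrreducible ℂ L V) {T : Module.End ℂ V} (hT : T ≠ 0)
    (h : ∀ x : L, ∃ c : ℂ, ∀ v, ⁅x, T v⁆ = T ⁅x, v⁆ + c • T v) : Function.Bijective T := by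
  constructor
  · rw [← LinearMap.ker_eq_bot]
    rw [Submodule.eq_bot_iff]
    intro v hv
    by_contra hv0
    have := eq_top_of_lie_mem hV (LinearMap.ker T) (fun x w hw => by
      obtain ⟨c, hc⟩ := h x
      have := hc w
      rw [LinearMap.mem_ker] at hw ⊢
      rw [hw] at this
      simpa using this.symm) hv hv0
    exact hT (LinearMap.ker_eq_top.mp this)
  · obtain ⟨v, hv⟩ : ∃ v, T v ≠ 0 := by
      by_contra hcon
      push Not at hcon
      exact hT (LinearMap.ext hcon)
    rw [← LinearMap.range_eq_top]
    refine eq_top_of_lie_mem hV (LinearMap.range T) ?_ (LinearMap.mem_range_self T v) hv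
    rintro x _ ⟨w, rfl⟩
    obtain ⟨c, hc⟩ := h x
    rw [hc w]
    exact add_mem (LinearMap.mem_range_self _ _) (Submodule.smul_mem _ _ (LinearMap.mem_range_self _ _))

/-- Schur's lemma for an endomorphism that preserves a non-zero finite-dimensional subspace. -/
lemma exists_scalar_of_finiteDimensional (hV : LieModule.IsIrreducible ℂ L V) {T : Module.End ℂ V}
    (h : ∀ (x : L) v, ⁅x, T v⁆ = T ⁅x, v⁆) (U : Submodule ℂ V) [FiniteDimensional ℂ U] (hU : U ≠ ⊥)
    (hT : ∀ v ∈ U, T v ∈ U) : ∃ c : ℂ, ∀ v, T v = c • v := by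
  have : Nontrivial U := Submodule.nontrivial_iff_ne_bot.mpr hU
  obtain ⟨c, hc⟩ := Module.End.exists_eigenvalue (T.restrict hT)
  obtain ⟨w, hw⟩ := hc.exists_hasEigenvector
  have hw' : T w = c • (w : V) := congrArg Subtype.val hw.apply_eq_smul
  refine ⟨c, ?_⟩
  -- The eigenspace of `T` on all of `V` is a submodule, and the eigenvector found in `U` shows that
  -- it is non-zero.
  have := eq_top_of_lie_mem hV (LinearMap.ker (T - algebraMap ℂ _ c)) (fun x v hv => by
      rw [LinearMap.mem_ker, LinearMap.sub_apply, Module.algebraMap_end_apply, sub_eq_zero] at hv ⊢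
      rw [← h, hv, lie_smul]) (v := w) (by
      rw [LinearMap.mem_ker, LinearMap.sub_apply, Module.algebraMap_end_apply, hw', sub_self])
      (fun h0 => hw.2 (Subtype.ext h0))
  intro v
  have hv : v ∈ LinearMap.ker (T - algebraMap ℂ _ c) := by rw [this]; trivial
  rwa [LinearMap.mem_ker, LinearMap.sub_apply, Module.algebraMap_end_apply, sub_eq_zero] at hv

lemma iSupIndep_wtSpace (T : Submodule ℂ L) : iSupIndep (wtSpace T V) :=
  (iSupIndep_simEigen (fun h : T => LieModule.toEnd ℂ L V h)).comp
    (f := fun χ : T →ₗ[ℂ] ℂ => (χ : T → ℂ)) DFunLike.coe_injective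

lemma HasFiniteWeights.exists_wtSpace_ne_bot [Nontrivial V] {T : Submodule ℂ L}
    (h : HasFiniteWeights T V) : ∃ χ, wtSpace T V χ ≠ ⊥ := by
  by_contra hcon
  push Not at hcon
  have := h.1
  simp only [hcon, iSup_bot] at this
  exact bot_ne_top this

/-- An operator commuting with the action preserves every weight space, and some weight space is
non-zero and finite-dimensional. -/
lemma HasFiniteWeights.exists_scalar (hV : LieModule.IsIrreducible ℂ L V) {T : Submodule ℂ L}
    (hf : HasFiniteWeights T V) {z : Module.End ℂ V} (h : ∀ (x : L) v, ⁅x, z v⁆ = z ⁅x, v⁆) :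
    ∃ c : ℂ, ∀ v, z v = c • v := by
  have : Nontrivial V := LieModule.nontrivial_of_isIrreducible ℂ L V
  obtain ⟨χ, hχ⟩ := hf.exists_wtSpace_ne_bot
  have := hf.2 χ
  refine exists_scalar_of_finiteDimensional hV h _ hχ fun v hv x => ?_
  rw [h, hv x, map_smul]

end Irreducible

/-! ### Operators that commute with the ideal and shift the degree -/

section QuasiCentral

variable {K : Type*} [LieRing K] [LieAlgebra ℂ K] {n : ℕ} (ψ : Der n →ₗ⁅ℂ⁆ LieDerivation ℂ K K)
variable {V : Type*} [AddCommGroup V] [Module ℂ V] [LieRingModule (K ⋊⁅ψ⁆ Der n) V]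
  [LieModule ℂ (K ⋊⁅ψ⁆ Der n) V]

/-- The operator `T` commutes with `K` and has degree `m` with respect to `D`. -/
def IsQuasiCentral (m : Fin n → ℤ) (T : Module.End ℂ V) : Prop :=
  ∀ (x : K ⋊⁅ψ⁆ Der n) (v : V), ⁅x, T v⁆ = T ⁅x, v⁆ + Der.deg x.right m • T v

variable {ψ}

namespace IsQuasiCentral

lemma bijective (hV : LieModule.IsIrreducible ℂ (K ⋊⁅ψ⁆ Der n) V) {m : Fin n → ℤ}
    {T : Module.End ℂ V} (h : IsQuasiCentral ψ m T) (hT : T ≠ 0) : Function.Bijective T :=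
  bijective_of_lie_eq hV hT fun x => ⟨_, h x⟩

lemma one : IsQuasiCentral ψ 0 (1 : Module.End ℂ V) := fun x v => by simp

lemma mul {m m' : Fin n → ℤ} {S T : Module.End ℂ V} (hS : IsQuasiCentral ψ m S)
    (hT : IsQuasiCentral ψ m' T) : IsQuasiCentral ψ (m + m') (S * T) := fun x v => by
  rw [Module.End.mul_apply, hS, hT, map_add, map_add, map_smul, add_smul, Module.End.mul_apply]
  abel

lemma inv {m : Fin n → ℤ} {S T : Module.End ℂ V} (hS : IsQuasiCentral ψ m S) (h : S * T = 1)
    (h' : T * S = 1) : IsQuasiCentral ψ (-m) T := fun x v => by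
  have e : ∀ v, S (T v) = v := fun v => congrArg (fun g => g v) h
  have e' : ∀ v, T (S v) = v := fun v => congrArg (fun g => g v) h'
  have := congrArg T (hS x (T v))
  rw [e, map_add, e', map_smul] at this
  rw [this, map_neg]
  simp

end IsQuasiCentral

end QuasiCentral

end ToroidalLie

end

/-! ### Central operators on `J ⊕ D`-modules and the grading by `d₁, …, d_{n-1}` -/

noncomputable section

namespace ToroidalLie

universe u v

lemma Der.eq_sum_coeff_smul_d {n : ℕ} (a : Der n) : a = ∑ i, Der.coeff i a • Der.d i := by
  have : ∀ i, Der.coeff i a • Der.d i = (Pi.single i (Der.coeff i a) : Fin n → ℂ) := by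
    intro i
    change Der.coeff i a • (Pi.single i 1 : Fin n → ℂ) = _
    rw [← Pi.single_smul, smul_eq_mul, mul_one]
  simp only [this]
  exact (Finset.univ_sum_single (a : Fin n → ℂ)).symm

lemma Der.deg_d {n : ℕ} (i : Fin n) (m : Fin n → ℤ) : Der.deg (Der.d i) m = m i := by
  rw [Der.deg_apply]
  simp

lemma Loop.mem_of_forall_of {P L : Type*} [AddCommGroup P] [LieRing L] [LieAlgebra ℂ L]
    (S : Submodule ℂ (Loop P L)) (h : ∀ r X, Loop.of r X ∈ S) (x : Loop P L) : x ∈ S := by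
  have : S.mkQ = 0 := Loop.hom_ext fun r => LinearMap.ext fun X => by
    simpa using h r X
  have := congrArg (fun g => g x) this
  simpa using this

lemma LoopSpace.mem_of_forall_of {P M : Type*} [AddCommGroup M] [Module ℂ M]
    (S : Submodule ℂ (LoopSpace P M)) (h : ∀ r v, LoopSpace.of r v ∈ S) (x : LoopSpace P M) :
    x ∈ S := by
  have : S.mkQ = 0 := LoopSpace.hom_ext fun r => LinearMap.ext fun v => by
    simpa using h r v
  have := congrArg (fun g => g x) this
  simpa using this

section SemiDirect

variable {K : Type*} [LieRing K] [LieAlgebra ℂ K] {n : ℕ} {ψ : Der n →ₗ⁅ℂ⁆ LieDerivation ℂ K K}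

lemma semiDirect_eq_add (x : K ⋊⁅ψ⁆ Der n) :
    x = ⟨x.left, 0⟩ + ∑ i, Der.coeff i x.right • (⟨0, Der.d i⟩ : K ⋊⁅ψ⁆ Der n) := by
  have h : ∑ i, Der.coeff i x.right • (⟨0, Der.d i⟩ : K ⋊⁅ψ⁆ Der n) =
      LieAlgebra.SemiDirectSum.inr ψ x.right := by
    conv_rhs => rw [Der.eq_sum_coeff_smul_d x.right, map_sum]
    refine Finset.sum_congr rfl fun i _ => ?_
    rw [map_smul]; rfl
  rw [h]
  ext <;> simp

lemma semiDirect_mem (S : Submodule ℂ (K ⋊⁅ψ⁆ Der n)) (h₁ : ∀ y, (⟨y, 0⟩ : K ⋊⁅ψ⁆ Der n) ∈ S)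
    (h₂ : ∀ i, (⟨0, Der.d i⟩ : K ⋊⁅ψ⁆ Der n) ∈ S) (x : K ⋊⁅ψ⁆ Der n) : x ∈ S := by
  rw [semiDirect_eq_add x]
  exact add_mem (h₁ _) (sum_mem fun i _ => S.smul_mem _ (h₂ i))

variable {V : Type*} [AddCommGroup V] [Module ℂ V] [LieRingModule (K ⋊⁅ψ⁆ Der n) V]
  [LieModule ℂ (K ⋊⁅ψ⁆ Der n) V]

lemma IsQuasiCentral.of_lie {m : Fin n → ℤ} {T : Module.End ℂ V}
    (h₁ : ∀ (y : K) (v : V), ⁅(⟨y, 0⟩ : K ⋊⁅ψ⁆ Der n), T v⁆ = T ⁅(⟨y, 0⟩ : K ⋊⁅ψ⁆ Der n), v⁆)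
    (h₂ : ∀ (i : Fin n) (v : V), ⁅(⟨0, Der.d i⟩ : K ⋊⁅ψ⁆ Der n), T v⁆ =
      T ⁅(⟨0, Der.d i⟩ : K ⋊⁅ψ⁆ Der n), v⁆ + (m i : ℂ) • T v) : IsQuasiCentral ψ m T := by
  intro x v
  conv_lhs => rw [semiDirect_eq_add x]
  conv_rhs => rw [semiDirect_eq_add x]
  rw [add_lie, h₁, add_lie, map_add, add_assoc, sum_lie, sum_lie, map_sum]
  congr 1
  have hd : Der.deg (⟨x.left, 0⟩ + ∑ i, Der.coeff i x.right • (⟨0, Der.d i⟩ : K ⋊⁅ψ⁆ Der n)).right m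
      = Der.deg x.right m := by rw [← semiDirect_eq_add x]
  rw [hd, Der.deg_apply, Finset.sum_smul, ← Finset.sum_add_distrib]
  refine Finset.sum_congr rfl fun i _ => ?_
  rw [smul_lie, h₂, smul_add, smul_lie, map_smul, smul_smul]

end SemiDirect

section JDBasics

variable {𝔤 : Type u} [LieRing 𝔤] [LieAlgebra ℂ 𝔤] (F : InvForm 𝔤) {N : ℕ}

lemma JD.mem_of_forall (S : Submodule ℂ (JD F N))
    (h₁ : ∀ m y, (⟨Loop.of m y, 0⟩ : JD F N) ∈ S) (h₂ : ∀ i, JD.d F i ∈ S) (x : JD F N) : x ∈ S := by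
  refine semiDirect_mem S (fun y => ?_) h₂ x
  exact Loop.mem_of_forall_of (S.comap (LieAlgebra.SemiDirectSum.inl (jDer F N)).toLinearMap) h₁ y

lemma JD.d_lie_loop (i : Fin N) (m : Fin N → ℤ) (y : Affine F) :
    ⁅JD.d F i.castSucc, (⟨Loop.of m y, 0⟩ : JD F N)⁆ = (m i : ℂ) • (⟨Loop.of m y, 0⟩ : JD F N) := by
  have h : jDer F N (Der.d i.castSucc) (Loop.of m y) = (m i : ℂ) • Loop.of m y := by
    change Loop.derOp (affDer F) (Der.d i.castSucc) (Loop.of m y) = _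
    rw [Loop.derOp_of, Der.coeff_d, if_neg (Fin.castSucc_ne_last i).symm, zero_smul, add_zero]
    congr 1
    rw [Der.deg_apply]
    have : ∀ j, Der.coeff j (Der.init (Der.d i.castSucc)) = if j = i then 1 else 0 := by
      intro j
      change Der.coeff j.castSucc (Der.d i.castSucc) = _
      rw [Der.coeff_d]
      simp
    simp [this]
  simp [JD.d, h]

lemma JD.d_lie_d (i j : Fin (N + 1)) : ⁅JD.d F i, (JD.d F j : JD F N)⁆ = 0 := by
  simp [JD.d, Der.lie_eq_zero (Der.d i)]

lemma JD.K_lie_loop (m : Fin N → ℤ) (x : LoopAffine F N) :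
    ⁅JD.K F m, (⟨x, 0⟩ : JD F N)⁆ = 0 := by
  have h : ⁅(Loop.of m (CentralExt.cen F affTwist 1) : LoopAffine F N), x⁆ = 0 := by
    have := Loop.mem_of_forall_of (LinearMap.ker (brk (LoopAffine F N)
      (Loop.of m (CentralExt.cen F affTwist 1)))) (fun r X => by
        rw [LinearMap.mem_ker, brk_apply, Loop.of_lie_of, CentralExt.cen_lie, map_zero]) x
    simpa using this
  simp [JD.K, h]

variable {V : Type v} [AddCommGroup V] [Module ℂ V] [LieRingModule (JD F N) V]
  [LieModule ℂ (JD F N) V]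

variable {F}

lemma IsCentralOp.lie_loop {z : Module.End ℂ V} (hz : IsCentralOp F N z) (x : LoopAffine F N)
    (v : V) : ⁅(⟨x, 0⟩ : JD F N), z v⁆ = z ⁅(⟨x, 0⟩ : JD F N), v⁆ := by
  induction hz generalizing v with
  | scalar c => simp
  | central m =>
    have := leibniz_lie (JD.K F m) (⟨x, 0⟩ : JD F N) v
    rw [JD.K_lie_loop, zero_lie, zero_add] at this
    exact this.symm
  | add _ _ h₁ h₂ => rw [LinearMap.add_apply, lie_add, h₁, h₂]; rfl
  | mul _ _ h₁ h₂ => rw [Module.End.mul_apply, h₁, h₂]; rfl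
  | @inv S T _ h h' h₁ =>
    have e : ∀ v, S (T v) = v := fun v => congrArg (fun g => g v) h
    have e' : ∀ v, T (S v) = v := fun v => congrArg (fun g => g v) h'
    rw [← e' ⁅(⟨x, 0⟩ : JD F N), T v⁆, ← h₁, e]

/-- Central operators are built from scalars and elements of `J`, so whatever commutes with `J`
commutes with them. Together with `IsCentralOp.lie_loop` this makes any two central operators
commute. -/
lemma IsCentralOp.commute {z : Module.End ℂ V} (hz : IsCentralOp F N z) {T : Module.End ℂ V}
    (hT : ∀ (x : LoopAffine F N) (v : V), ⁅(⟨x, 0⟩ : JD F N), T v⁆ = T ⁅(⟨x, 0⟩ : JD F N), v⁆) :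
    Commute z T := by
  induction hz with
  | scalar c => exact Algebra.commutes c T
  | central m => exact LinearMap.ext fun v => hT _ v
  | add _ _ h₁ h₂ => exact h₁.add_left h₂
  | mul _ _ h₁ h₂ => exact h₁.mul_left h₂
  | inv _ h h' h₁ =>
    exact Commute.units_inv_left (u := ⟨_, _, h, h'⟩) h₁

lemma IsCentralOp.isQuasiCentral {z : Module.End ℂ V} (hz : IsCentralOp F N z)
    {m : Fin (N + 1) → ℤ} (h : HasDegree F N z m) : IsQuasiCentral (jDer F N) m z :=
  IsQuasiCentral.of_lie (fun x v => hz.lie_loop x v) h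

variable (F) in
/-- The simultaneous eigenspaces of `d₁, …, d_{n-1}`. -/
def grade (β : Fin N → ℂ) : Submodule ℂ V :=
  simEigen (fun i : Fin N => LieModule.toEnd ℂ (JD F N) V (JD.d F i.castSucc)) β

lemma mem_grade {β : Fin N → ℂ} {v : V} :
    v ∈ grade F β ↔ ∀ i : Fin N, ⁅(JD.d F i.castSucc : JD F N), v⁆ = β i • v := Iff.rfl

/-- The translate of `α` by an integer vector. -/
def addInt (α : Fin N → ℂ) (k : Fin N → ℤ) : Fin N → ℂ := fun i => α i + k i

lemma addInt_injective (α : Fin N → ℂ) : Function.Injective (addInt α) := fun k k' h => by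
  funext i
  have := congrFun h i
  simpa [addInt] using this

lemma loop_lie_mem_grade {α : Fin N → ℂ} {k m : Fin N → ℤ} {y : Affine F} {v : V}
    (hv : v ∈ grade F (addInt α k)) :
    ⁅(⟨Loop.of m y, 0⟩ : JD F N), v⁆ ∈ grade F (addInt α (m + k)) := fun i => by
  change ⁅(JD.d F i.castSucc : JD F N), _⁆ = _
  rw [leibniz_lie, JD.d_lie_loop, smul_lie, mem_grade.mp hv i, lie_smul, ← add_smul]
  congr 1
  simp [addInt]; ring

lemma d_lie_mem_grade {β : Fin N → ℂ} {v : V} (j : Fin (N + 1))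
    (hv : v ∈ grade F β) : ⁅(JD.d F j : JD F N), v⁆ ∈ grade F β := fun i => by
  change ⁅(JD.d F i.castSucc : JD F N), _⁆ = _
  rw [leibniz_lie, JD.d_lie_d, zero_lie, zero_add, mem_grade.mp hv i, lie_smul]

lemma IsQuasiCentral.mem_grade {α : Fin N → ℂ} {k : Fin N → ℤ} {m : Fin (N + 1) → ℤ}
    {T : Module.End ℂ V} (hT : IsQuasiCentral (jDer F N) m T) {v : V}
    (hv : v ∈ grade F (addInt α k)) :
    T v ∈ grade F (addInt α (k + fun i => m i.castSucc)) := fun i => by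
  change ⁅(JD.d F i.castSucc : JD F N), _⁆ = _
  rw [hT, ToroidalLie.mem_grade.mp hv i, map_smul, ← add_smul]
  congr 1
  change _ + Der.deg (Der.d _) m = _
  rw [Der.deg_d]
  simp [addInt]; ring

lemma iSupIndep_grade : iSupIndep (fun β => grade F β : (Fin N → ℂ) → Submodule ℂ V) :=
  iSupIndep_simEigen _

lemma iSupIndep_grade_addInt (α : Fin N → ℂ) :
    iSupIndep (fun k => grade F (addInt α k) : (Fin N → ℤ) → Submodule ℂ V) :=
  iSupIndep_grade.comp (addInt_injective α)

/-- The generators of `J ⊕ D` shift degrees by integer vectors, so the sum over one coset of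
`ℤ^{n-1}` is a submodule. -/
lemma iSup_grade_eq_top (hV : LieModule.IsIrreducible ℂ (JD F N) V) {α : Fin N → ℂ} {v : V}
    (hv : v ∈ grade F α) (hv0 : v ≠ 0) : ⨆ k, (grade F (addInt α k) : Submodule ℂ V) = ⊤ := by
  have hv' : v ∈ ⨆ k, (grade F (addInt α k) : Submodule ℂ V) := by
    refine Submodule.mem_iSup_of_mem 0 ?_
    have : addInt α 0 = α := by funext i; simp [addInt]
    rwa [this]
  refine eq_top_of_lie_mem hV _ (fun x w hw => ?_) hv' hv0
  induction hw using Submodule.iSup_induction' with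
  | mem k w hw =>
    refine JD.mem_of_forall F (Submodule.comap (lieAct (JD F N) w)
      (⨆ k, (grade F (addInt α k) : Submodule ℂ V))) (fun m y => ?_) (fun j => ?_) x
    · exact Submodule.mem_iSup_of_mem _ (loop_lie_mem_grade hw)
    · exact Submodule.mem_iSup_of_mem _ (d_lie_mem_grade j hw)
  | zero => simp
  | add w w' _ _ h h' => rw [lie_add]; exact add_mem h h'

variable (F) in
lemma mem_wtSpace_cartan {H : LieSubalgebra ℂ 𝔤} {χ : JD.cartan F H (N := N) →ₗ[ℂ] ℂ} {v : V}
    (hv : v ∈ wtSpace (JD.cartan F H (N := N)) V χ) :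
    ∃ β : Fin N → ℂ, v ∈ grade F β :=
  ⟨fun i => χ ⟨JD.d F i.castSucc, Submodule.subset_span (Or.inr ⟨_, rfl⟩)⟩, fun i => hv ⟨JD.d F i.castSucc, Submodule.subset_span (Or.inr ⟨_, rfl⟩)⟩⟩

lemma exists_grading (hV : LieModule.IsIrreducible ℂ (JD F N) V) {H : LieSubalgebra ℂ 𝔤}
    (hf : HasFiniteWeights (JD.cartan F H (N := N)) V) :
    ∃ α : Fin N → ℂ, ⨆ k, (grade F (addInt α k) : Submodule ℂ V) = ⊤ := by
  have : Nontrivial V := LieModule.nontrivial_of_isIrreducible ℂ (JD F N) V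
  obtain ⟨χ, hχ⟩ := hf.exists_wtSpace_ne_bot
  obtain ⟨v, hv, hv0⟩ := Submodule.exists_mem_ne_zero_of_ne_bot hχ
  obtain ⟨β, hβ⟩ := mem_wtSpace_cartan F hv
  exact ⟨β, iSup_grade_eq_top hV hβ hv0⟩

/-- A non-zero eigenvector of `d₁, …, d_{n-1}` lies in one of the components of the grading. -/
lemma exists_eq_addInt {α β : Fin N → ℂ} {v : V}
    (h : ⨆ k, (grade F (addInt α k) : Submodule ℂ V) = ⊤) (hv : v ∈ grade F β) (hv0 : v ≠ 0) :
    ∃ k, β = addInt α k := by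
  by_contra hcon
  push Not at hcon
  have hd : Disjoint (grade F β : Submodule ℂ V) (⨆ (γ) (_ : γ ≠ β), grade F γ) :=
    iSupIndep_grade β
  have : (⊤ : Submodule ℂ V) ≤ ⨆ (γ) (_ : γ ≠ β), grade F γ := by
    rw [← h]
    exact iSup_le fun k => le_iSup₂_of_le (addInt α k) (hcon k).symm le_rfl
  rw [top_le_iff.mp this, disjoint_top] at hd
  rw [hd] at hv
  exact hv0 hv

end JDBasics

end ToroidalLie

end

/-! ### The group generated by invertible central operators -/

noncomputable section

namespace ToroidalLie

universe u v

open Multiplicative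

/-- The integer vector `m` extended by a last entry `0`. -/
def extZero {N : ℕ} : (Fin N → ℤ) →+ (Fin (N + 1) → ℤ) where
  toFun m := Fin.snoc (α := fun _ => ℤ) m 0
  map_zero' := by
    funext i
    refine Fin.lastCases ?_ (fun j => ?_) i <;> simp
  map_add' m m' := by
    funext i
    refine Fin.lastCases ?_ (fun j => ?_) i <;> simp

@[simp] lemma extZero_castSucc {N : ℕ} (m : Fin N → ℤ) (i : Fin N) :
    extZero m i.castSucc = m i := by simp [extZero]

@[simp] lemma extZero_last {N : ℕ} (m : Fin N → ℤ) : extZero m (Fin.last N) = 0 := by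
  simp [extZero]

lemma extZero_single {N : ℕ} (i : Fin N) (k : ℤ) :
    extZero (Pi.single i k) = Pi.single i.castSucc k := by
  funext j
  refine Fin.lastCases ?_ (fun j => ?_) j
  · simp [Fin.castSucc_ne_last]
  · simp [Pi.single_apply]

/-- Reduces a statement about all products of the `zᵢ` to the `zᵢ` themselves. It is applied with
`S` the operators scalar modulo `W`, and with `S` the pairs of an operator and its degree. -/
lemma hom_mem_of_forall_mulSingle {N : ℕ} {G : Type*} [Group G]
    (Δ : (Fin N → Multiplicative ℤ) →* G) (S : Subgroup G)
    (h : ∀ i, Δ (Pi.mulSingle i (ofAdd 1)) ∈ S) (g : Fin N → Multiplicative ℤ) : Δ g ∈ S := by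
  refine Pi.mulSingle_induction (fun g => Δ g ∈ S) g ?_ (fun f g hf hg => ?_) (fun i m => ?_)
  · simp [one_mem]
  · rw [map_mul]; exact mul_mem hf hg
  · have : (Pi.mulSingle i m : Fin N → Multiplicative ℤ) =
        (Pi.mulSingle i (ofAdd 1)) ^ (toAdd m) := by
      rw [← Pi.mulSingle_zpow, ← ofAdd_zsmul, smul_eq_mul, mul_one, ofAdd_toAdd]
    rw [this, map_zpow]
    exact zpow_mem (h i) _

lemma exists_hom_mulSingle {N : ℕ} {G : Type*} [Group G] (u : Fin N → G)
    (hc : ∀ i j, Commute (u i) (u j)) :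
    ∃ ζ : (Fin N → Multiplicative ℤ) →* G, ∀ i, ζ (Pi.mulSingle i (ofAdd 1)) = u i := by
  have h : Pairwise fun i j => ∀ x y : Multiplicative ℤ,
      Commute (zpowersHom G (u i) x) (zpowersHom G (u j) y) := fun i j _ x y => by
    rw [zpowersHom_apply, zpowersHom_apply]
    exact (hc i j).zpow_zpow _ _
  refine ⟨MonoidHom.noncommPiCoprod (fun i => zpowersHom G (u i)) h, fun i => ?_⟩
  rw [MonoidHom.noncommPiCoprod_mulSingle]
  simp

/-- The degree homomorphism `g ↦ (g₁ k₁, …, g_N k_N, 0)`. -/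
def degHom {N : ℕ} (k : Fin N → ℤ) :
    (Fin N → Multiplicative ℤ) →* Multiplicative (Fin (N + 1) → ℤ) where
  toFun g := ofAdd (extZero fun i => toAdd (g i) * k i)
  map_one' := by
    rw [← ofAdd_zero, ← map_zero extZero]
    congr 2; funext i; simp
  map_mul' g h := by
    rw [← ofAdd_add, ← map_add]
    congr 2; funext i; simp [add_mul]

lemma degHom_mulSingle {N : ℕ} (k : Fin N → ℤ) (i : Fin N) :
    degHom k (Pi.mulSingle i (ofAdd 1)) = ofAdd (Pi.single i.castSucc (k i)) := by
  change ofAdd (extZero _) = _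
  rw [← extZero_single]
  congr 2
  funext j
  by_cases h : j = i
  · subst h; simp
  · simp [h]

section Scalars

variable {V : Type*} [AddCommGroup V] [Module ℂ V]

/-- The invertible operators that act on `V / W` by a non-zero scalar. -/
def scalarMod (W : Submodule ℂ V) : Subgroup (Module.End ℂ V)ˣ where
  carrier := {u | ∃ c : ℂ, c ≠ 0 ∧ ∀ v, (u : Module.End ℂ V) v - c • v ∈ W}
  one_mem' := ⟨1, one_ne_zero, fun v => by simp⟩
  mul_mem' {a b} := by
    rintro ⟨c, hc, h⟩ ⟨d, hd, h'⟩
    refine ⟨c * d, mul_ne_zero hc hd, fun v => ?_⟩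
    have := add_mem (h ((b : Module.End ℂ V) v)) (W.smul_mem c (h' v))
    rw [smul_sub, smul_smul, sub_add_sub_cancel] at this
    exact this
  inv_mem' {a} := by
    rintro ⟨c, hc, h⟩
    refine ⟨c⁻¹, inv_ne_zero hc, fun v => ?_⟩
    have e : (a : Module.End ℂ V) ((a⁻¹ : (Module.End ℂ V)ˣ).val v) = v :=
      congrArg (fun g : Module.End ℂ V => g v) a.mul_inv
    have := W.smul_mem (-c⁻¹) (h ((a⁻¹ : (Module.End ℂ V)ˣ).val v))
    rw [e, smul_sub, neg_smul, neg_smul, smul_smul, inv_mul_cancel₀ hc, one_smul,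
      sub_neg_eq_add, neg_add_eq_sub] at this
    exact this

end Scalars

section Standard

variable {𝔤 : Type u} [LieRing 𝔤] [LieAlgebra ℂ 𝔤] {F : InvForm 𝔤} {N : ℕ}
variable {V : Type v} [AddCommGroup V] [Module ℂ V] [LieRingModule (JD F N) V]
  [LieModule ℂ (JD F N) V]

/-- The pairs of a degree and an invertible operator of that degree commuting with `J`. -/
def quasiCentralUnits (F : InvForm 𝔤) (N : ℕ) (V : Type v) [AddCommGroup V] [Module ℂ V]
    [LieRingModule (JD F N) V] [LieModule ℂ (JD F N) V] :
    Subgroup (Multiplicative (Fin (N + 1) → ℤ) × (Module.End ℂ V)ˣ) where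
  carrier := {p | IsQuasiCentral (jDer F N) (toAdd p.1) (p.2 : Module.End ℂ V)}
  one_mem' := IsQuasiCentral.one
  mul_mem' := fun h h' => h.mul h'
  inv_mem' {p} h := h.inv p.2.mul_inv p.2.inv_mul

/-- Invertible central operators of degrees `(k₁, 0, …), …` generate a group of operators of degrees
`(g₁ k₁, …, g_{n-1} k_{n-1}, 0)`. -/
lemma exists_unitsHom {k : Fin N → ℤ} {z : Fin N → Module.End ℂ V}
    (hz : ∀ i, IsCentralOp F N (z i)) (hb : ∀ i, Function.Bijective (z i))
    (hd : ∀ i, HasDegree F N (z i) (Pi.single i.castSucc (k i))) :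
    ∃ ζ : (Fin N → Multiplicative ℤ) →* (Module.End ℂ V)ˣ,
      (∀ i, (ζ (Pi.mulSingle i (ofAdd 1)) : Module.End ℂ V) = z i) ∧
      ∀ g, IsQuasiCentral (jDer F N) (extZero fun i => toAdd (g i) * k i)
        (ζ g : Module.End ℂ V) := by
  have hu : ∀ i, ∃ u : (Module.End ℂ V)ˣ, (u : Module.End ℂ V) = z i := fun i =>
    (Module.End.isUnit_iff (z i)).mpr (hb i)
  choose u hu using hu
  obtain ⟨ζ, hζ⟩ := exists_hom_mulSingle u fun i j => by
    have := (hz i).commute (hz j).lie_loop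
    rw [← hu, ← hu] at this
    exact Units.ext this
  refine ⟨ζ, fun i => by rw [hζ, hu], fun g => ?_⟩
  -- Degree and operator are carried along as one homomorphism into a product group, so that "`ζ g`
  -- has degree `degHom k g`" becomes membership in a subgroup.
  refine hom_mem_of_forall_mulSingle ((degHom k).prod ζ) (quasiCentralUnits F N V) (fun i => ?_) g
  change IsQuasiCentral (jDer F N) (toAdd (degHom k (Pi.mulSingle i (ofAdd 1))))
    ((ζ (Pi.mulSingle i (ofAdd 1))).val)
  rw [hζ, hu, degHom_mulSingle]
  exact (hz i).isQuasiCentral (hd i)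

/-- A linear map that identifies `v` with `zᵢ v` for all `i`, and does not kill homogeneous
vectors. -/
lemma exists_projection {α : Fin N → ℂ}
    (h : ⨆ k, (grade F (addInt α k) : Submodule ℂ V) = ⊤) {k : Fin N → ℤ} (hk : ∀ i, k i ≠ 0)
    {z : Fin N → Module.End ℂ V} {ζ : (Fin N → Multiplicative ℤ) →* (Module.End ℂ V)ˣ}
    (hz : ∀ i, (ζ (Pi.mulSingle i (ofAdd 1)) : Module.End ℂ V) = z i)
    (hζ : ∀ g, IsQuasiCentral (jDer F N) (extZero fun i => toAdd (g i) * k i)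
      (ζ g : Module.End ℂ V)) :
    ∃ P : V →ₗ[ℂ] V, (∀ i v, P (z i v) = P v) ∧
      ∀ j, ∀ v ∈ grade F (addInt α j), P v = 0 → v = 0 := by
  -- `P` moves the component of degree `j` back to the fundamental box: it applies the inverse of
  -- the product of the `zᵢ` to the powers given by the Euclidean quotients `j i / k i`.
  let γ : (Fin N → ℤ) → Fin N → Multiplicative ℤ := fun j i => ofAdd (j i / k i)
  obtain ⟨P, hP⟩ := exists_linearMap_of_isInternal (iSupIndep_grade_addInt (F := F) (V := V) α) h
    (fun j => ((ζ (γ j))⁻¹ : (Module.End ℂ V)ˣ).val)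
  refine ⟨P, fun i v => ?_, fun j v hv hv0 => ?_⟩
  · have hv : v ∈ ⨆ k, (grade F (addInt α k) : Submodule ℂ V) := by rw [h]; trivial
    induction hv using Submodule.iSup_induction' with
    | mem j v hv =>
      have hz' : z i v ∈ grade F (addInt α (j + Pi.single i (k i))) := by
        have := (hζ (Pi.mulSingle i (ofAdd 1))).mem_grade hv
        rw [hz] at this
        convert this using 3
        funext l
        by_cases hl : l = i
        · subst hl; simp
        · simp [hl]
      -- Adding `k i` to the `i`-th entry raises the quotient by one, so the extra factor of `P` on
      -- the degree of `z i v` cancels `z i`.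
      have e : γ (j + Pi.single i (k i)) = γ j * Pi.mulSingle i (ofAdd 1) := by
        funext l
        by_cases hl : l = i
        · subst hl
          simp only [γ, Pi.add_apply, Pi.single_eq_same, Pi.mul_apply, Pi.mulSingle_eq_same,
            ← ofAdd_add]
          rw [Int.add_ediv_of_dvd_right (dvd_refl _), Int.ediv_self (hk l)]
        · simp [γ, hl]
      rw [hP _ _ hz', hP _ _ hv, e, map_mul, mul_inv_rev, ← hz, ← Module.End.mul_apply,
        ← Units.val_mul, ← map_inv, ← map_inv, ← map_mul, ← map_mul]
      congr 3
      rw [mul_comm (Pi.mulSingle i _)⁻¹, mul_assoc, inv_mul_cancel, mul_one]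
    | zero => simp
    | add v w _ _ h₁ h₂ => rw [map_add, map_add, map_add, h₁, h₂]
  · rw [hP _ _ hv] at hv0
    have e : (ζ (γ j) : Module.End ℂ V) (((ζ (γ j))⁻¹ : (Module.End ℂ V)ˣ).val v) = v :=
      congrArg (fun g : Module.End ℂ V => g v) (ζ (γ j)).mul_inv
    rw [← e, hv0, map_zero]

end Standard

end ToroidalLie

end

/-! ### Irreducible quotients over `J ⊕ ℂ d_n` -/

noncomputable section

namespace ToroidalLie

universe u v

open Multiplicative

section Quotient

variable {𝔤 : Type u} [LieRing 𝔤] [LieAlgebra ℂ 𝔤] {F : InvForm 𝔤} {N : ℕ} {H : LieSubalgebra ℂ 𝔤}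
variable {V : Type v} [AddCommGroup V] [Module ℂ V] [LieRingModule (JD F N) V]
  [LieModule ℂ (JD F N) V]

/-- Elements of `J ⊕ ℂ d_n` have no `dᵢ`-component with `i < n`, and the degree of `T` has last
entry zero. So the shift vanishes and `T` is an endomorphism over `J ⊕ ℂ d_n`. -/
lemma IsQuasiCentral.sub_lie {m : Fin N → ℤ} {T : Module.End ℂ V}
    (hT : IsQuasiCentral (jDer F N) (extZero m) T) (x : JD.sub F N) (v : V) :
    ⁅x, T v⁆ = T ⁅x, v⁆ := by
  have h := hT x v
  have hd : Der.deg (x : JD F N).right (extZero m) = 0 := by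
    rw [Der.deg_apply, Fin.sum_univ_castSucc, extZero_last]
    simp [x.2 _]
  rw [hd, zero_smul, add_zero] at h
  exact h

variable (F N H) in
/-- The inclusion of the Cartan subalgebra of `J ⊕ ℂ d_n` in that of `J ⊕ D`. -/
def JD.subCartanIncl : JD.subCartan F N H →ₗ[ℂ] JD.cartan F H (N := N) where
  toFun x := ⟨(x : JD.sub F N), x.2⟩
  map_add' _ _ := rfl
  map_smul' _ _ := rfl

variable (F N) in
/-- The projection of `J ⊕ D` to `J ⊕ ℂ d_n` along `d₁, …, d_{n-1}`. -/
def JD.subProj : JD F N →ₗ[ℂ] JD F N :=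
  LinearMap.id - ∑ i : Fin N, ((Der.coeff i.castSucc) ∘ₗ
    (LieAlgebra.SemiDirectSum.projr (jDer F N)).toLinearMap).smulRight (JD.d F i.castSucc)

lemma JD.subProj_apply (x : JD F N) :
    JD.subProj F N x = x - ∑ i : Fin N, Der.coeff i.castSucc x.right • JD.d F i.castSucc := by
  simp only [JD.subProj, LinearMap.sub_apply, LinearMap.id_apply, LinearMap.sum_apply,
    LinearMap.smulRight_apply]
  rfl

lemma JD.subProj_mem (x : JD F N) : JD.subProj F N x ∈ JD.sub F N := fun i => by
  rw [JD.subProj_apply]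
  have h : (x - ∑ i : Fin N, Der.coeff i.castSucc x.right • JD.d F i.castSucc).right =
      x.right - ∑ i : Fin N, Der.coeff i.castSucc x.right • Der.d i.castSucc := by
    have e := map_sub (LieAlgebra.SemiDirectSum.projr (jDer F N)) x
      (∑ i : Fin N, Der.coeff i.castSucc x.right • JD.d F i.castSucc)
    rw [map_sum] at e
    simp only [map_smul] at e
    exact e
  rw [h]
  simp

variable (F N H) in
/-- The projection of the Cartan subalgebra of `J ⊕ D` to that of `J ⊕ ℂ d_n`. -/
def JD.cartanProj : JD.cartan F H (N := N) →ₗ[ℂ] JD.subCartan F N H :=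
  LinearMap.codRestrict _ (LinearMap.codRestrict (JD.sub F N).toSubmodule
    (JD.subProj F N ∘ₗ (JD.cartan F H).subtype) fun x => JD.subProj_mem _) fun x => by
      change JD.subProj F N x ∈ JD.cartan F H
      rw [JD.subProj_apply]
      exact sub_mem x.2 (sum_mem fun i _ => Submodule.smul_mem _ _
        (Submodule.subset_span (Or.inr ⟨_, rfl⟩)))

lemma JD.cartanProj_coe (x : JD.cartan F H (N := N)) :
    ((JD.cartanProj F N H x : JD.sub F N) : JD F N) = JD.subProj F N x := rfl

/-- The space `h₀` is spanned by `h_{n-1}` and `d₁, …, d_{n-1}`, so the pair `(χ, β)` prescribes a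
single weight `l` of `h₀`, and the intersection lies in its weight space. -/
lemma finiteDimensional_wtSpace_inf_grade (hf : HasFiniteWeights (JD.cartan F H (N := N)) V)
    (χ : JD.subCartan F N H →ₗ[ℂ] ℂ) (β : Fin N → ℂ) :
    FiniteDimensional ℂ (wtSpace (JD.subCartan F N H) V χ ⊓ grade F β : Submodule ℂ V) := by
  let l : JD.cartan F H (N := N) →ₗ[ℂ] ℂ := χ ∘ₗ JD.cartanProj F N H +
    ∑ i : Fin N, β i • (Der.coeff i.castSucc ∘ₗ
      (LieAlgebra.SemiDirectSum.projr (jDer F N)).toLinearMap ∘ₗ (JD.cartan F H).subtype)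
  have hl : ∀ x : JD.cartan F H (N := N), l x = χ (JD.cartanProj F N H x) +
      ∑ i : Fin N, β i * Der.coeff i.castSucc (x : JD F N).right := fun x => by
    simp only [l, LinearMap.add_apply, LinearMap.comp_apply, LinearMap.sum_apply,
      LinearMap.smul_apply, smul_eq_mul]
    rfl
  have := hf.2 l
  refine Submodule.finiteDimensional_of_le (S₂ := wtSpace (JD.cartan F H) V l) ?_
  rintro v ⟨hv, hv'⟩ x
  have e : (x : JD F N) = ((JD.cartanProj F N H x : JD.sub F N) : JD F N) +
      ∑ i : Fin N, Der.coeff i.castSucc (x : JD F N).right • JD.d F i.castSucc := by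
    rw [JD.cartanProj_coe, JD.subProj_apply, sub_add_cancel]
  have h₁ : ⁅((JD.cartanProj F N H x : JD.sub F N) : JD F N), v⁆ =
    χ (JD.cartanProj F N H x) • v := hv _
  conv_lhs => rw [e]
  rw [add_lie, h₁, hl, add_smul, sum_lie, Finset.sum_smul]
  congr 1
  refine Finset.sum_congr rfl fun i _ => ?_
  rw [smul_lie, mem_grade.mp hv' i, smul_smul, mul_comm]

variable {α : Fin N → ℂ} {k : Fin N → ℤ} {ζ : (Fin N → Multiplicative ℤ) →* (Module.End ℂ V)ˣ}

lemma lie_mk' (W : LieSubmodule ℂ (JD.sub F N) V) (x : JD.sub F N) (v : V) :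
    ⁅x, LieSubmodule.Quotient.mk' W v⁆ = LieSubmodule.Quotient.mk' W ⁅x, v⁆ :=
  (LieModuleHom.map_lie _ _ _).symm

lemma mk'_eq_zero {W : LieSubmodule ℂ (JD.sub F N) V} {v : V} :
    LieSubmodule.Quotient.mk' W v = 0 ↔ v ∈ W :=
  LieSubmodule.Quotient.mk_eq_zero'

/-- Modulo `W`, every homogeneous vector is proportional to one whose degree lies in a fixed box. -/
lemma exists_grade_box (hk : ∀ i, k i ≠ 0)
    (hζ : ∀ g, IsQuasiCentral (jDer F N) (extZero fun i => toAdd (g i) * k i)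
      (ζ g : Module.End ℂ V)) {W : LieSubmodule ℂ (JD.sub F N) V}
    (hW : ∀ g, ζ g ∈ scalarMod W.toSubmodule) {j : Fin N → ℤ} {v : V}
    (hv : v ∈ grade F (addInt α j)) (l : Fin N → ℤ) :
    ∃ (j' : Fin N → ℤ) (v' : V), l - j' ∈ Finset.Icc 0 (fun i => |k i|) ∧
      v' ∈ grade F (addInt α j') ∧
      LieSubmodule.Quotient.mk' W v' = LieSubmodule.Quotient.mk' W v ∧
      ∀ χ : JD.subCartan F N H →ₗ[ℂ] ℂ, v ∈ wtSpace (JD.subCartan F N H) V χ →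
        v' ∈ wtSpace (JD.subCartan F N H) V χ := by
  -- With Euclidean quotients as exponents, `ζ g` moves degree `j` to `l` minus the remainder of `l
  -- - j` modulo `k`, and the remainder lies in the box. The factor `c⁻¹` below undoes the scalar by
  -- which `ζ g` acts modulo `W`.
  let g : Fin N → Multiplicative ℤ := fun i => ofAdd ((l i - j i) / k i)
  obtain ⟨c, hc, hcW⟩ := hW g
  have hj : (l - fun i => l i - (l i - j i) % k i) = fun i => (l i - j i) % k i := by
    funext i; simp
  refine ⟨fun i => l i - (l i - j i) % k i, c⁻¹ • (ζ g).val v, ?_, ?_, ?_, fun χ hχ => ?_⟩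
  · rw [hj, Finset.mem_Icc]
    exact ⟨fun i => Int.emod_nonneg _ (hk i), fun i => (Int.emod_lt_abs _ (hk i)).le⟩
  · refine Submodule.smul_mem _ _ ?_
    have := (hζ g).mem_grade hv
    convert this using 3
    funext i
    simp only [g, Pi.add_apply, extZero_castSucc, toAdd_ofAdd]
    have := Int.emod_add_mul_ediv (l i - j i) (k i)
    linarith
  · rw [← sub_eq_zero, ← map_sub, mk'_eq_zero]
    have := W.toSubmodule.smul_mem c⁻¹ (hcW v)
    rwa [smul_sub, smul_smul, inv_mul_cancel₀ hc, one_smul] at this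
  · refine Submodule.smul_mem _ _ fun x => ?_
    rw [(hζ g).sub_lie, hχ x, map_smul]

/-- For a fixed weight of `h_{n-1}`, infinitely many degrees of `V` contribute to the quotient, but
modulo `W` those in a finite box suffice, and each contributes a finite-dimensional space. -/
lemma hasFiniteWeights_quotient (hf : HasFiniteWeights (JD.cartan F H (N := N)) V)
    (h : ⨆ j, (grade F (addInt α j) : Submodule ℂ V) = ⊤) (hk : ∀ i, k i ≠ 0)
    (hζ : ∀ g, IsQuasiCentral (jDer F N) (extZero fun i => toAdd (g i) * k i)
      (ζ g : Module.End ℂ V)) {W : LieSubmodule ℂ (JD.sub F N) V}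
    (hW : ∀ g, ζ g ∈ scalarMod W.toSubmodule) :
    HasFiniteWeights (JD.subCartan F N H) (V ⧸ W) := by
  let q : V →ₗ[ℂ] V ⧸ W := (LieSubmodule.Quotient.mk' W : V →ₗ[ℂ] V ⧸ W)
  have hq : Function.Surjective q := LieSubmodule.Quotient.surjective_mk' W
  let A : (JD.subCartan F N H →ₗ[ℂ] ℂ) → Submodule ℂ (V ⧸ W) := fun χ =>
    ⨆ j : Finset.Icc (0 : Fin N → ℤ) (fun i => |k i|),
      (wtSpace (JD.subCartan F N H) V χ ⊓ grade F (addInt α (-j.1))).map q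
  have hA : ∀ χ, A χ ≤ wtSpace (JD.subCartan F N H) (V ⧸ W) χ := fun χ => by
    refine iSup_le fun j => ?_
    rw [Submodule.map_le_iff_le_comap]
    rintro v ⟨hv, -⟩ x
    change ⁅(x : JD.sub F N), LieSubmodule.Quotient.mk' W v⁆ = χ x • LieSubmodule.Quotient.mk' W v
    rw [lie_mk', hv x, map_smul]
  have hAt : ⨆ χ, A χ = ⊤ := by
    rw [eq_top_iff, ← LinearMap.range_eq_top.mpr hq, ← Submodule.map_top, ← hf.1,
      Submodule.map_iSup]
    refine iSup_le fun l => ?_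
    rw [Submodule.map_le_iff_le_comap]
    intro v hv
    by_cases hv0 : v = 0
    · rw [hv0]; exact zero_mem _
    obtain ⟨β, hβ⟩ := mem_wtSpace_cartan F hv
    obtain ⟨j, rfl⟩ := exists_eq_addInt h hβ hv0
    -- With target `0` the box contains `-j'`, whence the sign in the definition of `A`.
    obtain ⟨j', v', hj', hv', hvv, hχ⟩ := exists_grade_box (H := H) hk hζ hW hβ 0
    rw [← neg_neg j'] at hv'
    rw [zero_sub] at hj'
    refine Submodule.mem_iSup_of_mem (l ∘ₗ JD.subCartanIncl F N H)
      (Submodule.mem_iSup_of_mem ⟨-j', hj'⟩ ⟨v', ⟨hχ _ fun x => ?_, hv'⟩, hvv⟩)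
    exact hv (JD.subCartanIncl F N H x)
  constructor
  · rw [eq_top_iff, ← hAt]
    exact iSup_mono hA
  · intro χ
    -- The `A χ` span and lie in the weight spaces, which are independent; so each `A χ` is the full
    -- weight space.
    have hE := eq_of_iSupIndep_of_iSup_eq_top
      (iSupIndep_wtSpace (V := V ⧸ W) (JD.subCartan F N H)) hA hAt χ
    rw [hE]
    have : ∀ j : Finset.Icc (0 : Fin N → ℤ) (fun i => |k i|), FiniteDimensional ℂ
        ((wtSpace (JD.subCartan F N H) V χ ⊓ grade F (addInt α (-j.1))).map q) := fun j => by
      have := finiteDimensional_wtSpace_inf_grade hf χ (addInt α (-j.1))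
      infer_instance
    exact Submodule.finiteDimensional_iSup _

/-- A homogeneous vector generates an irreducible `J ⊕ D`-module already over `J ⊕ ℂ d_n`. -/
lemma lieSpan_sub_eq_top (hV : LieModule.IsIrreducible ℂ (JD F N) V) {β : Fin N → ℂ} {v : V}
    (hv : v ∈ grade F β) (hv0 : v ≠ 0) : LieSubmodule.lieSpan ℂ (JD.sub F N) {v} = ⊤ := by
  set U := LieSubmodule.lieSpan ℂ (JD.sub F N) {v}
  have hvU : v ∈ U := LieSubmodule.subset_lieSpan rfl
  -- The `dᵢ` normalise `J ⊕ ℂ d_n` and scale the generator `v`, so they preserve the submodule it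
  -- generates.
  have hd : ∀ (i : Fin N) (w : V), w ∈ U → ⁅(JD.d F i.castSucc : JD F N), w⁆ ∈ U := fun i w hw => by
    induction hw using LieSubmodule.lieSpan_induction with
    | mem x hx =>
      rw [Set.mem_singleton_iff.mp hx, mem_grade.mp hv i]
      exact U.smul_mem _ hvU
    | zero => rw [lie_zero]; exact U.zero_mem
    | add x y _ _ hx hy => rw [lie_add]; exact U.add_mem hx hy
    | smul a x _ hx => rw [lie_smul]; exact U.smul_mem _ hx
    | lie x y hyU hy =>
      rw [LieSubalgebra.coe_bracket_of_module, leibniz_lie]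
      refine U.add_mem ?_ (U.lie_mem hy (x := x))
      have hmem : ⁅JD.d F i.castSucc, (x : JD F N)⁆ ∈ JD.sub F N := fun l => by
        simp only [LieAlgebra.SemiDirectSum.lie_eq_mk, Der.lie_eq_zero, map_zero]
      exact U.lie_mem hyU (x := ⟨_, hmem⟩)
  have := eq_top_of_lie_mem hV U.toSubmodule (fun x w hw => by
    have e : x = JD.subProj F N x + ∑ i : Fin N, Der.coeff i.castSucc x.right • JD.d F i.castSucc := by
      rw [JD.subProj_apply, sub_add_cancel]
    rw [e, add_lie, sum_lie]
    refine add_mem (U.lie_mem hw (x := ⟨_, JD.subProj_mem x⟩)) (sum_mem fun i _ => ?_)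
    rw [smul_lie]
    exact U.smul_mem _ (hd i w hw)) hvU hv0
  rwa [LieSubmodule.toSubmodule_eq_top] at this

lemma isIrreducible_quotient_of_isCoatom {L M : Type*} [LieRing L] [LieAlgebra ℂ L]
    [AddCommGroup M] [Module ℂ M] [LieRingModule L M] [LieModule ℂ L M] {W : LieSubmodule ℂ L M}
    (hW : IsCoatom W) : LieModule.IsIrreducible ℂ L (M ⧸ W) := by
  have hn : Nontrivial (M ⧸ W) := by
    obtain ⟨v, -, hv⟩ := SetLike.exists_of_lt hW.lt_top
    exact ⟨LieSubmodule.Quotient.mk' W v, 0, fun h => hv (LieSubmodule.Quotient.mk_eq_zero'.mp h)⟩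
  refine LieModule.IsIrreducible.mk fun S hS => ?_
  have hlt : W < S.comap (LieSubmodule.Quotient.mk' W) := by
    refine lt_of_le_of_ne (fun v hv => ?_) fun h => hS ?_
    · change LieSubmodule.Quotient.mk' W v ∈ S
      have h0 : LieSubmodule.Quotient.mk' W v = 0 := LieSubmodule.Quotient.mk_eq_zero'.mpr hv
      rw [h0]
      exact S.zero_mem
    · rw [LieSubmodule.eq_bot_iff]
      intro x hx
      obtain ⟨v, rfl⟩ := LieSubmodule.Quotient.surjective_mk' W x
      exact LieSubmodule.Quotient.mk_eq_zero'.mpr (h ▸ (show v ∈ S.comap _ from hx))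
  have := hW.2 _ hlt
  rw [eq_top_iff]
  intro x _
  obtain ⟨v, rfl⟩ := LieSubmodule.Quotient.surjective_mk' W x
  have hv : v ∈ S.comap (LieSubmodule.Quotient.mk' W) := by rw [this]; trivial
  exact hv

/-- Any maximal submodule containing all ranges of `zᵢ - 1` will do, since the `zᵢ` then act on the
quotient as the identity. It remains to see that these ranges do not span `V` and that a maximal
submodule exists. -/
lemma exists_isGoodMaximal (hV : IsStandard F N H V) :
    ∃ W : LieSubmodule ℂ (JD.sub F N) V, IsGoodMaximal F N H W := by
  have hirr := hV.irreducible
  have : Nontrivial V := LieModule.nontrivial_of_isIrreducible ℂ (JD F N) V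
  obtain ⟨k, z, hz⟩ := hV.centralOps
  obtain ⟨χ, hχ⟩ := hV.finiteWeights.exists_wtSpace_ne_bot
  obtain ⟨v, hv, hv0⟩ := Submodule.exists_mem_ne_zero_of_ne_bot hχ
  obtain ⟨α, hα⟩ := mem_wtSpace_cartan F hv
  have h := iSup_grade_eq_top hirr hα hv0
  have hq : ∀ i, IsQuasiCentral (jDer F N) (Pi.single i.castSucc (k i)) (z i) := fun i =>
    (hz i).2.1.isQuasiCentral (hz i).2.2.2
  obtain ⟨ζ, hζz, hζ⟩ := exists_unitsHom (fun i => (hz i).2.1)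
    (fun i => (hq i).bijective hirr (hz i).2.2.1) fun i => (hz i).2.2.2
  obtain ⟨P, hP, hP0⟩ := exists_projection h (fun i => (hz i).1) hζz hζ
  let W₀ : LieSubmodule ℂ (JD.sub F N) V := lieSubmoduleOf (⨆ i, LinearMap.range (z i - 1))
    fun x w hw => by
      induction hw using Submodule.iSup_induction' with
      | mem i w hw =>
        obtain ⟨y, rfl⟩ := hw
        refine Submodule.mem_iSup_of_mem i ⟨⁅x, y⁆, ?_⟩
        have := hq i
        rw [← extZero_single] at this
        rw [LinearMap.sub_apply, LinearMap.sub_apply, lie_sub, this.sub_lie]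
        rfl
      | zero => simp
      | add w w' _ _ h₁ h₂ => rw [lie_add]; exact add_mem h₁ h₂
  -- The projection `P` vanishes on `W₀` but on no non-zero homogeneous vector.
  have hW₀ : W₀ ≠ ⊤ := fun ht => by
    have hle : (⨆ i, LinearMap.range (z i - 1)) ≤ LinearMap.ker P := by
      refine iSup_le fun i => ?_
      rintro _ ⟨y, rfl⟩
      rw [LinearMap.mem_ker, LinearMap.sub_apply, map_sub, hP, Module.End.one_apply, sub_self]
    have hvW : v ∈ W₀ := by rw [ht]; trivial
    have hα' : v ∈ grade F (addInt α 0) := by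
      have : addInt α 0 = α := by funext i; simp [addInt]
      rwa [this]
    exact hv0 (hP0 0 v hα' (hle hvW))
  -- Zorn's lemma applies because the module is generated by one vector, which makes `⊤` compact.
  have hc : IsCoatomic (LieSubmodule ℂ (JD.sub F N) V) := by
    apply CompleteLattice.coatomic_of_top_compact
    rw [← lieSpan_sub_eq_top hirr hα hv0]
    exact LieSubmodule.isCompactElement_lieSpan_singleton _ _ _
  obtain ⟨W, hW, hle⟩ := (hc.eq_top_or_exists_le_coatom W₀).resolve_left hW₀
  refine ⟨W, isIrreducible_quotient_of_isCoatom hW, ?_⟩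
  refine hasFiniteWeights_quotient hV.finiteWeights h (fun i => (hz i).1) hζ fun g => ?_
  refine hom_mem_of_forall_mulSingle ζ (scalarMod W.toSubmodule) (fun i => ?_) g
  refine ⟨1, one_ne_zero, fun w => ?_⟩
  rw [hζz, one_smul]
  exact hle (Submodule.mem_iSup_of_mem i ⟨w, rfl⟩)

end Quotient

end ToroidalLie

end

/-! ### Simple components of the loop module -/

noncomputable section

namespace ToroidalLie

universe u v

open Multiplicative

/-- In a modular lattice, a finite join of atoms is the join of an independent subfamily, which may
be chosen to contain a given one of the atoms. -/
lemma exists_supIndep_of_atoms {Λ : Type*} [Lattice Λ] [OrderBot Λ] [IsModularLattice Λ] {a : Λ}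
    (ha : IsAtom a) (s : Finset Λ) (hs : ∀ b ∈ s, IsAtom b) :
    ∃ t : Finset Λ, a ∈ t ∧ (∀ b ∈ t, IsAtom b) ∧ t.SupIndep id ∧ s.sup id ≤ t.sup id := by
  classical
  induction s using Finset.induction_on with
  | empty =>
    exact ⟨{a}, Finset.mem_singleton_self a, fun b hb => Finset.mem_singleton.mp hb ▸ ha,
      Finset.supIndep_singleton _ _, by simp⟩
  | insert b s _ ih =>
    obtain ⟨t, hat, ht, hi, hle⟩ := ih fun c hc => hs c (Finset.mem_insert_of_mem hc)
    have hb := hs b (Finset.mem_insert_self b s)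
    -- An atom not below the join is disjoint from it, and modularity keeps the enlarged family
    -- independent.
    by_cases h : b ≤ t.sup id
    · exact ⟨t, hat, ht, hi, by rw [Finset.sup_insert]; exact sup_le h hle⟩
    · refine ⟨insert b t, Finset.mem_insert_of_mem hat, fun c hc => ?_, ?_, ?_⟩
      · rcases Finset.mem_insert.mp hc with rfl | hc
        exacts [hb, ht c hc]
      · exact hi.insert (hb.not_le_iff_disjoint.mp h)
      · rw [Finset.sup_insert, Finset.sup_insert]
        exact sup_le_sup_left hle _

section Component

variable {L : Type*} [LieRing L] [LieAlgebra ℂ L]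
variable {M : Type*} [AddCommGroup M] [Module ℂ M] [LieRingModule L M] [LieModule ℂ L M]

lemma isIrreducible_of_isAtom {S : LieSubmodule ℂ L M} (hS : IsAtom S) :
    LieModule.IsIrreducible ℂ L S := by
  have hn : Nontrivial S := (LieSubmodule.nontrivial_iff_ne_bot ℂ L M).mpr hS.1
  refine LieModule.IsIrreducible.mk fun T hT => ?_
  have hle : T.map S.incl ≤ S := by
    rintro _ ⟨x, -, rfl⟩
    exact x.2
  rcases hS.le_iff.mp hle with h | h
  · exfalso
    apply hT
    rw [LieSubmodule.eq_bot_iff]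
    intro x hx
    have : S.incl x ∈ T.map S.incl := ⟨x, hx, rfl⟩
    rw [h, LieSubmodule.mem_bot] at this
    exact Subtype.ext this
  · rw [eq_top_iff]
    intro x _
    have : (x : M) ∈ T.map S.incl := by rw [h]; exact x.2
    obtain ⟨y, hy, hyx⟩ := this
    rwa [← Subtype.ext (a1 := y) (a2 := x) hyx]

lemma isComponent_of_atoms {V : Type*} [AddCommGroup V] [Module ℂ V] [LieRingModule L V]
    [LieModule ℂ L V] {a : LieSubmodule ℂ L M} (ha : IsAtom a) (e : Nonempty (V ≃ₗ⁅ℂ, L⁆ a))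
    (s : Finset (LieSubmodule ℂ L M)) (hs : ∀ b ∈ s, IsAtom b) (h : s.sup id = ⊤) :
    IsComponent L V M := by
  classical
  obtain ⟨t, hat, ht, hi, hle⟩ := exists_supIndep_of_atoms ha s hs
  rw [h, top_le_iff] at hle
  let f : Fin t.card → LieSubmodule ℂ L M := fun i => (t.equivFin.symm i : LieSubmodule ℂ L M)
  refine ⟨t.card, f, fun j => isIrreducible_of_isAtom (ht _ (t.equivFin.symm j).2), ?_,
    t.equivFin ⟨a, hat⟩, ?_⟩
  · rw [DirectSum.isInternal_submodule_iff_iSupIndep_and_iSup_eq_top]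
    constructor
    · rw [LieSubmodule.iSupIndep_toSubmodule]
      exact (iSupIndep_comp_coe_iff_supIndep.mpr hi).comp t.equivFin.symm.injective
    · rw [← LieSubmodule.iSup_toSubmodule, LieSubmodule.toSubmodule_eq_top, ← hle, Finset.sup_eq_iSup]
      refine (t.equivFin.symm.iSup_comp (g := fun x : t => (x : LieSubmodule ℂ L M))).trans ?_
      exact iSup_subtype'' (t : Set (LieSubmodule ℂ L M)) id
  · have : f (t.equivFin ⟨a, hat⟩) = a := by simp [f]
    rw [this]
    exact e

end Component

section TwistedHom

variable {K : Type*} [LieRing K] [LieAlgebra ℂ K] {n : ℕ} {ψ : Der n →ₗ⁅ℂ⁆ LieDerivation ℂ K K}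
variable {V : Type*} [AddCommGroup V] [Module ℂ V] [LieRingModule (K ⋊⁅ψ⁆ Der n) V]
  [LieModule ℂ (K ⋊⁅ψ⁆ Der n) V]
variable {M : Type*} [AddCommGroup M] [Module ℂ M] [LieRingModule (K ⋊⁅ψ⁆ Der n) M]
  [LieModule ℂ (K ⋊⁅ψ⁆ Der n) M]

/-- The range of a map that is equivariant up to a degree shift. -/
def twistedRange (f : V →ₗ[ℂ] M) (m : Fin n → ℤ)
    (h : ∀ (x : K ⋊⁅ψ⁆ Der n) v, ⁅x, f v⁆ = f ⁅x, v⁆ + Der.deg x.right m • f v) :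
    LieSubmodule ℂ (K ⋊⁅ψ⁆ Der n) M :=
  lieSubmoduleOf (LinearMap.range f) (by
    rintro x _ ⟨v, rfl⟩
    rw [h]
    exact add_mem (LinearMap.mem_range_self _ _)
      (Submodule.smul_mem _ _ (LinearMap.mem_range_self _ _)))

/-- The shift only adds a multiple of `f v`, so the preimage under `f` of a submodule is again a
submodule, and irreducibility of `V` passes to the image although `f` need not be a homomorphism. -/
lemma isAtom_twistedRange (hV : LieModule.IsIrreducible ℂ (K ⋊⁅ψ⁆ Der n) V) {f : V →ₗ[ℂ] M}
    (hf : f ≠ 0) {m : Fin n → ℤ}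
    (h : ∀ (x : K ⋊⁅ψ⁆ Der n) v, ⁅x, f v⁆ = f ⁅x, v⁆ + Der.deg x.right m • f v) :
    IsAtom (twistedRange f m h) := by
  constructor
  · intro hb
    apply hf
    ext v
    have : f v ∈ twistedRange f m h := LinearMap.mem_range_self f v
    rwa [hb] at this
  · intro Y hY
    by_contra hne
    obtain ⟨y, hy, hy0⟩ : ∃ y ∈ Y, y ≠ 0 := by
      by_contra hcon
      push Not at hcon
      exact hne ((LieSubmodule.eq_bot_iff Y).mpr hcon)
    obtain ⟨v, rfl⟩ : ∃ v, f v = y := hY.le hy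
    have := eq_top_of_lie_mem hV (Y.toSubmodule.comap f) (fun x w hw => by
      have e : f ⁅x, w⁆ = ⁅x, f w⁆ - Der.deg x.right m • f w := by rw [h, add_sub_cancel_right]
      change f ⁅x, w⁆ ∈ Y
      rw [e]
      exact Y.sub_mem (Y.lie_mem hw) (Y.smul_mem _ hw)) (v := v) hy
      (fun h0 => hy0 (by rw [h0, map_zero]))
    refine hY.not_ge ?_
    rintro _ ⟨w, rfl⟩
    have hw : w ∈ Y.toSubmodule.comap f := by rw [this]; trivial
    exact hw

lemma injective_of_twisted (hV : LieModule.IsIrreducible ℂ (K ⋊⁅ψ⁆ Der n) V) {f : V →ₗ[ℂ] M}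
    (hf : f ≠ 0) {m : Fin n → ℤ}
    (h : ∀ (x : K ⋊⁅ψ⁆ Der n) v, ⁅x, f v⁆ = f ⁅x, v⁆ + Der.deg x.right m • f v) :
    Function.Injective f := by
  rw [← LinearMap.ker_eq_bot, Submodule.eq_bot_iff]
  intro v hv
  by_contra hv0
  refine hf (LinearMap.ker_eq_top.mp (eq_top_of_lie_mem hV _ (fun x w hw => ?_) hv hv0))
  rw [LinearMap.mem_ker] at hw ⊢
  have := h x w
  rw [hw, lie_zero, smul_zero, add_zero] at this
  exact this.symm

lemma nonempty_equiv_twistedRange {f : V →ₗ[ℂ] M} (hf : Function.Injective f) {m : Fin n → ℤ}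
    (hm : m = 0) (h : ∀ (x : K ⋊⁅ψ⁆ Der n) v, ⁅x, f v⁆ = f ⁅x, v⁆ + Der.deg x.right m • f v) :
    Nonempty (V ≃ₗ⁅ℂ, K ⋊⁅ψ⁆ Der n⁆ twistedRange f m h) :=
  have h' : ∀ (x : K ⋊⁅ψ⁆ Der n) v, f ⁅x, v⁆ = ⁅x, f v⁆ := fun x v => by
    rw [h, hm, map_zero, zero_smul, add_zero]
  let e : V ≃ₗ[ℂ] LinearMap.range f := LinearEquiv.ofInjective f hf
  ⟨{ toFun := fun v => ⟨f v, LinearMap.mem_range_self f v⟩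
     map_add' := fun v w => Subtype.ext (map_add f v w)
     map_smul' := fun c v => Subtype.ext (map_smul f c v)
     map_lie' := fun {x v} => Subtype.ext (h' x v)
     invFun := e.symm
     left_inv := e.left_inv
     right_inv := e.right_inv }⟩

end TwistedHom

section LoopModule

variable {𝔤 : Type u} [LieRing 𝔤] [LieAlgebra ℂ 𝔤] {F : InvForm 𝔤} {N : ℕ} {α : Fin N → ℂ}
variable {U : Type v} [AddCommGroup U] [Module ℂ U]

namespace LoopModule

variable (F α U) in
/-- The map `v ↦ v(k)`. -/
def of (k : Fin N → ℤ) : U →ₗ[ℂ] LoopModule F α U := LoopSpace.of k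

lemma of_injective (k : Fin N → ℤ) : Function.Injective (of F α U k) := by
  have h : ∀ v, LoopSpace.lift (fun j => if j = k then LinearMap.id else 0)
      (LoopSpace.of k v : LoopSpace (Fin N → ℤ) U) = v := fun v => by
    rw [LoopSpace.lift_of]; simp
  exact Function.LeftInverse.injective h

lemma mem_of_forall_of (S : Submodule ℂ (LoopModule F α U)) (h : ∀ k v, of F α U k v ∈ S)
    (w : LoopModule F α U) : w ∈ S :=
  LoopSpace.mem_of_forall_of S h w

variable [LieRingModule (JD.sub F N) U] [LieModule ℂ (JD.sub F N) U]

lemma loop_lie_of (m k : Fin N → ℤ) (y : Affine F) (v : U) :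
    ⁅(⟨Loop.of m y, 0⟩ : JD F N), of F α U k v⁆ =
      of F α U (m + k) ⁅JD.inclJ F N (Loop.of m y), v⁆ := by
  change actL F α U ⟨Loop.of m y, 0⟩ (LoopSpace.of k v) = LoopSpace.of (m + k) _
  rw [actL_apply, actJ_of]
  simp

lemma d_lie_of (i : Fin N) (k : Fin N → ℤ) (v : U) :
    ⁅(JD.d F i.castSucc : JD F N), of F α U k v⁆ = (α i + k i) • of F α U k v := by
  change actL F α U (JD.d F i.castSucc) (LoopSpace.of k v) = _ • LoopSpace.of k v
  rw [actL_apply]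
  simp only [JD.d, map_zero, LinearMap.zero_apply, zero_add, actD_of, Der.coeff_d]
  simp [(Fin.castSucc_ne_last i).symm]
  rfl

lemma dLast_lie_of (k : Fin N → ℤ) (v : U) :
    ⁅(JD.d F (Fin.last N) : JD F N), of F α U k v⁆ = of F α U k ⁅JD.dLast F N, v⁆ := by
  change actL F α U (JD.d F (Fin.last N)) (LoopSpace.of k v) = LoopSpace.of k _
  rw [actL_apply]
  simp [JD.d, Fin.castSucc_ne_last]

end LoopModule

end LoopModule

/-! ### The centre on `V / W`, and `V` as a component of the loop module -/

section Main

variable {𝔤 : Type u} [LieRing 𝔤] [LieAlgebra ℂ 𝔤] {F : InvForm 𝔤} {N : ℕ} {H : LieSubalgebra ℂ 𝔤}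
variable {V : Type v} [AddCommGroup V] [Module ℂ V] [LieRingModule (JD F N) V]
  [LieModule ℂ (JD F N) V]

lemma lie_map_eq_of_forall {M : Type*} [AddCommGroup M] [Module ℂ M] [LieRingModule (JD F N) M]
    [LieModule ℂ (JD F N) M] {f : V →ₗ[ℂ] M} {k : Fin (N + 1) → ℤ} {v : V}
    (h₁ : ∀ m y, ⁅(⟨Loop.of m y, 0⟩ : JD F N), f v⁆ = f ⁅(⟨Loop.of m y, 0⟩ : JD F N), v⁆)
    (h₂ : ∀ i, ⁅(JD.d F i : JD F N), f v⁆ = f ⁅(JD.d F i : JD F N), v⁆ + (k i : ℂ) • f v)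
    (x : JD F N) : ⁅x, f v⁆ = f ⁅x, v⁆ + Der.deg x.right k • f v := by
  let S : Submodule ℂ (JD F N) :=
    { carrier := {x | ⁅x, f v⁆ = f ⁅x, v⁆ + Der.deg x.right k • f v}
      zero_mem' := by
        have : Der.deg (0 : JD F N).right k = 0 := by simp [Der.deg_apply]
        change ⁅(0 : JD F N), f v⁆ = f ⁅(0 : JD F N), v⁆ + Der.deg (0 : JD F N).right k • f v
        rw [this, zero_lie, zero_lie, map_zero, zero_smul, add_zero]
      add_mem' := fun {x y} hx hy => by
        have e : Der.deg (x + y).right k = Der.deg x.right k + Der.deg y.right k :=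
          Der.deg_add _ _ _
        change ⁅x + y, f v⁆ = f ⁅x + y, v⁆ + Der.deg (x + y).right k • f v
        rw [add_lie, hx, hy, e, add_lie, map_add, add_smul]
        abel
      smul_mem' := fun c x hx => by
        have e : Der.deg (c • x).right k = c * Der.deg x.right k := Der.deg_smul _ _ _
        change ⁅c • x, f v⁆ = f ⁅c • x, v⁆ + Der.deg (c • x).right k • f v
        rw [smul_lie, hx, e, smul_lie, map_smul, smul_add, mul_smul] }
  refine JD.mem_of_forall F S (fun m y => ?_) (fun i => ?_) x
  · change _ = _ + Der.deg (0 : Der (N + 1)) k • f v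
    have : Der.deg (0 : Der (N + 1)) k = 0 := by simp [Der.deg_apply]
    rw [this, zero_smul, add_zero]
    exact h₁ m y
  · change _ = _ + Der.deg (Der.d i) k • f v
    rw [Der.deg_d]
    exact h₂ i

/-- A version of `lie_map_eq_of_forall` for maps on a sum of subspaces. -/
lemma lie_map_eq_of_iSup {M : Type*} [AddCommGroup M] [Module ℂ M] [LieRingModule (JD F N) M]
    [LieModule ℂ (JD F N) M] {ι : Type*} {A : ι → Submodule ℂ V} (hA : ⨆ j, A j = ⊤) {f : V →ₗ[ℂ] M}
    {k : Fin (N + 1) → ℤ}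
    (h₁ : ∀ j, ∀ v ∈ A j, ∀ m y,
      ⁅(⟨Loop.of m y, 0⟩ : JD F N), f v⁆ = f ⁅(⟨Loop.of m y, 0⟩ : JD F N), v⁆)
    (h₂ : ∀ j, ∀ v ∈ A j, ∀ i,
      ⁅(JD.d F i : JD F N), f v⁆ = f ⁅(JD.d F i : JD F N), v⁆ + (k i : ℂ) • f v)
    (x : JD F N) (v : V) : ⁅x, f v⁆ = f ⁅x, v⁆ + Der.deg x.right k • f v := by
  have hv : v ∈ ⨆ j, A j := by rw [hA]; trivial
  induction hv using Submodule.iSup_induction' with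
  | mem j v hv => exact lie_map_eq_of_forall (h₁ j v hv) (h₂ j v hv) x
  | zero => rw [map_zero, lie_zero, lie_zero, map_zero, smul_zero, add_zero]
  | add v w _ _ h₁ h₂ =>
    rw [map_add, lie_add, h₁, h₂, lie_add, map_add, smul_add]
    abel

variable (F) in
lemma JD.dLast_lie_K (m : Fin N → ℤ) : ⁅JD.d F (Fin.last N), (JD.K F m : JD F N)⁆ = 0 := by
  have h : jDer F N (Der.d (Fin.last N)) (Loop.of m (CentralExt.cen F affTwist 1)) = 0 := by
    change Loop.derOp (affDer F) (Der.d (Fin.last N)) _ = _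
    rw [Loop.derOp_of]
    have h₁ : Der.deg (Der.init (Der.d (Fin.last N))) m = 0 := by
      rw [Der.deg_apply]
      refine Finset.sum_eq_zero fun i _ => ?_
      have : Der.coeff i (Der.init (Der.d (Fin.last N))) =
        Der.coeff i.castSucc (Der.d (Fin.last N)) := rfl
      rw [this, Der.coeff_d, if_neg (Fin.castSucc_ne_last i), zero_mul]
    have h₂ : affDer F (CentralExt.cen F affTwist 1) = 0 := by
      ext <;> simp [affDer]
    rw [h₁, h₂]
    simp
  simp [JD.d, JD.K, h]

lemma hasDegree_K (m : Fin N → ℤ) :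
    HasDegree F N (LieModule.toEnd ℂ (JD F N) V (JD.K F m)) (extZero m) := fun i v => by
  change ⁅(JD.d F i : JD F N), ⁅(JD.K F m : JD F N), v⁆⁆ =
    ⁅(JD.K F m : JD F N), ⁅(JD.d F i : JD F N), v⁆⁆ + _ • ⁅(JD.K F m : JD F N), v⁆
  rw [leibniz_lie, add_comm]
  congr 1
  refine Fin.lastCases ?_ (fun j => ?_) i
  · rw [JD.dLast_lie_K, zero_lie, extZero_last, Int.cast_zero, zero_smul]
  · rw [JD.K, JD.d_lie_loop, smul_lie, extZero_castSucc]

lemma isQuasiCentral_K (m : Fin N → ℤ) :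
    IsQuasiCentral (jDer F N) (extZero m) (LieModule.toEnd ℂ (JD F N) V (JD.K F m)) :=
  (IsCentralOp.central m).isQuasiCentral (hasDegree_K m)

lemma mk'_subK_lie (W : LieSubmodule ℂ (JD.sub F N) V) (m : Fin N → ℤ) (v : V) :
    ⁅JD.subK F m, LieSubmodule.Quotient.mk' W v⁆ =
      LieSubmodule.Quotient.mk' W ⁅(JD.K F m : JD F N), v⁆ := lie_mk' W (JD.subK F m) v

/-- Schur's lemma on `V / W`: over `J ⊕ ℂ d_n` the element `K_n ⊗ t^m` acts as an endomorphism,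
because its degree has last entry zero. -/
lemma IsGoodMaximal.exists_scalar_K {W : LieSubmodule ℂ (JD.sub F N) V}
    (hW : IsGoodMaximal F N H W) (m : Fin N → ℤ) :
    ∃ c : ℂ, ∀ v : V ⧸ W, ⁅JD.subK F m, v⁆ = c • v := by
  refine hW.finiteWeights.exists_scalar hW.irreducible
    (z := LieModule.toEnd ℂ (JD.sub F N) (V ⧸ W) (JD.subK F m)) fun x v => ?_
  obtain ⟨v, rfl⟩ := LieSubmodule.Quotient.surjective_mk' W v
  change ⁅x, ⁅JD.subK F m, LieSubmodule.Quotient.mk' W v⁆⁆ =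
    ⁅JD.subK F m, ⁅x, LieSubmodule.Quotient.mk' W v⁆⁆
  rw [mk'_subK_lie, lie_mk', lie_mk', mk'_subK_lie]
  exact congrArg _ ((isQuasiCentral_K (V := V) m).sub_lie x v)

lemma IsGoodMaximal.exists_notMem {W : LieSubmodule ℂ (JD.sub F N) V}
    (hW : IsGoodMaximal F N H W) : ∃ v, v ∉ W := by
  have := hW.irreducible
  have : Nontrivial (V ⧸ W) := LieModule.nontrivial_of_isIrreducible ℂ (JD.sub F N) _
  obtain ⟨x, hx⟩ := exists_ne (0 : V ⧸ W)
  obtain ⟨v, rfl⟩ := LieSubmodule.Quotient.surjective_mk' W x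
  exact ⟨v, fun h => hx (mk'_eq_zero.mpr h)⟩

lemma IsGoodMaximal.exists_scalar_mod {W : LieSubmodule ℂ (JD.sub F N) V}
    (hW : IsGoodMaximal F N H W) {z : Module.End ℂ V} (hz : IsCentralOp F N z) :
    ∃ c : ℂ, ∀ v, z v - c • v ∈ W := by
  induction hz with
  | scalar c => exact ⟨c, fun v => by simp⟩
  | central m =>
    obtain ⟨c, hc⟩ := hW.exists_scalar_K m
    refine ⟨c, fun v => ?_⟩
    rw [← mk'_eq_zero, map_sub, map_smul, ← hc, mk'_subK_lie, sub_eq_zero]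
    rfl
  | add _ _ h₁ h₂ =>
    obtain ⟨c, hc⟩ := h₁
    obtain ⟨d, hd⟩ := h₂
    refine ⟨c + d, fun v => ?_⟩
    rw [LinearMap.add_apply, add_smul, add_sub_add_comm]
    exact W.add_mem (hc v) (hd v)
  | @mul S T _ _ h₁ h₂ =>
    obtain ⟨c, hc⟩ := h₁
    obtain ⟨d, hd⟩ := h₂
    refine ⟨c * d, fun v => ?_⟩
    have := W.add_mem (hc (T v)) (W.smul_mem c (hd v))
    rwa [smul_sub, smul_smul, sub_add_sub_cancel] at this
  | @inv S T _ h h' h₁ =>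
    obtain ⟨c, hc⟩ := h₁
    have e : ∀ v, S (T v) = v := fun v => congrArg (fun g => g v) h
    -- The scalar of an invertible `S` cannot be zero: `S` would map `V` into `W`, yet it is
    -- surjective.
    by_cases hc0 : c = 0
    · obtain ⟨v, hv⟩ := hW.exists_notMem
      have := hc (T v)
      rw [e, hc0, zero_smul, sub_zero] at this
      exact absurd this hv
    · refine ⟨c⁻¹, fun v => ?_⟩
      have := W.smul_mem (-c⁻¹) (hc (T v))
      rwa [e, smul_sub, neg_smul, neg_smul, smul_smul, inv_mul_cancel₀ hc0, one_smul,
        sub_neg_eq_add, neg_add_eq_sub] at this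

lemma IsGoodMaximal.ne_zero_of_surjective {W : LieSubmodule ℂ (JD.sub F N) V}
    (hW : IsGoodMaximal F N H W) {z : Module.End ℂ V} (hz : Function.Surjective z) {c : ℂ}
    (hc : ∀ v, z v - c • v ∈ W) : c ≠ 0 := by
  rintro rfl
  obtain ⟨v, hv⟩ := hW.exists_notMem
  obtain ⟨w, rfl⟩ := hz v
  apply hv
  simpa using hc w

/-- A non-zero `K_n ⊗ t^m` is bijective on the irreducible module `V`, and a surjective operator
cannot be zero modulo the proper subspace `W`. -/
lemma IsGoodMaximal.scalar_K_ne_zero (hV : LieModule.IsIrreducible ℂ (JD F N) V)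
    {W : LieSubmodule ℂ (JD.sub F N) V} (hW : IsGoodMaximal F N H W) {m : Fin N → ℤ} {c : ℂ}
    (hc : ∀ v : V ⧸ W, ⁅JD.subK F m, v⁆ = c • v) (h : ∃ v : V, ⁅(JD.K F m : JD F N), v⁆ ≠ 0) :
    c ≠ 0 := by
  obtain ⟨v, hv⟩ := h
  have hb := (isQuasiCentral_K (V := V) (F := F) m).bijective hV fun h0 =>
    hv (congrArg (fun g => g v) h0)
  refine hW.ne_zero_of_surjective hb.2 fun w => ?_
  rw [← mk'_eq_zero, map_sub, map_smul, ← hc, mk'_subK_lie, sub_eq_zero]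
  rfl

/-- The map `v ↦ v̄(j + l)` on the component of degree `j` of `V`. -/
lemma exists_loopMap {α : Fin N → ℂ} (h : ⨆ k, (grade F (addInt α k) : Submodule ℂ V) = ⊤)
    (W : LieSubmodule ℂ (JD.sub F N) V) (l : Fin N → ℤ) :
    ∃ f : V →ₗ[ℂ] LoopModule F α (V ⧸ W),
      (∀ j, ∀ v ∈ grade F (addInt α j),
        f v = LoopModule.of F α (V ⧸ W) (j + l) (LieSubmodule.Quotient.mk' W v)) ∧
      ∀ (x : JD F N) v, ⁅x, f v⁆ = f ⁅x, v⁆ + Der.deg x.right (extZero l) • f v := by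
  obtain ⟨f, hf⟩ := exists_linearMap_of_isInternal
    (iSupIndep_grade_addInt (F := F) (V := V) α) h
    fun j => LoopModule.of F α (V ⧸ W) (j + l) ∘ₗ
      (LieSubmodule.Quotient.mk' W : V →ₗ[ℂ] V ⧸ W)
  refine ⟨f, hf, lie_map_eq_of_iSup h (fun j v hv m y => ?_) (fun j v hv i => ?_)⟩
  · rw [hf _ _ hv, hf _ _ (loop_lie_mem_grade hv), LinearMap.comp_apply,
      LinearMap.comp_apply, LoopModule.loop_lie_of, add_assoc]
    exact congrArg _ (lie_mk' W _ v)
  · rw [hf _ _ hv, hf _ _ (d_lie_mem_grade i hv)]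
    refine Fin.lastCases ?_ (fun i => ?_) i
    · rw [LinearMap.comp_apply, LinearMap.comp_apply, LoopModule.dLast_lie_of, extZero_last,
        Int.cast_zero, zero_smul, add_zero]
      exact congrArg _ (lie_mk' W _ v)
    · rw [LinearMap.comp_apply, LinearMap.comp_apply, LoopModule.d_lie_of, mem_grade.mp hv i,
        map_smul, map_smul, ← add_smul, extZero_castSucc]
      congr 1
      simp [addInt]; ring

/-- The images of the maps `f l` are simple, that of `f 0` is a copy of `V`, and finitely many of
them span the loop module by periodicity modulo `W`. -/
lemma IsGoodMaximal.exists_isComponent (hV : IsStandard F N H V)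
    {W : LieSubmodule ℂ (JD.sub F N) V} (hW : IsGoodMaximal F N H W) :
    ∃ α : Fin N → ℂ, IsComponent (JD F N) V (LoopModule F α (V ⧸ W)) := by
  classical
  have hirr := hV.irreducible
  obtain ⟨α, h⟩ := exists_grading hirr hV.finiteWeights
  obtain ⟨k, z, hz⟩ := hV.centralOps
  have hq : ∀ i, IsQuasiCentral (jDer F N) (Pi.single i.castSucc (k i)) (z i) := fun i =>
    (hz i).2.1.isQuasiCentral (hz i).2.2.2
  have hb := fun i => (hq i).bijective hirr (hz i).2.2.1
  obtain ⟨ζ, hζz, hζ⟩ := exists_unitsHom (fun i => (hz i).2.1) hb fun i => (hz i).2.2.2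
  -- Here `W` is arbitrary, so the `zᵢ` act on `V / W` by non-zero scalars that need not be 1.
  have hζW : ∀ g, ζ g ∈ scalarMod W.toSubmodule := by
    refine hom_mem_of_forall_mulSingle ζ _ fun i => ?_
    obtain ⟨c, hc⟩ := hW.exists_scalar_mod (hz i).2.1
    refine ⟨c, hW.ne_zero_of_surjective (hb i).2 hc, fun w => ?_⟩
    rw [hζz]
    exact hc w
  choose f hf hflie using exists_loopMap h W
  -- If `f l` vanished, every homogeneous vector would lie in `W`, hence all of `V`.
  have hf0 : ∀ l, f l ≠ 0 := fun l h0 => by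
    obtain ⟨v, hv⟩ := hW.exists_notMem
    apply hv
    have hvt : v ∈ ⨆ k, (grade F (addInt α k) : Submodule ℂ V) := by rw [h]; trivial
    refine (iSup_le fun j w hw => ?_ : (⨆ k, (grade F (addInt α k) : Submodule ℂ V)) ≤
      W.toSubmodule) hvt
    have := hf l j w hw
    rw [h0, LinearMap.zero_apply] at this
    exact mk'_eq_zero.mp (LoopModule.of_injective _ (this.symm.trans (map_zero _).symm))
  let R : (Fin N → ℤ) → LieSubmodule ℂ (JD F N) (LoopModule F α (V ⧸ W)) := fun l =>
    twistedRange (f l) (extZero l) (hflie l)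
  have hR : ∀ l, IsAtom (R l) := fun l => isAtom_twistedRange hirr (hf0 l) (hflie l)
  refine ⟨α, isComponent_of_atoms (hR 0)
    (nonempty_equiv_twistedRange (injective_of_twisted hirr (hf0 0) (hflie 0)) (map_zero extZero)
      (hflie 0))
    ((Finset.Icc (0 : Fin N → ℤ) (fun i => |k i|)).image R) (fun b hb => ?_) ?_⟩
  · obtain ⟨l, -, rfl⟩ := Finset.mem_image.mp hb
    exact hR l
  · rw [Finset.sup_image, eq_top_iff]
    intro w _
    set S := (Finset.Icc (0 : Fin N → ℤ) (fun i => |k i|)).sup (id ∘ R) with hS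
    refine LoopModule.mem_of_forall_of S.toSubmodule (fun l u => ?_) w
    obtain ⟨v, rfl⟩ := LieSubmodule.Quotient.surjective_mk' W u
    have hvt : v ∈ ⨆ k, (grade F (addInt α k) : Submodule ℂ V) := by rw [h]; trivial
    refine (iSup_le fun j v hv => ?_ : (⨆ k, (grade F (addInt α k) : Submodule ℂ V)) ≤
      S.toSubmodule.comap (LoopModule.of F α (V ⧸ W) l ∘ₗ
        (LieSubmodule.Quotient.mk' W : V →ₗ[ℂ] V ⧸ W))) hvt
    -- The class of `v` has a representative of degree `j'` with `l - j'` in the box, and `f (l -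
    -- j')` sends it to `v̄(l)`.
    obtain ⟨j', v', hj', hv', hvv, -⟩ :=
      exists_grade_box (H := H) (fun i => (hz i).1) hζ hζW hv l
    have hmem : LoopModule.of F α (V ⧸ W) l (LieSubmodule.Quotient.mk' W v') ∈ R (l - j') := by
      refine ⟨v', ?_⟩
      rw [hf _ _ _ hv', add_sub_cancel]
    rw [hvv] at hmem
    have hle : R (l - j') ≤ S := Finset.le_sup (f := id ∘ R) hj'
    exact hle hmem

end Main

end ToroidalLie

end

/-! ### Weyl pairs and commuting oscillators -/

noncomputable section

namespace ToroidalLie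

section WeylTrace

variable {V : Type*} [AddCommGroup V] [Module ℂ V]

/-- Operators `p, q` with `p q - q p = 1` cannot act on a periodic chain of non-zero
finite-dimensional spaces. -/
lemma eq_bot_of_weyl {W : ℤ → Submodule ℂ V} (hW : ∀ j, FiniteDimensional ℂ (W j))
    {p q : Module.End ℂ V} (hp : ∀ j, ∀ v ∈ W j, p v ∈ W (j + 1))
    (hq : ∀ j, ∀ v ∈ W (j + 1), q v ∈ W j) (hpq : p * q - q * p = 1) {z : (Module.End ℂ V)ˣ}
    {k : ℕ} (hk : 0 < k) (hz : ∀ j v, v ∈ W j ↔ z.val v ∈ W (j + k))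
    (hzp : Commute z.val p) (hzq : Commute z.val q) : W 0 = ⊥ := by
  have hN : ∀ j, ∀ v ∈ W j, (q * p) v ∈ W j := fun j v hv => hq j _ (hp j v hv)
  let f : ℤ → ℂ := fun j => LinearMap.trace ℂ (W j) ((q * p).restrict (hN j))
  -- Cyclicity of the trace: `q p` on `W j` has the trace of `p q` on `W (j + 1)`, and `p q = q p +
  -- 1`.
  have h₁ : ∀ j, f j = f (j + 1) + Module.finrank ℂ (W (j + 1)) := fun j => by
    have e₁ : (q * p).restrict (hN j) = (q.restrict (hq j)) ∘ₗ (p.restrict (hp j)) :=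
      LinearMap.ext fun v => rfl
    have e₂ : (p.restrict (hp j)) ∘ₗ (q.restrict (hq j)) =
        (q * p).restrict (hN (j + 1)) + LinearMap.id := LinearMap.ext fun v => Subtype.ext <| by
      have := congrArg (fun g : Module.End ℂ V => g v) hpq
      simp only [LinearMap.sub_apply, Module.End.one_apply] at this
      change (p * q) v = (q * p) v + v
      rw [← sub_eq_iff_eq_add']
      exact this
    change LinearMap.trace ℂ (W j) ((q * p).restrict (hN j)) = _
    rw [e₁, LinearMap.trace_comp_comm', e₂, map_add, LinearMap.trace_id]
  have h₂ : ∀ i : ℕ, f 0 = f i + ∑ l ∈ Finset.range i, (Module.finrank ℂ (W (l + 1)) : ℂ) := by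
    intro i
    induction i with
    | zero => simp
    | succ i ih =>
      rw [ih, h₁ i, Finset.sum_range_succ]
      push_cast
      ring
  have e' : ∀ v, z.val ((z⁻¹).val v) = v := fun v =>
    congrArg (fun g : Module.End ℂ V => g v) z.mul_inv
  have e'' : ∀ v, (z⁻¹).val (z.val v) = v := fun v =>
    congrArg (fun g : Module.End ℂ V => g v) z.inv_mul
  have hz0 : ∀ v, v ∈ W 0 ↔ z.val v ∈ W k := fun v => by
    have := hz 0 v
    rwa [zero_add] at this
  let e : W 0 ≃ₗ[ℂ] W k :=
    { toFun := fun v => ⟨z.val v, (hz0 v).mp v.2⟩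
      map_add' := fun v w => Subtype.ext (map_add _ _ _)
      map_smul' := fun c v => Subtype.ext (map_smul _ _ _)
      invFun := fun v => ⟨(z⁻¹).val v, (hz0 _).mpr (by rw [e']; exact v.2)⟩
      left_inv := fun v => Subtype.ext (e'' v)
      right_inv := fun v => Subtype.ext (e' v) }
  -- Conjugation by `z` carries `q p` on `W 0` to `q p` on `W k`. Hence the dimensions added along
  -- one period sum to zero.
  have h₃ : f k = f 0 := by
    have : (q * p).restrict (hN k) = e.conj ((q * p).restrict (hN 0)) :=
      LinearMap.ext fun v => Subtype.ext <| by
        have h := congrArg (fun g : Module.End ℂ V => g ((z⁻¹).val v)) (hzq.mul_right hzp).eq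
        change (q * p) (v : V) = (z.val * (q * p)) ((z⁻¹).val v)
        change (z.val * (q * p)) ((z⁻¹).val v) = (q * p) (z.val ((z⁻¹).val v)) at h
        rw [h, e']
    change LinearMap.trace ℂ (W k) ((q * p).restrict (hN k)) = _
    rw [this, LinearMap.trace_conj']
  have h₄ := h₂ k
  rw [h₃, left_eq_add, ← Nat.cast_sum, Nat.cast_eq_zero, Finset.sum_eq_zero_iff] at h₄
  -- The last summand is the dimension of `W k`, which is isomorphic to `W 0` through `z`.
  have h₅ := h₄ (k - 1) (Finset.mem_range.mpr (by omega))
  have h₆ : ((k - 1 : ℕ) : ℤ) + 1 = k := by omega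
  rw [h₆] at h₅
  have h₇ : Module.finrank ℂ (W 0) = 0 := e.finrank_eq.trans h₅
  exact Submodule.finrank_eq_zero.mp h₇

end WeylTrace

section CommonEigenvector

variable {V : Type*} [AddCommGroup V] [Module ℂ V]

/-- On a non-zero invariant subspace of `E` of least dimension every `T i` is scalar, since its
eigenspaces there are again invariant. This works for infinite families. -/
lemma exists_common_eigenvector {ι : Type*} (T : ι → Module.End ℂ V)
    (hT : ∀ i j, Commute (T i) (T j)) (E : Submodule ℂ V) [FiniteDimensional ℂ E] (hE : E ≠ ⊥)
    (hTE : ∀ i, ∀ v ∈ E, T i v ∈ E) :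
    ∃ v ∈ E, v ≠ 0 ∧ ∃ l : ι → ℂ, ∀ i, T i v = l i • v := by
  let 𝒮 : Set (Submodule ℂ V) := {S | S ≤ E ∧ S ≠ ⊥ ∧ ∀ i, ∀ v ∈ S, T i v ∈ S}
  obtain ⟨S, ⟨hSE, hS, hTS⟩, hmin⟩ :=
    (measure fun S : Submodule ℂ V => Module.finrank ℂ S).wf.has_min 𝒮 ⟨E, le_rfl, hE, hTE⟩
  have : FiniteDimensional ℂ S := Submodule.finiteDimensional_of_le hSE
  have : Nontrivial S := Submodule.nontrivial_iff_ne_bot.mpr hS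
  have key : ∀ i, ∃ c : ℂ, ∀ v ∈ S, T i v = c • v := fun i => by
    obtain ⟨c, hc⟩ := Module.End.exists_eigenvalue ((T i).restrict (hTS i))
    obtain ⟨w, hw⟩ := hc.exists_hasEigenvector
    have hw' : T i w = c • (w : V) := congrArg Subtype.val hw.apply_eq_smul
    let S' := S ⊓ LinearMap.ker (T i - algebraMap ℂ _ c)
    have hmem : ∀ v, v ∈ S' ↔ v ∈ S ∧ T i v = c • v := fun v => by
      rw [Submodule.mem_inf, LinearMap.mem_ker, LinearMap.sub_apply, Module.algebraMap_end_apply,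
        sub_eq_zero]
    have hS' : S' ∈ 𝒮 := by
      refine ⟨inf_le_left.trans hSE, fun h0 => hw.2 (Subtype.ext ?_), fun j v hv => ?_⟩
      · have : (w : V) ∈ S' := (hmem _).mpr ⟨w.2, hw'⟩
        rw [h0] at this
        simpa using this
      · rw [hmem] at hv ⊢
        refine ⟨hTS j v hv.1, ?_⟩
        have := congrArg (fun g : Module.End ℂ V => g v) (hT i j).eq
        simp only [Module.End.mul_apply] at this
        rw [this, hv.2, map_smul]
    have h := hmin S' hS'
    have heq : S' = S := Submodule.eq_of_le_of_finrank_le inf_le_left (not_lt.mp h)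
    exact ⟨c, fun v hv => ((hmem v).mp (heq ▸ hv)).2⟩
  choose l hl using key
  obtain ⟨v, hv, hv0⟩ := Submodule.exists_mem_ne_zero_of_ne_bot hS
  exact ⟨v, hSE hv, hv0, l, fun i => hl i v hv⟩

/-- Vectors separated by operators are linearly independent. -/
lemma linearIndependent_of_separating {κ : Type*} (w : κ → V) (T : κ → Module.End ℂ V)
    (h : ∀ k l, k ≠ l → T k (w l) = 0) (h' : ∀ k, T k (w k) ≠ 0) : LinearIndependent ℂ w := by
  classical
  rw [linearIndependent_iff']
  intro s c hs k hk
  have := congrArg (T k) hs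
  rw [map_sum, map_zero, Finset.sum_eq_single k] at this
  · rw [map_smul] at this
    exact (smul_eq_zero.mp this).resolve_right (h' k)
  · intro l _ hl
    rw [map_smul, h k l hl.symm, smul_zero]
  · exact fun hk' => absurd hk hk'

lemma not_infinite_of_linearIndependent {κ : Type*} [Infinite κ] {w : κ → V}
    (h : LinearIndependent ℂ w) (E : Submodule ℂ V) [FiniteDimensional ℂ E] (hw : ∀ k, w k ∈ E) :
    False := by
  have : LinearIndependent ℂ (fun k => (⟨w k, hw k⟩ : E)) :=
    LinearIndependent.of_comp E.subtype h
  have := this.finite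
  exact not_finite κ

end CommonEigenvector

section Oscillators

variable {V ι : Type*} [AddCommGroup V] [Module ℂ V]

/-- A family of commuting oscillators: `pᵢ qᵢ - qᵢ pᵢ = ζᵢ` with invertible central `ζᵢ`, where
`pᵢ = x i true` and `qᵢ = x i false`. -/
structure Oscillators (x : ι → Bool → Module.End ℂ V) (ζ : ι → (Module.End ℂ V)ˣ) : Prop where
  comm_self : ∀ i, x i true * x i false - x i false * x i true = (ζ i).val
  comm : ∀ i j, i ≠ j → ∀ a b, Commute (x i a) (x j b)
  central : ∀ i j a, Commute (ζ i).val (x j a)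
  central_central : ∀ i j, Commute (ζ i).val (ζ j).val

namespace Oscillators

variable {x : ι → Bool → Module.End ℂ V} {ζ : ι → (Module.End ℂ V)ˣ}

/-- The number operator `ζᵢ⁻¹ qᵢ pᵢ`. -/
def num (x : ι → Bool → Module.End ℂ V) (ζ : ι → (Module.End ℂ V)ˣ) (i : ι) : Module.End ℂ V :=
  (ζ i)⁻¹.val * (x i false * x i true)

/-- The change of the eigenvalue of the number operator. -/
def sgn : Bool → ℂ
  | true => -1
  | false => 1

/-- The eigenvalue of the number operator on vectors that may be killed. -/
def bad : Bool → ℂ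
  | true => 0
  | false => -1

variable (h : Oscillators x ζ)
include h

lemma central_inv (i j : ι) (a : Bool) : Commute (ζ i)⁻¹.val (x j a) :=
  (h.central i j a).units_inv_left

lemma num_mul_of_ne {i j : ι} (hij : i ≠ j) (a : Bool) : Commute (num x ζ i) (x j a) :=
  (h.central_inv i j a).mul_left ((h.comm i j hij _ _).mul_left (h.comm i j hij _ _))

lemma num_comm (i j : ι) : Commute (num x ζ i) (num x ζ j) := by
  by_cases hij : i = j
  · rw [hij]
  · refine Commute.mul_right ?_ ((h.num_mul_of_ne hij _).mul_right (h.num_mul_of_ne hij _))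
    refine Commute.mul_left ?_ ?_
    · exact ((h.central_central i j).units_inv_left).units_inv_right
    · exact ((h.central_inv j i _).mul_right (h.central_inv j i _)).symm

/-- The ladder relation: `pᵢ` lowers and `qᵢ` raises the eigenvalue of the `i`-th number operator by
one. This shift later separates the vectors. -/
lemma num_mul_self (i : ι) (a : Bool) : num x ζ i * x i a = x i a * num x ζ i + sgn a • x i a := by
  have e : x i true * x i false = x i false * x i true + (ζ i).val := by
    rw [← h.comm_self i]; abel
  have c := fun a => (h.central_inv i i a).eq
  cases a
  · simp only [num, sgn, one_smul]
    calc (ζ i)⁻¹.val * (x i false * x i true) * x i false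
        = (ζ i)⁻¹.val * x i false * (x i true * x i false) := by noncomm_ring
      _ = x i false * ((ζ i)⁻¹.val * (x i false * x i true)) + x i false * ((ζ i)⁻¹.val * (ζ i).val) := by
          rw [e, c]; noncomm_ring
      _ = _ := by rw [Units.inv_mul, mul_one]
  · simp only [num, sgn, neg_smul, one_smul]
    have e' : x i false * x i true = x i true * x i false - (ζ i).val := by rw [e]; abel
    calc (ζ i)⁻¹.val * (x i false * x i true) * x i true
        = (ζ i)⁻¹.val * x i true * (x i false * x i true) - ((ζ i)⁻¹.val * (ζ i).val) * x i true := by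
          conv_lhs => rw [e']
          noncomm_ring
      _ = _ := by rw [Units.inv_mul, one_mul, c]; noncomm_ring

/-- The number operator `ζᵢ⁻¹ qᵢ pᵢ` vanishes where `pᵢ` does, and adding 1 to it gives `ζᵢ⁻¹ pᵢ
qᵢ`, which vanishes where `qᵢ` does. -/
lemma apply_ne_zero {i : ι} {v : V} {l : ℂ} (hv : num x ζ i v = l • v) (hv0 : v ≠ 0) {a : Bool}
    (hl : l ≠ bad a) : x i a v ≠ 0 := by
  intro h0
  cases a
  · have e : num x ζ i + 1 = (ζ i)⁻¹.val * (x i true * x i false) := by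
      have : x i true * x i false = x i false * x i true + (ζ i).val := by
        rw [← h.comm_self i]; abel
      rw [this, mul_add, Units.inv_mul]; rfl
    have := congrArg (fun g : Module.End ℂ V => g v) e
    simp only [LinearMap.add_apply, hv, Module.End.one_apply, Module.End.mul_apply, h0,
      map_zero] at this
    nth_rewrite 2 [← one_smul ℂ v] at this
    rw [← add_smul, smul_eq_zero] at this
    rcases this with h | h
    · exact hl (eq_neg_of_add_eq_zero_left h)
    · exact hv0 h
  · have : num x ζ i v = 0 := by
      simp only [num, Module.End.mul_apply, h0, map_zero]
    rw [hv, smul_eq_zero] at this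
    rcases this with h | h
    · exact hl h
    · exact hv0 h

/-- Infinitely many products of two oscillators, all indices distinct, applied to a common
eigenvector of the number operators, do not fit into a finite-dimensional space. -/
lemma false_of_infinite {κ : Type*} [Infinite κ] {v : V} (hv0 : v ≠ 0) {l : ι → ℂ}
    (hv : ∀ i, num x ζ i v = l i • v) (i j : κ → ι) (hij : ∀ k, i k ≠ j k)
    (hd : ∀ k k', k ≠ k' → i k ≠ i k' ∧ i k ≠ j k') {a b : Bool}
    (ha : ∀ k, l (i k) ≠ bad a) (hb : ∀ k, l (j k) ≠ bad b) (E : Submodule ℂ V)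
    [FiniteDimensional ℂ E] (hE : ∀ k, x (i k) a (x (j k) b v) ∈ E) : False := by
  have hc : ∀ {r s : ι}, r ≠ s → ∀ a w, num x ζ r (x s a w) = x s a (num x ζ r w) :=
    fun hrs a w => congrArg (fun g : Module.End ℂ V => g w) (h.num_mul_of_ne hrs a).eq
  have h₁ : ∀ k, num x ζ (i k) (x (j k) b v) = l (i k) • x (j k) b v := fun k => by
    rw [hc (hij k), hv, map_smul]
  have h₂ : ∀ k, x (i k) a (x (j k) b v) ≠ 0 := fun k =>
    h.apply_ne_zero (h₁ k) (h.apply_ne_zero (hv _) hv0 (hb k)) (ha k)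
  refine not_infinite_of_linearIndependent
    (linearIndependent_of_separating (fun k => x (i k) a (x (j k) b v))
      -- This operator kills every product not involving the index `i k`, and multiplies the `k`-th
      -- product by `±1`.
      (fun k => num x ζ (i k) - algebraMap ℂ _ (l (i k))) (fun k k' hk => ?_) fun k => ?_) E hE
  · rw [LinearMap.sub_apply, Module.algebraMap_end_apply, hc (hd k k' hk).1, hc (hd k k' hk).2, hv,
      map_smul, map_smul, sub_self]
  · have := congrArg (fun g : Module.End ℂ V => g (x (j k) b v)) (h.num_mul_self (i k) a)
    simp only [Module.End.mul_apply, LinearMap.add_apply, LinearMap.smul_apply, h₁ k,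
      map_smul] at this
    rw [LinearMap.sub_apply, Module.algebraMap_end_apply, this, add_sub_cancel_left]
    refine smul_ne_zero ?_ (h₂ k)
    cases a <;> simp [sgn]

end Oscillators

end Oscillators

end ToroidalLie

end

/-! ### Graded Heisenberg families on finite-dimensional spaces -/

noncomputable section

namespace ToroidalLie

/-- A Heisenberg-type family of operators `a r`, graded by `G`, on a family of finite-dimensional
subspaces: `[a r, a s] = ω (r + s) r` is central, additive in `r`, and zero or invertible. -/
structure GradedHeisenberg {G V : Type*} [AddCommGroup G] [AddCommGroup V] [Module ℂ V]
    (U : G → Submodule ℂ V) (a : G → Module.End ℂ V) (ω : G → G →+ Module.End ℂ V) : Prop where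
  finite : ∀ g, FiniteDimensional ℂ (U g)
  ne_bot : U 0 ≠ ⊥
  a_mem : ∀ r g, ∀ v ∈ U g, a r v ∈ U (g + r)
  comm : ∀ r s, a r * a s - a s * a r = ω (r + s) r
  bijective : ∀ m r, ω m r ≠ 0 → Function.Bijective (ω m r)
  ω_mem : ∀ m r, ω m r ≠ 0 → ∀ g v, v ∈ U g ↔ ω m r v ∈ U (g + m)
  ω_comm_a : ∀ m r s, Commute (ω m r) (a s)
  ω_comm : ∀ m r m' r', Commute (ω m r) (ω m' r')

namespace GradedHeisenberg

variable {G V : Type*} [AddCommGroup G] [AddCommGroup V] [Module ℂ V]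
variable {U : G → Submodule ℂ V} {a : G → Module.End ℂ V} {ω : G → G →+ Module.End ℂ V}
variable (h : GradedHeisenberg U a ω)

/-- The degrees of the invertible operators commuting with all `a r`. -/
def periods (U : G → Submodule ℂ V) (a : G → Module.End ℂ V) : AddSubgroup G where
  carrier := {l | ∃ z : (Module.End ℂ V)ˣ, (∀ g v, v ∈ U g ↔ z.val v ∈ U (g + l)) ∧
    ∀ s, Commute z.val (a s)}
  zero_mem' := ⟨1, fun g v => by simp, fun s => Commute.one_left _⟩
  add_mem' := by
    rintro l l' ⟨z, hz, hz'⟩ ⟨w, hw, hw'⟩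
    refine ⟨w * z, fun g v => ?_, fun s => (hw' s).mul_left (hz' s)⟩
    rw [hz, hw, add_assoc]
    rfl
  neg_mem' := by
    rintro l ⟨z, hz, hz'⟩
    refine ⟨z⁻¹, fun g v => ?_, fun s => (hz' s).units_inv_left⟩
    rw [hz (g + -l), neg_add_cancel_right]
    have : z.val ((z⁻¹).val v) = v := congrArg (fun g : Module.End ℂ V => g v) z.mul_inv
    rw [this]

include h

lemma exists_unit {m r : G} (hm : ω m r ≠ 0) : ∃ z : (Module.End ℂ V)ˣ, z.val = ω m r :=
  (Module.End.isUnit_iff _).mpr (h.bijective m r hm)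

lemma mem_periods {m r : G} (hm : ω m r ≠ 0) : m ∈ periods U a := by
  obtain ⟨z, hz⟩ := h.exists_unit hm
  exact ⟨z, fun g v => by rw [hz]; exact h.ω_mem m r hm g v,
    fun s => by rw [hz]; exact h.ω_comm_a m r s⟩

lemma comm_sub (m r : G) : a r * a (m - r) - a (m - r) * a r = ω m r := by
  rw [h.comm, add_sub_cancel]

/-- If `a r` and `a (m - r)` do not commute, no multiple of `r` is a period. -/
lemma nsmul_notMem_periods {m r : G} (hm : ω m r ≠ 0) {k : ℕ} (hk : 0 < k) :
    k • r ∉ periods U a := by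
  rintro ⟨z, hz, hza⟩
  obtain ⟨w, hw⟩ := h.exists_unit hm
  have hwmem : ∀ g v, v ∈ U g ↔ w.val v ∈ U (g + m) := fun g v => by
    rw [hw]; exact h.ω_mem m r hm g v
  have hwa : ∀ s, Commute w.val (a s) := fun s => by rw [hw]; exact h.ω_comm_a m r s
  have hww : ∀ v, w.val ((w⁻¹).val v) = v := fun v =>
    congrArg (fun g : Module.End ℂ V => g v) w.mul_inv
  -- In fact they always commute: `w` is the commutator of `a r` and `a (m - r)`, and `z` commutes
  -- with both.
  by_cases hzw : Commute z.val w.val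
  · refine h.ne_bot ?_
    -- Dividing `a (m - r)` by `ω m r` lowers its degree to `-r` and turns the pair into a Weyl pair
    -- along the multiples of `r`.
    have := eq_bot_of_weyl (W := fun j : ℤ => U (j • r)) (fun j => h.finite _) (p := a r)
      (q := (w⁻¹).val * a (m - r)) (fun j v hv => ?_) (fun j v hv => ?_) ?_ hk (z := z)
      (fun j v => ?_) (hza r) ?_
    · simpa using this
    · rw [add_smul, one_smul]
      exact h.a_mem r _ v hv
    · rw [hwmem, Module.End.mul_apply, hww]
      have := h.a_mem (m - r) _ v hv
      rwa [add_smul, one_smul, add_add_sub_cancel] at this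
    · have e : a r * ((w⁻¹).val * a (m - r)) = (w⁻¹).val * (a r * a (m - r)) := by
        rw [← mul_assoc, ← mul_assoc, (hwa r).units_inv_left.eq]
      rw [e, mul_assoc, ← mul_sub, h.comm_sub, ← hw, Units.inv_mul]
    · rw [add_smul, natCast_zsmul]
      exact hz _ v
    · exact hzw.units_inv_right.mul_right (hza _)
  · refine hzw ?_
    rw [hw, ← h.comm_sub m r]
    exact ((hza _).mul_right (hza _)).sub_right ((hza _).mul_right (hza _))

section Rank

variable {Λ : AddSubgroup G} (hΛ : ∀ m r, ω m r ≠ 0 → m ∈ Λ)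
include hΛ

lemma commute_of_notMem {r s : G} (hrs : r + s ∉ Λ) : Commute (a r) (a s) := by
  have : ω (r + s) r = 0 := by
    by_contra hne
    exact hrs (hΛ _ _ hne)
  rw [commute_iff_lie_eq, Ring.lie_def, h.comm, this]

/-- Since `m ∈ Λ`, the degrees of two operators with different indices add up to `± rᵢ ± rⱼ` modulo
`Λ`; this is outside `Λ`, where every commutator vanishes. -/
lemma oscillators {ι : Type*} {m : G} (hm : m ∈ Λ) (r : ι → G)
    (hadd : ∀ i j, i ≠ j → r i + r j ∉ Λ) (hsub : ∀ i j, i ≠ j → r i - r j ∉ Λ)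
    {ζ : ι → (Module.End ℂ V)ˣ} (hζ : ∀ i, (ζ i).val = ω m (r i)) :
    Oscillators (fun i b => if b then a (r i) else a (m - r i)) ζ where
  comm_self i := by simp [h.comm_sub, hζ]
  comm i j hij b c := by
    have hmem : ∀ {x y : G}, y ∉ Λ → x ∈ Λ → x + y ∉ Λ := fun hy hx hxy =>
      hy ((Λ.add_mem_cancel_left hx).mp hxy)
    cases b <;> cases c <;> refine h.commute_of_notMem hΛ ?_
    · rw [show m - r i + (m - r j) = (m + m) + -(r i + r j) by abel]
      exact hmem (fun hn => hadd i j hij (neg_mem_iff.mp hn)) (add_mem hm hm)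
    · rw [show m - r i + r j = m + (r j - r i) by abel]
      exact hmem (hsub j i hij.symm) hm
    · rw [show r i + (m - r j) = m + (r i - r j) by abel]
      exact hmem (hsub i j hij) hm
    · exact hadd i j hij
  central i j b := by rw [hζ]; cases b <;> exact h.ω_comm_a _ _ _
  central_central i j := by rw [hζ, hζ]; exact h.ω_comm _ _ _ _

/-- The degrees modulo the periods cannot contain a plane on which `[a r, a (m - r)]` is non-zero
off a line. -/
lemma false_of_independent {m e f : G} (hm : m ∈ Λ)
    (hef : ∀ x y : ℤ, x • e + y • f ∈ Λ → x = 0 ∧ y = 0)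
    (hω : ∀ x y : ℤ, x ≠ 0 → ω m (x • e + y • f) ≠ 0) : False := by
  -- The coefficient of `e` is kept positive, so `hω` applies to each `r i` and no sum `r i + r j`
  -- can lie in `Λ`.
  let r : ℕ × ℤ → G := fun i => ((i.1 : ℤ) + 1) • e + i.2 • f
  have hr : ∀ i, ω m (r i) ≠ 0 := fun i => hω _ _ (by omega)
  choose ζ hζ using fun i => h.exists_unit (hr i)
  have ho := h.oscillators hΛ hm r (fun i j hij hmem => ?_) (fun i j hij hmem => ?_) hζ
  rotate_left
  · rw [show r i + r j = ((i.1 : ℤ) + 1 + (j.1 + 1)) • e + (i.2 + j.2) • f by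
      simp only [r, add_smul]; abel] at hmem
    have := (hef _ _ hmem).1
    omega
  · rw [show r i - r j = ((i.1 : ℤ) + 1 - (j.1 + 1)) • e + (i.2 - j.2) • f by
      simp only [r, sub_smul, add_smul]; abel] at hmem
    obtain ⟨h₁, h₂⟩ := hef _ _ hmem
    exact hij (Prod.ext (by omega) (by omega))
  set x : ℕ × ℤ → Bool → Module.End ℂ V := fun i b => if b then a (r i) else a (m - r i) with hx
  have hxt : ∀ i g, ∀ v ∈ U g, x i true v ∈ U (g + r i) := fun i g v hv => h.a_mem _ g v hv
  have hxf : ∀ i g, ∀ v ∈ U g, x i false v ∈ U (g + (m - r i)) := fun i g v hv => h.a_mem _ g v hv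
  have hfin := h.finite
  obtain ⟨v, hv, hv0, l, hl⟩ := exists_common_eigenvector (Oscillators.num x ζ) ho.num_comm (U 0)
    h.ne_bot fun i v hv => by
      rw [h.ω_mem m (r i) (hr i), ← hζ, Oscillators.num, ← Module.End.mul_apply, ← mul_assoc,
        Units.mul_inv, one_mul]
      have := hxf i _ _ (hxt i _ v hv)
      rwa [add_add_sub_cancel] at this
  -- The product of `p` at `(n, y)` and `q` at `(n, y + s)` has degree `m - s f`, independent of `n`
  -- and `y`. So only finitely many columns `n` can contain such a pair that is not forced to kill
  -- `v`.
  have hcol : ∀ s : ℤ, s = 1 ∨ s = -1 →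
      {n : ℕ | ∃ y, l (n, y) ≠ 0 ∧ l (n, y + s) ≠ -1}.Finite := by
    intro s hs
    by_contra hinf
    have hinf' : Infinite {n : ℕ | ∃ y, l (n, y) ≠ 0 ∧ l (n, y + s) ≠ -1} :=
      Set.infinite_coe_iff.mpr hinf
    choose y hy hy' using fun n : {n : ℕ | ∃ y, l (n, y) ≠ 0 ∧ l (n, y + s) ≠ -1} => n.2
    refine ho.false_of_infinite hv0 hl (κ := {n : ℕ | ∃ y, l (n, y) ≠ 0 ∧ l (n, y + s) ≠ -1})
      (fun n => (n.1, y n)) (fun n => (n.1, y n + s)) (fun n hn => ?_) (fun n n' hn => ?_)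
      (a := true) (b := false) hy hy' (U (m - s • f)) fun n => ?_
    · have := congrArg Prod.snd hn
      simp only at this
      omega
    · have := fun h => hn (Subtype.ext h)
      exact ⟨fun h => this (congrArg Prod.fst h), fun h => this (congrArg Prod.fst h)⟩
    · have := hxt (n.1, y n) _ _ (hxf (n.1, y n + s) _ v hv)
      convert this using 2
      simp only [r, add_smul]; abel
  obtain ⟨n, hn⟩ := ((hcol 1 (Or.inl rfl)).union (hcol (-1) (Or.inr rfl))).infinite_compl.nonempty
  rw [Set.mem_compl_iff, Set.mem_union, not_or] at hn
  -- In the chosen column a non-zero eigenvalue forces `-1` at both neighbours. Hence the column is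
  -- everywhere non-zero or everywhere zero.
  have hstep : ∀ s : ℤ, s = 1 ∨ s = -1 → ∀ y, l (n, y) ≠ 0 → l (n, y + s) ≠ 0 := by
    intro s hs y hy h0
    have : l (n, y + s) ≠ -1 := by rw [h0]; simp
    rcases hs with rfl | rfl
    · exact hn.1 ⟨y, hy, this⟩
    · exact hn.2 ⟨y, hy, this⟩
  by_cases hex : ∃ y₀, l (n, y₀) ≠ 0
  · obtain ⟨y₀, hy₀⟩ := hex
    have hall : ∀ y, l (n, y) ≠ 0 := fun y => by
      have hd : ∀ d : ℤ, l (n, y₀ + d) ≠ 0 := fun d => by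
        induction d using Int.induction_on with
        | zero => rwa [add_zero]
        | succ d ih => rw [← add_assoc]; exact hstep 1 (Or.inl rfl) _ ih
        | pred d ih => rw [sub_eq_add_neg, ← add_assoc]; exact hstep (-1) (Or.inr rfl) _ ih
      have := hd (y - y₀)
      rwa [add_sub_cancel] at this
    -- No `p` of this column kills `v`. Pairing the entries `y + 1` and `-(y + 1)` gives a degree
    -- independent of `y`, and adding 1 keeps the two indices distinct at `y = 0`.
    refine ho.false_of_infinite hv0 hl (κ := ℕ) (fun y => (n, (y : ℤ) + 1))
      (fun y => (n, -((y : ℤ) + 1))) (fun y hy => ?_) (fun y y' hy => ?_) (a := true) (b := true)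
      (fun y => hall _) (fun y => hall _) (U (((n : ℤ) + 1 + (n + 1)) • e)) fun y => ?_
    · have := congrArg Prod.snd hy
      simp only at this
      omega
    · refine ⟨fun h => ?_, fun h => ?_⟩ <;>
      · have := congrArg Prod.snd h
        simp only at this
        omega
    · have := hxt (n, (y : ℤ) + 1) _ _ (hxt (n, -((y : ℤ) + 1)) _ v hv)
      convert this using 2
      simp only [r, add_smul, neg_smul]; abel
  · push Not at hex
    have hall : ∀ y, l (n, y) ≠ -1 := fun y => by rw [hex]; simp
    -- All eigenvalues in the column are 0, so no `q` kills `v`, and the same pairing works with two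
    -- `q`'s.
    refine ho.false_of_infinite hv0 hl (κ := ℕ) (fun y => (n, (y : ℤ) + 1))
      (fun y => (n, -((y : ℤ) + 1))) (fun y hy => ?_) (fun y y' hy => ?_) (a := false) (b := false)
      (fun y => hall _) (fun y => hall _) (U (m + m - ((n : ℤ) + 1 + (n + 1)) • e)) fun y => ?_
    · have := congrArg Prod.snd hy
      simp only at this
      omega
    · refine ⟨fun h => ?_, fun h => ?_⟩ <;>
      · have := congrArg Prod.snd h
        simp only at this
        omega
    · have := hxf (n, (y : ℤ) + 1) _ _ (hxf (n, -((y : ℤ) + 1)) _ v hv)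
      convert this using 2
      simp only [r, add_smul, neg_smul]; abel

end Rank

end GradedHeisenberg

end ToroidalLie

end

/-! ### The lattice of central degrees and an adapted basis of `ℤ^n` -/

noncomputable section

namespace ToroidalLie

/-- The saturation of a subgroup. -/
def saturation {G : Type*} [AddCommGroup G] (L : AddSubgroup G) : AddSubgroup G where
  carrier := {r | ∃ k : ℕ, 0 < k ∧ k • r ∈ L}
  zero_mem' := ⟨1, one_pos, by simp [zero_mem]⟩
  add_mem' := by
    rintro r s ⟨k, hk, hr⟩ ⟨l, hl, hs⟩
    refine ⟨k * l, Nat.mul_pos hk hl, ?_⟩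
    rw [smul_add, mul_comm, mul_smul, mul_comm, mul_smul]
    exact add_mem (nsmul_mem hr l) (nsmul_mem hs k)
  neg_mem' := by
    rintro r ⟨k, hk, hr⟩
    exact ⟨k, hk, by rw [smul_neg]; exact neg_mem hr⟩

lemma le_saturation {G : Type*} [AddCommGroup G] (L : AddSubgroup G) : L ≤ saturation L :=
  fun r hr => ⟨1, one_pos, by simpa using hr⟩

lemma mem_saturation_of_zsmul_mem {G : Type*} [AddCommGroup G] {L : AddSubgroup G} {r : G} {k : ℤ}
    (hk : k ≠ 0) (h : k • r ∈ saturation L) : r ∈ saturation L := by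
  have h' : k.natAbs • r ∈ saturation L := by
    rcases Int.natAbs_eq k with hk' | hk'
    · rw [hk', natCast_zsmul] at h; exact h
    · rw [hk', neg_smul, neg_mem_iff, natCast_zsmul] at h; exact h
  obtain ⟨l, hl, hmem⟩ := h'
  exact ⟨l * k.natAbs, Nat.mul_pos hl (Int.natAbs_pos.mpr hk), by rwa [mul_smul]⟩

section Basis

variable {N : ℕ}

/-- The element of `GL(n, ℤ)` whose columns form a given basis. -/
def glOfBasis (c : Module.Basis (Fin (N + 1)) ℤ (Fin (N + 1) → ℤ)) :
    Matrix.GeneralLinearGroup (Fin (N + 1)) ℤ :=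
  ⟨(Pi.basisFun ℤ _).toMatrix c, c.toMatrix (Pi.basisFun ℤ _),
    (Pi.basisFun ℤ _).toMatrix_mul_toMatrix_flip c, c.toMatrix_mul_toMatrix_flip (Pi.basisFun ℤ _)⟩

lemma glOfBasis_mulVec (c : Module.Basis (Fin (N + 1)) ℤ (Fin (N + 1) → ℤ)) (m : Fin (N + 1) → ℤ) :
    (glOfBasis c).1.mulVec m = ∑ i, m i • c i := by
  funext j
  change ∑ i, (Pi.basisFun ℤ _).toMatrix c j i * m i = _
  rw [Finset.sum_apply]
  refine Finset.sum_congr rfl fun i _ => ?_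
  simp [Module.Basis.toMatrix_apply, mul_comm]

/-- A surjective linear form on `ℤ^(N+1)` is a coordinate of some basis. -/
lemma exists_gl_of_surjective {θ : (Fin (N + 1) → ℤ) →ₗ[ℤ] ℤ} (hθ : Function.Surjective θ) :
    ∃ B : Matrix.GeneralLinearGroup (Fin (N + 1)) ℤ, ∀ m, θ (B.1.mulVec m) = m (Fin.last N) := by
  obtain ⟨y, hy⟩ := hθ 1
  have hrank : Module.finrank ℤ (LinearMap.ker θ) = N := by
    have h₁ := θ.quotKerEquivOfSurjective hθ
    have h₂ := (LinearMap.ker θ).finrank_quotient_add_finrank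
    rw [h₁.finrank_eq, Module.finrank_self, Module.finrank_fin_fun] at h₂
    omega
  let b := Module.finBasisOfFinrankEq ℤ (LinearMap.ker θ) hrank
  -- A basis of the kernel of `θ` followed by a vector with `θ y = 1`: each `z` differs from `θ z •
  -- y` by an element of the kernel.
  let c := Module.Basis.mkFinSnoc b y
    (fun k x hx hk => by
      have := congrArg θ hk
      rw [map_add, map_smul, hy, LinearMap.mem_ker.mp hx, map_zero] at this
      simpa using this)
    (fun z => ⟨-θ z, by rw [LinearMap.mem_ker, map_add, map_smul, hy]; simp⟩)
  refine ⟨glOfBasis c, fun m => ?_⟩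
  rw [glOfBasis_mulVec, map_sum, Fin.sum_univ_castSucc]
  have h₁ : c (Fin.last N) = y := by simp [c]
  have h₂ : ∀ i : Fin N, θ (c i.castSucc) = 0 := fun i => by
    have : c i.castSucc = b i := by simp [c]
    rw [this]
    exact (b i).2
  simp only [map_smul, h₁, h₂, hy, mul_zero, Finset.sum_const_zero, zero_add, smul_eq_mul, mul_one]

end Basis

namespace GradedHeisenberg

variable {V : Type*} [AddCommGroup V] [Module ℂ V] {N : ℕ}
variable {U : (Fin (N + 1) → ℤ) → Submodule ℂ V} {a : (Fin (N + 1) → ℤ) → Module.End ℂ V}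
variable {ω : (Fin (N + 1) → ℤ) → (Fin (N + 1) → ℤ) →+ Module.End ℂ V}

/-- The subgroup generated by the degrees of the non-zero central operators. -/
def degrees {G : Type*} [AddCommGroup G] (ω : G → G →+ Module.End ℂ V) : AddSubgroup G :=
  AddSubgroup.closure {m | ∃ r, ω m r ≠ 0}

variable (h : GradedHeisenberg U a ω)
include h

/-- Non-zero central operators are invertible, so their degrees generate a group of periods, and no
positive multiple of `r` is a period. -/
lemma notMem_saturation {m r : Fin (N + 1) → ℤ} (hm : ω m r ≠ 0) : r ∉ saturation (degrees ω) := by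
  rintro ⟨k, hk, hr⟩
  refine h.nsmul_notMem_periods hm hk ((AddSubgroup.closure_le _).mpr ?_ hr)
  rintro m ⟨r, hm⟩
  exact h.mem_periods hm

/-- The saturated subgroup generated by the degrees of the central operators is the kernel of a
surjective linear form. -/
lemma exists_linearForm {m₀ r₀ : Fin (N + 1) → ℤ} (h₀ : ω m₀ r₀ ≠ 0) :
    ∃ θ : (Fin (N + 1) → ℤ) →ₗ[ℤ] ℤ, Function.Surjective θ ∧
      ∀ r, θ r = 0 ↔ r ∈ saturation (degrees ω) := by
  set Λ := saturation (degrees ω) with hΛdef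
  have hΛ : ∀ m r, ω m r ≠ 0 → m ∈ Λ := fun m r hm =>
    le_saturation _ (AddSubgroup.subset_closure ⟨r, hm⟩)
  let M : Submodule ℤ (Fin (N + 1) → ℤ) := AddSubgroup.toIntSubmodule Λ
  have hM : ∀ r, r ∈ M ↔ r ∈ Λ := fun r => Iff.rfl
  -- Saturation of `Λ` is torsion-freeness of the quotient, which is therefore free.
  have htf : Module.IsTorsionFree ℤ ((Fin (N + 1) → ℤ) ⧸ M) := by
    refine Module.IsTorsionFree.of_smul_eq_zero fun k q hq => or_iff_not_imp_left.mpr fun hk => ?_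
    obtain ⟨r, rfl⟩ := Submodule.mkQ_surjective M q
    rw [← map_smul, Submodule.mkQ_apply, Submodule.Quotient.mk_eq_zero] at hq
    exact (Submodule.Quotient.mk_eq_zero M).mpr (mem_saturation_of_zsmul_mem hk hq)
  have hfree : Module.Free ℤ ((Fin (N + 1) → ℤ) ⧸ M) := inferInstance
  let b := Module.Free.chooseBasis ℤ ((Fin (N + 1) → ℤ) ⧸ M)
  have hne : M.mkQ r₀ ≠ 0 := fun h0 => h.notMem_saturation h₀ (by simpa [hM] using h0)
  have hsub : Subsingleton (Module.Free.ChooseBasisIndex ℤ ((Fin (N + 1) → ℤ) ⧸ M)) := by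
    by_contra hns
    rw [not_subsingleton_iff_nontrivial] at hns
    obtain ⟨i, j, hij⟩ := hns
    -- A plane is needed on which `ω m₀` is non-zero off the line of `f`. If `ω m₀ f = 0` for some
    -- `f` outside `Λ`, additivity lets `e = r₀` serve; if not, `ω m₀` is non-zero everywhere off
    -- `Λ` and two basis directions of the quotient serve.
    by_cases hex : ∃ f, f ∉ Λ ∧ ω m₀ f = 0
    · obtain ⟨f, hf, hf0⟩ := hex
      have hω : ∀ x y : ℤ, x ≠ 0 → ω m₀ (x • r₀ + y • f) ≠ 0 := fun x y hx => by
        rw [map_add, map_zsmul, map_zsmul, hf0, smul_zero, add_zero]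
        rw [← Int.cast_smul_eq_zsmul ℂ]
        exact smul_ne_zero (Int.cast_ne_zero.mpr hx) h₀
      refine h.false_of_independent hΛ (hΛ _ _ h₀) (e := r₀) (f := f) (fun x y hxy => ?_) hω
      have hx : x = 0 := by
        by_contra hx
        exact h.notMem_saturation (hω x y hx) hxy
      refine ⟨hx, ?_⟩
      by_contra hy
      rw [hx, zero_smul, zero_add] at hxy
      exact hf (mem_saturation_of_zsmul_mem hy hxy)
    · push Not at hex
      obtain ⟨e, he⟩ := Submodule.mkQ_surjective M (b i)
      obtain ⟨f, hf⟩ := Submodule.mkQ_surjective M (b j)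
      have hef : ∀ x y : ℤ, x • e + y • f ∈ Λ → x = 0 ∧ y = 0 := fun x y hxy => by
        have hq : M.mkQ (x • e + y • f) = 0 := (Submodule.Quotient.mk_eq_zero M).mpr hxy
        rw [map_add, map_smul, map_smul, he, hf] at hq
        have := congrArg b.repr hq
        have hi := congrArg (fun g => g i) this
        have hj := congrArg (fun g => g j) this
        simp [hij, hij.symm] at hi hj
        exact ⟨hi, hj⟩
      refine h.false_of_independent hΛ (hΛ _ _ h₀) hef fun x y hx => hex _ fun hmem => ?_
      exact hx (hef x y hmem).1
  obtain ⟨i⟩ : Nonempty (Module.Free.ChooseBasisIndex ℤ ((Fin (N + 1) → ℤ) ⧸ M)) := by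
    by_contra hemp
    rw [not_nonempty_iff] at hemp
    exact hne (b.repr.injective (Subsingleton.elim _ _))
  refine ⟨b.coord i ∘ₗ M.mkQ, fun k => ?_, fun r => ?_⟩
  · obtain ⟨r, hr⟩ := Submodule.mkQ_surjective M (k • b i)
    exact ⟨r, by rw [LinearMap.comp_apply, hr]; simp⟩
  · rw [← hM, ← Submodule.Quotient.mk_eq_zero, LinearMap.comp_apply]
    refine ⟨fun h0 => ?_, fun h0 => ?_⟩
    · refine b.repr.injective (Finsupp.ext fun j => ?_)
      rw [Subsingleton.elim j i]
      simpa using h0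
    · rw [Submodule.mkQ_apply, h0, map_zero]

/-- In a basis where the linear form is the last coordinate, the first `N` basis vectors span `Λ`.
So `ω m` vanishes on them, and a multiple of each is a sum of degrees. -/
lemma exists_gl {m₀ r₀ : Fin (N + 1) → ℤ} (h₀ : ω m₀ r₀ ≠ 0) :
    ∃ B : Matrix.GeneralLinearGroup (Fin (N + 1)) ℤ,
      (∀ m r, ω (B.1.mulVec m) r ≠ 0 → m (Fin.last N) = 0) ∧
      (∀ (i : Fin N) m, ω m (B.1.mulVec (Pi.single i.castSucc 1)) = 0) ∧
      ∀ i : Fin N, ∃ k : ℕ, 0 < k ∧ k • B.1.mulVec (Pi.single i.castSucc 1) ∈ degrees ω := by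
  obtain ⟨θ, hθ, hθ'⟩ := h.exists_linearForm h₀
  obtain ⟨B, hB⟩ := exists_gl_of_surjective hθ
  have hmem : ∀ i : Fin N, B.1.mulVec (Pi.single i.castSucc 1) ∈ saturation (degrees ω) :=
    fun i => by
      rw [← hθ', hB]
      simp [Fin.castSucc_ne_last]
  refine ⟨B, fun m r hm => ?_, fun i m => ?_, fun i => hmem i⟩
  · rw [← hB m, hθ']
    exact le_saturation _ (AddSubgroup.subset_closure ⟨r, hm⟩)
  · by_contra hne
    exact h.notMem_saturation hne (hmem i)

end GradedHeisenberg

end ToroidalLie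

end

/-! ### The Heisenberg operators `h(r)` in a module of `τ` -/

noncomputable section

namespace ToroidalLie

universe u v

section Cartan

variable {𝔤 : Type u} [LieRing 𝔤] [LieAlgebra ℂ 𝔤] [FiniteDimensional ℂ 𝔤]
  [LieAlgebra.IsSimple ℂ 𝔤] (F : InvForm 𝔤) (H : LieSubalgebra ℂ 𝔤) [H.IsCartanSubalgebra]

/-- Elements of the Cartan subalgebra are orthogonal to the root spaces of non-zero roots. -/
lemma InvForm.form_rootSpace {α : H → ℂ} (hα : α ≠ 0) {x y : 𝔤} (hx : x ∈ H)
    (hy : y ∈ LieAlgebra.rootSpace H α) : F.form x y = 0 := by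
  obtain ⟨h, hh⟩ := Function.ne_iff.mp hα
  have e : ⁅h, y⁆ = α h • y := LieAlgebra.IsKilling.lie_eq_smul_of_mem_rootSpace hy h
  have e₀ : ⁅(h : 𝔤), x⁆ = 0 := congrArg Subtype.val (trivial_lie_zero H H h ⟨x, hx⟩)
  have := F.invariant (h : 𝔤) x y
  rw [e₀, map_zero, LinearMap.zero_apply] at this
  have e' : ⁅(h : 𝔤), y⁆ = α h • y := e
  rw [e', map_smul, smul_eq_mul, eq_comm, neg_eq_zero] at this
  exact (mul_eq_zero.mp this).resolve_left hh

/-- By the root space decomposition, `H` is orthogonal to everything but itself, so the form stays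
non-degenerate on `H`. -/
lemma InvForm.eq_zero_of_orthogonal {x : 𝔤} (hx : x ∈ H) (h : ∀ y ∈ H, F.form x y = 0) : x = 0 := by
  refine F.nondegenerate.1 x fun y => ?_
  have hy : y ∈ (⊤ : LieSubmodule ℂ H 𝔤) := trivial
  rw [← LieModule.iSup_genWeightSpace_eq_top ℂ H 𝔤] at hy
  induction hy using LieSubmodule.iSup_induction' with
  | mem α y hy =>
    by_cases hα : α = 0
    · subst hα
      have : y ∈ LieAlgebra.rootSpace H (0 : H → ℂ) := hy
      rw [LieAlgebra.rootSpace_zero_eq ℂ 𝔤 H] at this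
      exact h y this
    · exact F.form_rootSpace H hα hx hy
  | zero => simp
  | add y z _ _ h₁ h₂ => rw [map_add, h₁, h₂, add_zero]

lemma InvForm.exists_form_self_eq_one : ∃ h ∈ H, F.form h h = 1 := by
  obtain ⟨x, hx, hx0⟩ : ∃ x ∈ H, x ≠ 0 := by
    by_contra hcon
    push Not at hcon
    -- A zero Cartan subalgebra would be normalised by everything, hence be all of `𝔤`, which would
    -- then be abelian.
    have hH : H = ⊥ := (LieSubalgebra.eq_bot_iff H).mpr hcon
    have hn : H.normalizer = H := LieSubalgebra.IsCartanSubalgebra.self_normalizing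
    have ht : H.normalizer = ⊤ := by
      rw [eq_top_iff]
      intro y _
      rw [LieSubalgebra.mem_normalizer_iff]
      intro z hz
      rw [hcon z hz, lie_zero]
      exact H.zero_mem
    have : LieAlgebra.IsSimple ℂ 𝔤 := inferInstance
    refine this.non_abelian ⟨fun y z => ?_⟩
    have hy : y ∈ H := by rw [← hn, ht]; trivial
    rw [hcon y hy, zero_lie]
  -- Polarization: a symmetric form with no anisotropic vector in `H` would vanish on `H`.
  obtain ⟨z, hz, hzz⟩ : ∃ z ∈ H, F.form z z ≠ 0 := by
    by_contra hcon
    push Not at hcon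
    refine hx0 (F.eq_zero_of_orthogonal H hx fun y hy => ?_)
    have := hcon _ (H.add_mem hx hy)
    have hs : F.form y x = F.form x y := F.symm.eq y x
    simp only [map_add, LinearMap.add_apply, hcon x hx, hcon y hy, hs] at this
    simpa using this
  obtain ⟨c, hc⟩ := IsAlgClosed.exists_pow_nat_eq (F.form z z) (n := 2) two_pos
  have hc0 : c ≠ 0 := by rintro rfl; simp at hc; exact hzz hc.symm
  refine ⟨c⁻¹ • z, H.smul_mem _ hz, ?_⟩
  simp only [map_smul, LinearMap.smul_apply, smul_eq_mul, ← hc]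
  field_simp

end Cartan

section ToroidalOperators

variable {𝔤 : Type u} [LieRing 𝔤] [LieAlgebra ℂ 𝔤] (F : InvForm 𝔤) {n : ℕ}

/-- The central element `∑ vᵢ t^m Kᵢ` of `𝔤 ⊗ A ⊕ Z` in `τ`. -/
def Toroidal.cen (m : Fin n → ℤ) : (Fin n → ℂ) →ₗ[ℂ] Toroidal F n where
  toFun v := ⟨CentralExt.cen F (torTwist n) (KDiff.of m v), 0⟩
  map_add' v w := by simp
  map_smul' c v := by simp

lemma Toroidal.lie_cen (x : Toroidal F n) (m : Fin n → ℤ) (v : Fin n → ℂ) :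
    ⁅x, Toroidal.cen F m v⁆ = Der.deg x.right m • Toroidal.cen F m v := by
  have h : ⁅x.left, CentralExt.cen F (torTwist n) (KDiff.of m v)⁆ = 0 := by
    rw [← lie_skew, CentralExt.cen_lie, neg_zero]
  simp [Toroidal.cen, h, torDer_cen]

lemma Toroidal.X_lie_X (r s : Fin n → ℤ) (X Y : 𝔤) :
    ⁅Toroidal.X F r X, Toroidal.X F s Y⁆ = Toroidal.X F (r + s) ⁅X, Y⁆ +
      F.form X Y • Toroidal.cen F (r + s) fun i => (r i : ℂ) := by
  have h : ⁅CentralExt.loop F (torTwist n) (Loop.of r X),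
      CentralExt.loop F (torTwist n) (Loop.of s Y)⁆ =
      CentralExt.loop F (torTwist n) (Loop.of (r + s) ⁅X, Y⁆) +
      F.form X Y • CentralExt.cen F (torTwist n) (KDiff.of (r + s) fun i => (r i : ℂ)) := by
    have e : (torTwist n).κ r s = KDiff.of (r + s) fun i => (r i : ℂ) := rfl
    ext <;> simp [e]
  simp [Toroidal.X, Toroidal.cen, h]

lemma Toroidal.d_lie_X (i : Fin n) (r : Fin n → ℤ) (X : 𝔤) :
    ⁅Toroidal.d F i, Toroidal.X F r X⁆ = (r i : ℂ) • Toroidal.X F r X := by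
  simp [Toroidal.X, Toroidal.d, torDer_loop, Der.deg_d]

variable [FiniteDimensional ℂ 𝔤] [LieAlgebra.IsSimple ℂ 𝔤]

/-- Only the degree matters: `H` is abelian, and the central term of a bracket with `h'(0)` contains
`d(t^0) = 0`. -/
lemma Toroidal.lie_X_of_mem_cartan {H : LieSubalgebra ℂ 𝔤} [H.IsCartanSubalgebra]
    {x : Toroidal F n} (hx : x ∈ Toroidal.cartan F H) (r : Fin n → ℤ) {h : 𝔤} (hh : h ∈ H) :
    ⁅x, Toroidal.X F r h⁆ = Der.deg x.right r • Toroidal.X F r h := by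
  induction hx using Submodule.span_induction with
  | mem x hx =>
    rcases hx with (⟨h', hh', rfl⟩ | ⟨i, rfl⟩) | ⟨i, rfl⟩
    · have e : ⁅h', h⁆ = 0 := congrArg Subtype.val (trivial_lie_zero H H ⟨h', hh'⟩ ⟨h, hh⟩)
      have e' : (fun i => (((0 : Fin n → ℤ) i : ℤ) : ℂ)) = 0 := by funext i; simp
      rw [Toroidal.X_lie_X, e, e', map_zero, smul_zero, add_zero]
      simp [Toroidal.X, Der.deg_apply]
    · have e : Toroidal.K F 0 i = Toroidal.cen F 0 (Pi.single i 1) := rfl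
      rw [e, ← lie_skew, Toroidal.lie_cen]
      simp [Toroidal.X, Toroidal.cen, Der.deg_apply]
    · rw [Toroidal.d_lie_X]
      simp [Toroidal.d, Der.deg_d]
  | zero => rw [zero_lie]; simp [Der.deg_apply]
  | add x y _ _ h₁ h₂ => rw [add_lie, h₁, h₂, ← add_smul]; simp
  | smul c x _ h => rw [smul_lie, h, smul_smul]; simp

end ToroidalOperators

section Shift

variable {K : Type*} [LieRing K] [LieAlgebra ℂ K] {n : ℕ} {ψ : Der n →ₗ⁅ℂ⁆ LieDerivation ℂ K K}
variable {V : Type*} [AddCommGroup V] [Module ℂ V] [LieRingModule (K ⋊⁅ψ⁆ Der n) V]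
  [LieModule ℂ (K ⋊⁅ψ⁆ Der n) V] (C : Submodule ℂ (K ⋊⁅ψ⁆ Der n))

/-- The weight of `t^m`. -/
def degWeight (m : Fin n → ℤ) : C →ₗ[ℂ] ℂ where
  toFun x := Der.deg x.1.right m
  map_add' x y := by simp
  map_smul' c x := by simp

variable {C}

lemma map_mem_wtSpace {T : Module.End ℂ V} {m : Fin n → ℤ}
    (hT : ∀ x ∈ C, ∀ v, ⁅x, T v⁆ = T ⁅x, v⁆ + Der.deg x.right m • T v)
    {χ : C →ₗ[ℂ] ℂ} {g : Fin n → ℤ} {v : V} (hv : v ∈ wtSpace C V (χ + degWeight C g)) :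
    T v ∈ wtSpace C V (χ + degWeight C (g + m)) := fun x => by
  rw [hT x x.2, hv x, map_smul, ← add_smul]
  congr 1
  simp [degWeight, add_assoc]

lemma mem_wtSpace_of_map_mem {T : Module.End ℂ V} {m : Fin n → ℤ} (hi : Function.Injective T)
    (hT : ∀ x ∈ C, ∀ v, ⁅x, T v⁆ = T ⁅x, v⁆ + Der.deg x.right m • T v)
    {χ : C →ₗ[ℂ] ℂ} {g : Fin n → ℤ} {v : V}
    (hv : T v ∈ wtSpace C V (χ + degWeight C (g + m))) :
    v ∈ wtSpace C V (χ + degWeight C g) := fun x => by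
  have := hv x
  rw [hT x x.2, ← eq_sub_iff_add_eq, ← sub_smul, ← map_smul] at this
  rw [hi this]
  congr 1
  simp [degWeight]
  ring

end Shift

section Heisenberg

variable {𝔤 : Type u} [LieRing 𝔤] [LieAlgebra ℂ 𝔤] (F : InvForm 𝔤) {n : ℕ}
variable (V : Type v) [AddCommGroup V] [Module ℂ V] [LieRingModule (Toroidal F n) V]
  [LieModule ℂ (Toroidal F n) V]

/-- The action of `∑ vᵢ t^m Kᵢ` as a function of `v`. -/
def cenOp (m : Fin n → ℤ) : (Fin n → ℂ) →ₗ[ℂ] Module.End ℂ V :=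
  (LieModule.toEnd ℂ (Toroidal F n) V : Toroidal F n →ₗ[ℂ] Module.End ℂ V) ∘ₗ Toroidal.cen F m

variable {V} in
lemma cenOp_apply (m : Fin n → ℤ) (c : Fin n → ℂ) (v : V) :
    cenOp F V m c v = ⁅Toroidal.cen F m c, v⁆ := rfl

lemma isQuasiCentral_cenOp (m : Fin n → ℤ) (c : Fin n → ℂ) :
    IsQuasiCentral (torDer F n) m (cenOp F V m c) := fun x v => by
  rw [cenOp_apply, leibniz_lie, Toroidal.lie_cen, smul_lie, add_comm]
  rfl

/-- The action of `d(t^r) t^{m-r} = ∑ rᵢ t^m Kᵢ`. -/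
def intCenOp (m : Fin n → ℤ) : (Fin n → ℤ) →+ Module.End ℂ V where
  toFun r := cenOp F V m fun i => (r i : ℂ)
  map_zero' := by
    rw [← map_zero (cenOp F V m)]
    congr 1; funext i; simp
  map_add' r s := by
    rw [← map_add]
    congr 1; funext i; simp

lemma intCenOp_apply (m r : Fin n → ℤ) : intCenOp F V m r = cenOp F V m fun i => (r i : ℂ) := rfl

lemma intCenOp_ne_zero {m : Fin n → ℤ} {i : Fin n} {v : V} (h : ⁅Toroidal.K F m i, v⁆ ≠ 0) :
    intCenOp F V m (Pi.single i 1) ≠ 0 := fun h0 => by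
  refine h ?_
  have e : (fun j => (((Pi.single i 1 : Fin n → ℤ) j : ℤ) : ℂ)) = Pi.single i 1 := by
    funext j
    by_cases hj : j = i
    · subst hj; simp
    · simp [hj]
  rw [intCenOp_apply, e] at h0
  exact congrArg (fun g => g v) h0

lemma cenOp_eq_zero {m : Fin n → ℤ} (h : ∀ r, intCenOp F V m r = 0) (c : Fin n → ℂ) :
    cenOp F V m c = 0 := by
  rw [← Finset.univ_sum_single c, map_sum]
  refine Finset.sum_eq_zero fun i _ => ?_
  have e : (Pi.single i (c i) : Fin n → ℂ) =
      c i • fun j => (((Pi.single i 1 : Fin n → ℤ) j : ℤ) : ℂ) := by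
    funext j
    by_cases hj : j = i
    · subst hj; simp
    · simp [hj]
  rw [e, map_smul, ← intCenOp_apply, h, smul_zero]

variable [FiniteDimensional ℂ 𝔤] [LieAlgebra.IsSimple ℂ 𝔤]

/-- The spaces are the weight spaces of `χ` shifted by the weight of `t^g`, and the operators are
the `h(r)` with `(h, h) = 1`, whose brackets consist of the central term alone. -/
lemma exists_gradedHeisenberg {H : LieSubalgebra ℂ 𝔤} [H.IsCartanSubalgebra]
    (hV : LieModule.IsIrreducible ℂ (Toroidal F n) V)
    (hf : HasFiniteWeights (Toroidal.cartan F H (n := n)) V) :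
    ∃ (U : (Fin n → ℤ) → Submodule ℂ V) (a : (Fin n → ℤ) → Module.End ℂ V),
      GradedHeisenberg U a (intCenOp F V) := by
  obtain ⟨h, hh, hF⟩ := F.exists_form_self_eq_one H
  have : Nontrivial V := LieModule.nontrivial_of_isIrreducible ℂ (Toroidal F n) V
  obtain ⟨χ, hχ⟩ := hf.exists_wtSpace_ne_bot
  have hq : ∀ m r, IsQuasiCentral (torDer F n) m (intCenOp F V m r) := fun m r =>
    isQuasiCentral_cenOp F V m _
  have hb : ∀ m r, intCenOp F V m r ≠ 0 → Function.Bijective (intCenOp F V m r) := fun m r hne =>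
    (hq m r).bijective hV hne
  have hcX : ∀ m r (y : TorCore F n), Commute (intCenOp F V m r)
      (LieModule.toEnd ℂ (Toroidal F n) V ⟨y, 0⟩) := fun m r y => LinearMap.ext fun v => by
    have := hq m r ⟨y, 0⟩ v
    have e : Der.deg (0 : Der n) m = 0 := by simp [Der.deg_apply]
    rw [e, zero_smul, add_zero] at this
    exact this.symm
  refine ⟨fun g => wtSpace _ V (χ + degWeight _ g),
    fun r => LieModule.toEnd ℂ (Toroidal F n) V (Toroidal.X F r h), ?_⟩
  constructor
  · exact fun g => hf.2 _
  · have : degWeight (Toroidal.cartan F H (n := n)) 0 = 0 := by ext; simp [degWeight]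
    rwa [this, add_zero]
  · intro r g v hv
    refine map_mem_wtSpace (fun x hx v => ?_) hv
    change ⁅x, ⁅Toroidal.X F r h, v⁆⁆ = ⁅Toroidal.X F r h, ⁅x, v⁆⁆ + _ • ⁅Toroidal.X F r h, v⁆
    rw [leibniz_lie, Toroidal.lie_X_of_mem_cartan F hx r hh, smul_lie, add_comm]
  · intro r s
    refine LinearMap.ext fun v => ?_
    change ⁅Toroidal.X F r h, ⁅Toroidal.X F s h, v⁆⁆ - ⁅Toroidal.X F s h, ⁅Toroidal.X F r h, v⁆⁆ =
      ⁅Toroidal.cen F (r + s) fun i => (r i : ℂ), v⁆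
    have : Toroidal.X F (r + s) (0 : 𝔤) = 0 := by simp [Toroidal.X]
    rw [← lie_lie, Toroidal.X_lie_X, lie_self, this, hF, one_smul, zero_add]
  · exact hb
  · intro m r hne g v
    exact ⟨fun hv => map_mem_wtSpace (fun x _ => hq m r x) hv,
      fun hv => mem_wtSpace_of_map_mem (hb m r hne).1 (fun x _ => hq m r x) hv⟩
  · exact fun m r s => hcX m r _
  · exact fun m r m' r' => hcX m r _

end Heisenberg

end ToroidalLie

end

/-! ### Descent of the twisted action along `φ` -/

noncomputable section

namespace ToroidalLie

universe u v

section Transport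

variable {L L' M V : Type*} [LieRing L] [LieAlgebra ℂ L] [LieRing L'] [LieAlgebra ℂ L']
  [LieRing M] [LieAlgebra ℂ M] [AddCommGroup V] [Module ℂ V] [LieRingModule M V] [LieModule ℂ M V]

/-- An action pulled back along `g : L → M` that factors through a split surjection `f : L → L'`
descends to `L'`. -/
lemma exists_lieModule_of_section (f : L →ₗ⁅ℂ⁆ L') (g : L →ₗ⁅ℂ⁆ M) (s : L' →ₗ[ℂ] L)
    (hs : ∀ y, f (s y) = y) (hg : ∀ x (v : V), ⁅g (s (f x)), v⁆ = ⁅g x, v⁆) :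
    ∃ (_ : LieRingModule L' V) (_ : LieModule ℂ L' V), ∀ x (v : V), ⁅g x, v⁆ = ⁅f x, v⁆ := by
  let i₁ : LieRingModule L' V :=
    { bracket := fun y v => ⁅g (s y), v⁆
      add_lie := fun x y v => by
        rw [map_add, map_add, add_lie]
      lie_add := fun x v w => lie_add (g (s x)) v w
      leibniz_lie := fun x y v => by
        change ⁅g (s x), ⁅g (s y), v⁆⁆ = ⁅g (s ⁅x, y⁆), v⁆ + ⁅g (s y), ⁅g (s x), v⁆⁆
        -- The section `s` need not respect brackets; the error lies in the kernel of `f`, which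
        -- acts by zero according to `hg`.
        have e : ⁅x, y⁆ = f ⁅s x, s y⁆ := by rw [LieHom.map_lie, hs, hs]
        rw [e, hg, LieHom.map_lie, leibniz_lie] }
  refine ⟨i₁, ⟨fun c x v => ?_, fun c x v => lie_smul c (g (s x)) v⟩, fun x v => (hg x v).symm⟩
  change ⁅g (s (c • x)), v⁆ = c • ⁅g (s x), v⁆
  rw [map_smul, map_smul, smul_lie]

/-- Each weight space for one Cartan subspace lies in a weight space for the other, with the weight
pulled back along `s` or `t`. The two maps need not be inverse to each other. -/
lemma HasFiniteWeights.transfer [LieRingModule L V] [LieModule ℂ L V] {C : Submodule ℂ L}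
    {C' : Submodule ℂ M} (hf : HasFiniteWeights C' V) (s : L →ₗ[ℂ] M) (t : M →ₗ[ℂ] L)
    (hsC : ∀ x ∈ C, s x ∈ C') (htC : ∀ y ∈ C', t y ∈ C) (hs : ∀ x (v : V), ⁅s x, v⁆ = ⁅x, v⁆)
    (ht : ∀ y (v : V), ⁅t y, v⁆ = ⁅y, v⁆) : HasFiniteWeights C V := by
  constructor
  · rw [eq_top_iff, ← hf.1]
    refine iSup_le fun χ => le_iSup_of_le (χ ∘ₗ s.restrict hsC) fun v hv x => ?_
    rw [← hs]
    exact hv ⟨s x, hsC x x.2⟩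
  · intro χ
    have := hf.2 (χ ∘ₗ t.restrict htC)
    refine Submodule.finiteDimensional_of_le
      (S₂ := wtSpace C' V (χ ∘ₗ t.restrict htC)) fun v hv y => ?_
    rw [← ht]
    exact hv ⟨t y, htC y y.2⟩

end Transport

section Section

variable {𝔤 : Type u} [LieRing 𝔤] [LieAlgebra ℂ 𝔤] (F : InvForm 𝔤) (N : ℕ)

/-- The linear section of `φ` on `J`. -/
def secJ : LoopAffine F N →ₗ[ℂ] TorCore F (N + 1) :=
  Loop.lift fun m =>
    (Loop.lift fun k => CentralExt.loop F (torTwist (N + 1)) ∘ₗ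
      Loop.of (Fin.snoc (α := fun _ => ℤ) m k)) ∘ₗ CentralExt.fst F affTwist +
    (CentralExt.cen F (torTwist (N + 1)) ∘ₗ KDiff.of (extZero m) ∘ₗ
      LinearMap.single ℂ (fun _ => ℂ) (Fin.last N)) ∘ₗ CentralExt.snd F affTwist

lemma secJ_loop (m : Fin N → ℤ) (k : ℤ) (X : 𝔤) :
    secJ F N (Loop.of m (CentralExt.loop F affTwist (Loop.of k X))) =
      CentralExt.loop F _ (Loop.of (Fin.snoc (α := fun _ => ℤ) m k) X) := by
  simp [secJ]

lemma secJ_cen (m : Fin N → ℤ) (c : ℂ) :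
    secJ F N (Loop.of m (CentralExt.cen F affTwist c)) =
      CentralExt.cen F _ (KDiff.of (extZero m) (Pi.single (Fin.last N) c)) := by
  simp [secJ]

variable {F N} in
lemma loopAffine_ext {M : Type*} [AddCommGroup M] [Module ℂ M] {f g : LoopAffine F N →ₗ[ℂ] M}
    (h₁ : ∀ m k X, f (Loop.of m (CentralExt.loop F affTwist (Loop.of k X))) =
      g (Loop.of m (CentralExt.loop F affTwist (Loop.of k X))))
    (h₂ : ∀ m c, f (Loop.of m (CentralExt.cen F affTwist c)) =
      g (Loop.of m (CentralExt.cen F affTwist c))) : f = g := by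
  refine Loop.hom_ext fun m => LinearMap.ext fun x => ?_
  have hx : x = CentralExt.loop F _ (CentralExt.fst F _ x) +
      CentralExt.cen F _ (CentralExt.snd F _ x) := by ext <;> simp
  have e : f ∘ₗ Loop.of m ∘ₗ CentralExt.loop F affTwist =
      g ∘ₗ Loop.of m ∘ₗ CentralExt.loop F affTwist :=
    Loop.hom_ext fun k => LinearMap.ext fun X => h₁ m k X
  rw [hx, map_add, map_add]
  exact congrArg₂ (· + ·) (congrArg (fun g => g (CentralExt.fst F _ x)) e) (h₂ m _)

lemma phiCore_secJ (y : LoopAffine F N) : phiCore F N (secJ F N y) = y := by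
  have : (phiCore F N : TorCore F (N + 1) →ₗ[ℂ] LoopAffine F N) ∘ₗ secJ F N = LinearMap.id := by
    refine loopAffine_ext (fun m k X => ?_) (fun m c => ?_)
    · change phiCore F N (secJ F N _) = _
      rw [secJ_loop, phiCore_loop, phiLoop_of]
      simp
    · change phiCore F N (secJ F N _) = _
      rw [secJ_cen, phiCore_cen, phiCen_of, if_pos (extZero_last m)]
      simp
  exact congrArg (fun g => g y) this

lemma secJ_phiCore_loop (r : Fin (N + 1) → ℤ) (X : 𝔤) :
    secJ F N (phiCore F N (CentralExt.loop F _ (Loop.of r X))) =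
      CentralExt.loop F _ (Loop.of r X) := by
  rw [phiCore_loop, phiLoop_of, secJ_loop]
  have e : Fin.snoc (α := fun _ => ℤ) (fun i : Fin N => r i.castSucc) (r (Fin.last N)) = r :=
    Fin.snoc_init_self r
  rw [e]

/-- The linear section of `φ`. -/
def sec : JD F N →ₗ[ℂ] Toroidal F (N + 1) where
  toFun y := ⟨secJ F N y.left, y.right⟩
  map_add' x y := by simp
  map_smul' c x := by simp

lemma phi_sec (y : JD F N) : phi F N (sec F N y) = y := by
  change (⟨phiCore F N (secJ F N y.left), y.right⟩ : JD F N) = y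
  rw [phiCore_secJ]

variable {F N}

lemma extZero_init {m : Fin (N + 1) → ℤ} (h : m (Fin.last N) = 0) :
    extZero (fun i : Fin N => m i.castSucc) = m := by
  funext j
  refine Fin.lastCases ?_ (fun j => ?_) j
  · rw [extZero_last, h]
  · rw [extZero_castSucc]

variable {V : Type v} [AddCommGroup V] [Module ℂ V] [LieRingModule (Toroidal F (N + 1)) V]
  [LieModule ℂ (Toroidal F (N + 1)) V] {B : Matrix.GeneralLinearGroup (Fin (N + 1)) ℤ}

variable (F) in
-- In the basis given by the columns of `B`, the first `N` directions act by zero; this matches `φ`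
-- killing `t^m Kᵢ` for `i < n`.
lemma cenOp_mulVec_castSucc
    (h : ∀ (i : Fin N) m, intCenOp F V m (B.1.mulVec (Pi.single i.castSucc 1)) = 0)
    (m : Fin (N + 1) → ℤ) (c : Fin (N + 1) → ℂ) :
    cenOp F V m ((B.1.map (Int.cast : ℤ → ℂ)).mulVec c) =
      cenOp F V m ((B.1.map (Int.cast : ℤ → ℂ)).mulVec
        (Pi.single (Fin.last N) (c (Fin.last N)))) := by
  have e : ∀ i : Fin N, cenOp F V m ((B.1.map (Int.cast : ℤ → ℂ)).mulVec
      (Pi.single i.castSucc (c i.castSucc))) = 0 := fun i => by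
    have e₁ : (Pi.single i.castSucc (c i.castSucc) : Fin (N + 1) → ℂ) =
        c i.castSucc • fun j => (((Pi.single i.castSucc 1 : Fin (N + 1) → ℤ) j : ℤ) : ℂ) := by
      funext j
      by_cases hj : j = i.castSucc
      · subst hj; simp
      · simp [hj]
    rw [e₁, Matrix.mulVec_smul, castVec_mulVec, map_smul, ← intCenOp_apply, h, smul_zero]
  conv_lhs => rw [← Finset.univ_sum_single c, Fin.sum_univ_castSucc]
  rw [Matrix.mulVec_add, map_add, Matrix.mulVec_sum, map_sum, Finset.sum_eq_zero fun i _ => e i,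
    zero_add]

variable (F) in
lemma gl_cen_lie (m : Fin (N + 1) → ℤ) (c : Fin (N + 1) → ℂ) (v : V) :
    ⁅(⟨glCore F B (CentralExt.cen F _ (KDiff.of m c)), 0⟩ : Toroidal F (N + 1)), v⁆ =
      cenOp F V (B.1.mulVec m) ((B.1.map (Int.cast : ℤ → ℂ)).mulVec c) v := by
  rw [glCore_cen, glCen_of]
  rfl

variable (F B) in
/-- The action of `𝔤 ⊗ A ⊕ Z` on a vector, twisted by `B`. -/
def coreAct (v : V) : TorCore F (N + 1) →ₗ[ℂ] V where
  toFun y := ⁅(⟨glCore F B y, 0⟩ : Toroidal F (N + 1)), v⁆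
  map_add' x y := by
    rw [← add_lie, map_add, LieAlgebra.SemiDirectSum.add_eq_mk, add_zero]
  map_smul' c x := by
    rw [RingHom.id_apply, ← smul_lie, map_smul, LieAlgebra.SemiDirectSum.smul_eq_mk, smul_zero]

/-- The composite of `φ` and its section changes only `Z`. It drops the `t^m Kᵢ` with `m_n ≠ 0`,
which act by zero by `h₁`, and those with `i < n`, which act by zero by `h₂`. -/
lemma coreAct_secJ_phiCore
    (h₁ : ∀ m r, intCenOp F V (B.1.mulVec m) r ≠ 0 → m (Fin.last N) = 0)
    (h₂ : ∀ (i : Fin N) m, intCenOp F V m (B.1.mulVec (Pi.single i.castSucc 1)) = 0)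
    (y : TorCore F (N + 1)) (v : V) :
    coreAct F B v (secJ F N (phiCore F N y)) = coreAct F B v y := by
  refine torCore_ext F (f := coreAct F B v ∘ₗ secJ F N ∘ₗ (phiCore F N).toLinearMap)
    (g := coreAct F B v) (fun r X => ?_) (fun m c => ?_) y
  · simp only [LinearMap.comp_apply, LieHom.coe_toLinearMap, secJ_phiCore_loop]
  · simp only [LinearMap.comp_apply, LieHom.coe_toLinearMap, phiCore_cen, phiCen_of]
    have e : coreAct F B v (CentralExt.cen F _ (KDiff.of m c)) =
      cenOp F V (B.1.mulVec m) ((B.1.map (Int.cast : ℤ → ℂ)).mulVec c) v := gl_cen_lie F m c v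
    rw [e]
    split_ifs with hm
    · rw [secJ_cen, extZero_init hm, cenOp_mulVec_castSucc F h₂]
      exact gl_cen_lie F m _ v
    · rw [map_zero, map_zero, cenOp_eq_zero F V fun r => by_contra fun h => hm (h₁ m r h),
        LinearMap.zero_apply]

lemma gl_lie (x : Toroidal F (N + 1)) (v : V) :
    ⁅gl F B x, v⁆ = coreAct F B v x.left + ⁅(⟨0, glDer B x.right⟩ : Toroidal F (N + 1)), v⁆ := by
  have : gl F B x = ⟨glCore F B x.left, 0⟩ + ⟨0, glDer B x.right⟩ := by
    rw [LieAlgebra.SemiDirectSum.add_eq_mk, add_zero, zero_add]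
    rfl
  rw [this, add_lie]
  rfl

lemma gl_sec_phi_lie (h₁ : ∀ m r, intCenOp F V (B.1.mulVec m) r ≠ 0 → m (Fin.last N) = 0)
    (h₂ : ∀ (i : Fin N) m, intCenOp F V m (B.1.mulVec (Pi.single i.castSucc 1)) = 0)
    (x : Toroidal F (N + 1)) (v : V) : ⁅gl F B (sec F N (phi F N x)), v⁆ = ⁅gl F B x, v⁆ := by
  rw [gl_lie, gl_lie]
  exact congrArg (· + _) (coreAct_secJ_phiCore h₁ h₂ x.left v)

end Section

end ToroidalLie

end

/-! ### The descended module is standard -/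

noncomputable section

namespace ToroidalLie

universe u v

section Inverse

variable {𝔤 : Type u} [LieRing 𝔤] [LieAlgebra ℂ 𝔤] (F : InvForm 𝔤)
variable {n : ℕ} (B : Matrix.GeneralLinearGroup (Fin n) ℤ)

lemma mulVec_inv_mulVec (m : Fin n → ℤ) : B.1.mulVec (B⁻¹.1.mulVec m) = m := by
  rw [Matrix.mulVec_mulVec, B.mul_inv, Matrix.one_mulVec]

lemma inv_mulVec_mulVec (m : Fin n → ℤ) : B⁻¹.1.mulVec (B.1.mulVec m) = m := by
  rw [Matrix.mulVec_mulVec, B.inv_mul, Matrix.one_mulVec]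

lemma map_mul_map_inv :
    B.1.map (Int.cast : ℤ → ℂ) * B⁻¹.1.map (Int.cast : ℤ → ℂ) = 1 := by
  have h := congrArg (fun M : Matrix (Fin n) (Fin n) ℤ => M.map (Int.castRingHom ℂ)) B.mul_inv
  simp only [Matrix.map_mul] at h
  exact h.trans (Matrix.map_one _ (map_zero _) (map_one _))

lemma glCore_glCore_inv (x : TorCore F n) : glCore F B (glCore F B⁻¹ x) = x := by
  refine torCore_ext F (f := (glCore F B).toLinearMap ∘ₗ (glCore F B⁻¹).toLinearMap)
    (g := LinearMap.id) (fun r X => ?_) (fun m v => ?_) x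
  · simp only [LinearMap.comp_apply, LieHom.coe_toLinearMap, glCore_loop, glLoop_of,
      mulVec_inv_mulVec, LinearMap.id_apply]
  · simp only [LinearMap.comp_apply, LieHom.coe_toLinearMap, glCore_cen, glCen_of,
      mulVec_inv_mulVec, LinearMap.id_apply]
    rw [Matrix.mulVec_mulVec, map_mul_map_inv, Matrix.one_mulVec]

lemma glDer_glDer_inv (a : Der n) : glDer B (glDer B⁻¹ a) = a := by
  have h : ∀ w : Fin n → ℂ, Matrix.vecMul (Matrix.vecMul w (B⁻¹⁻¹.1.map (Int.cast : ℤ → ℂ)))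
      (B⁻¹.1.map (Int.cast : ℤ → ℂ)) = w := fun w => by
    rw [inv_inv, Matrix.vecMul_vecMul, map_mul_map_inv, Matrix.vecMul_one]
  exact h a

lemma gl_gl_inv (x : Toroidal F n) : gl F B (gl F B⁻¹ x) = x := by
  change (⟨glCore F B (glCore F B⁻¹ x.left), glDer B (glDer B⁻¹ x.right)⟩ : Toroidal F n) = x
  rw [glCore_glCore_inv, glDer_glDer_inv]

lemma gl_X (r : Fin n → ℤ) (X : 𝔤) : gl F B (Toroidal.X F r X) = Toroidal.X F (B.1.mulVec r) X := by
  change (⟨glCore F B (CentralExt.loop F _ (Loop.of r X)), glDer B 0⟩ : Toroidal F n) = _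
  rw [glCore_loop, glLoop_of, map_zero]
  rfl

lemma gl_cen (m : Fin n → ℤ) (c : Fin n → ℂ) : gl F B (Toroidal.cen F m c) =
    Toroidal.cen F (B.1.mulVec m) ((B.1.map (Int.cast : ℤ → ℂ)).mulVec c) := by
  change (⟨glCore F B (CentralExt.cen F _ (KDiff.of m c)), glDer B 0⟩ : Toroidal F n) = _
  rw [glCore_cen, glCen_of, map_zero]
  rfl

lemma gl_der (a : Der n) : gl F B ⟨0, a⟩ = ⟨0, glDer B a⟩ := by
  change (⟨glCore F B 0, glDer B a⟩ : Toroidal F n) = _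
  rw [map_zero]

variable {F} {H : LieSubalgebra ℂ 𝔤}

lemma Toroidal.cen_mem_cartan (c : Fin n → ℂ) : Toroidal.cen F 0 c ∈ Toroidal.cartan F H := by
  rw [← Finset.univ_sum_single c, map_sum]
  refine sum_mem fun i _ => ?_
  have e : (Pi.single i (c i) : Fin n → ℂ) = c i • Pi.single i 1 := by
    rw [← Pi.single_smul, smul_eq_mul, mul_one]
  rw [e, map_smul]
  exact Submodule.smul_mem _ _ (Submodule.subset_span (Or.inl (Or.inr ⟨i, rfl⟩)))

lemma Toroidal.der_mem_cartan (a : Der n) : (⟨0, a⟩ : Toroidal F n) ∈ Toroidal.cartan F H := by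
  rw [semiDirect_eq_add (⟨0, a⟩ : Toroidal F n)]
  exact add_mem (zero_mem _) (sum_mem fun i _ =>
    Submodule.smul_mem _ _ (Submodule.subset_span (Or.inr ⟨i, rfl⟩)))

lemma Toroidal.X_mem_cartan {h : 𝔤} (hh : h ∈ H) :
    (Toroidal.X F (0 : Fin n → ℤ) h) ∈ Toroidal.cartan F H :=
  Submodule.subset_span (Or.inl (Or.inl ⟨h, hh, rfl⟩))

lemma gl_mem_cartan {x : Toroidal F n} (hx : x ∈ Toroidal.cartan F H) :
    gl F B x ∈ Toroidal.cartan F H := by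
  have h : Toroidal.cartan F H ≤ (Toroidal.cartan F H).comap (gl F B).toLinearMap := by
    refine Submodule.span_le.mpr ?_
    rintro _ ((⟨h, hh, rfl⟩ | ⟨i, rfl⟩) | ⟨i, rfl⟩)
    · change gl F B _ ∈ Toroidal.cartan F H
      rw [gl_X, Matrix.mulVec_zero]
      exact Toroidal.X_mem_cartan hh
    · change gl F B (Toroidal.cen F 0 _) ∈ Toroidal.cartan F H
      rw [gl_cen, Matrix.mulVec_zero]
      exact Toroidal.cen_mem_cartan _
    · change gl F B ⟨0, _⟩ ∈ Toroidal.cartan F H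
      rw [gl_der]
      exact Toroidal.der_mem_cartan _
  exact h hx

end Inverse

section CartanMaps

variable {𝔤 : Type u} [LieRing 𝔤] [LieAlgebra ℂ 𝔤] {F : InvForm 𝔤} {N : ℕ}
  {H : LieSubalgebra ℂ 𝔤}

variable (F) in
lemma phi_cen {m : Fin (N + 1) → ℤ} (hm : m (Fin.last N) = 0) (c : Fin (N + 1) → ℂ) :
    phi F N (Toroidal.cen F m c) = c (Fin.last N) • JD.K F fun i => m i.castSucc := by
  change (⟨phiCore F N (CentralExt.cen F _ (KDiff.of m c)), 0⟩ : JD F N) = _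
  rw [phiCore_cen, phiCen_of, if_pos hm, JD.K, LieAlgebra.SemiDirectSum.smul_eq_mk, smul_zero,
    ← map_smul, ← map_smul, smul_eq_mul, mul_one]

lemma phi_mem_cartan {x : Toroidal F (N + 1)} (hx : x ∈ Toroidal.cartan F H) :
    phi F N x ∈ JD.cartan F H := by
  have h : Toroidal.cartan F H ≤ (JD.cartan F H).comap (phi F N).toLinearMap := by
    refine Submodule.span_le.mpr ?_
    rintro _ ((⟨h, hh, rfl⟩ | ⟨i, rfl⟩) | ⟨i, rfl⟩)
    · change (⟨phiCore F N (CentralExt.loop F _ (Loop.of 0 h)), 0⟩ : JD F N) ∈ JD.cartan F H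
      rw [phiCore_loop, phiLoop_of]
      exact Submodule.subset_span (Or.inl (Or.inl ⟨h, hh, rfl⟩))
    · change phi F N (Toroidal.cen F 0 _) ∈ JD.cartan F H
      rw [phi_cen F rfl]
      exact Submodule.smul_mem _ _ (Submodule.subset_span (Or.inl (Or.inr rfl)))
    · change (⟨phiCore F N 0, Der.d i⟩ : JD F N) ∈ JD.cartan F H
      rw [map_zero]
      exact Submodule.subset_span (Or.inr ⟨i, rfl⟩)
  exact h hx

lemma sec_mem_cartan {y : JD F N} (hy : y ∈ JD.cartan F H) :
    sec F N y ∈ Toroidal.cartan F H := by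
  have h : JD.cartan F H ≤ (Toroidal.cartan F H).comap (sec F N) := by
    refine Submodule.span_le.mpr ?_
    rintro _ ((⟨h, hh, rfl⟩ | rfl) | ⟨i, rfl⟩)
    · change (⟨secJ F N (Loop.of 0 (CentralExt.loop F affTwist (Loop.of 0 h))), 0⟩ : Toroidal F (N + 1)) ∈
        Toroidal.cartan F H
      rw [secJ_loop]
      have e : Fin.snoc (α := fun _ => ℤ) (0 : Fin N → ℤ) 0 = 0 := map_zero extZero
      rw [e]
      exact Toroidal.X_mem_cartan hh
    · change (⟨secJ F N (Loop.of 0 (CentralExt.cen F affTwist 1)), 0⟩ : Toroidal F (N + 1)) ∈ Toroidal.cartan F H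
      rw [secJ_cen, map_zero]
      exact Toroidal.cen_mem_cartan _
    · change (⟨secJ F N 0, Der.d i⟩ : Toroidal F (N + 1)) ∈ Toroidal.cartan F H
      rw [map_zero]
      exact Toroidal.der_mem_cartan _
  exact h hy

end CartanMaps

section Standard

variable {𝔤 : Type u} [LieRing 𝔤] [LieAlgebra ℂ 𝔤] {F : InvForm 𝔤} {N : ℕ}
variable {V : Type v} [AddCommGroup V] [Module ℂ V] [LieRingModule (Toroidal F (N + 1)) V]
  [LieModule ℂ (Toroidal F (N + 1)) V] [LieRingModule (JD F N) V] [LieModule ℂ (JD F N) V]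
  {B : Matrix.GeneralLinearGroup (Fin (N + 1)) ℤ}

lemma gl_sec_lie (h : ∀ (x : Toroidal F (N + 1)) (v : V), ⁅gl F B x, v⁆ = ⁅phi F N x, v⁆)
    (y : JD F N) (v : V) : ⁅gl F B (sec F N y), v⁆ = ⁅y, v⁆ := by
  rw [h, phi_sec]

lemma phi_gl_inv_lie (h : ∀ (x : Toroidal F (N + 1)) (v : V), ⁅gl F B x, v⁆ = ⁅phi F N x, v⁆)
    (x : Toroidal F (N + 1)) (v : V) : ⁅phi F N (gl F B⁻¹ x), v⁆ = ⁅x, v⁆ := by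
  rw [← h, gl_gl_inv]

lemma isIrreducible_of_gl (hV : LieModule.IsIrreducible ℂ (Toroidal F (N + 1)) V)
    (h : ∀ (x : Toroidal F (N + 1)) (v : V), ⁅gl F B x, v⁆ = ⁅phi F N x, v⁆) :
    LieModule.IsIrreducible ℂ (JD F N) V := by
  have : Nontrivial V := LieModule.nontrivial_of_isIrreducible ℂ (Toroidal F (N + 1)) V
  refine LieModule.IsIrreducible.mk fun S hS => ?_
  obtain ⟨v, hv, hv0⟩ := Submodule.exists_mem_ne_zero_of_ne_bot
    (mt (LieSubmodule.toSubmodule_eq_bot S).mp hS)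
  rw [← LieSubmodule.toSubmodule_eq_top]
  refine eq_top_of_lie_mem hV S.toSubmodule (fun x w hw => ?_) hv hv0
  rw [← phi_gl_inv_lie h]
  exact S.lie_mem hw

lemma hasFiniteWeights_of_gl {H : LieSubalgebra ℂ 𝔤}
    (hf : HasFiniteWeights (Toroidal.cartan F H (n := N + 1)) V)
    (h : ∀ (x : Toroidal F (N + 1)) (v : V), ⁅gl F B x, v⁆ = ⁅phi F N x, v⁆) :
    HasFiniteWeights (JD.cartan F H (N := N)) V :=
  hf.transfer ((gl F B).toLinearMap ∘ₗ sec F N)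
    ((phi F N).toLinearMap ∘ₗ (gl F B⁻¹).toLinearMap)
    (fun _ hx => gl_mem_cartan B (sec_mem_cartan hx))
    (fun _ hy => phi_mem_cartan (gl_mem_cartan B⁻¹ hy))
    (gl_sec_lie h) (phi_gl_inv_lie h)

variable (F N V) in
/-- The vectors `l` such that there is an invertible central operator of degree `B⁻¹ l`. -/
def centralDegrees (B : Matrix.GeneralLinearGroup (Fin (N + 1)) ℤ) :
    AddSubgroup (Fin (N + 1) → ℤ) where
  carrier := {l | ∃ z : (Module.End ℂ V)ˣ, IsCentralOp F N z.val ∧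
    IsQuasiCentral (jDer F N) (B⁻¹.1.mulVec l) z.val}
  zero_mem' := ⟨1, by
    have := IsCentralOp.scalar (F := F) (N := N) (V := V) 1
    rwa [map_one] at this, by
    rw [Matrix.mulVec_zero]
    exact IsQuasiCentral.one⟩
  add_mem' := by
    rintro l l' ⟨z, hz, hz'⟩ ⟨w, hw, hw'⟩
    refine ⟨z * w, hz.mul hw, ?_⟩
    rw [Matrix.mulVec_add]
    exact hz'.mul hw'
  neg_mem' := by
    rintro l ⟨z, hz, hz'⟩
    refine ⟨z⁻¹, hz.inv z.mul_inv z.inv_mul, ?_⟩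
    rw [Matrix.mulVec_neg]
    exact hz'.inv z.mul_inv z.inv_mul

/-- With `l = B m`, the given operator is a multiple of the action of `K_n ⊗ t^m` on the descended
module, so the latter is non-zero and hence invertible, of degree `m = B⁻¹ l`. -/
lemma mem_centralDegrees (hV : LieModule.IsIrreducible ℂ (JD F N) V)
    (h : ∀ (x : Toroidal F (N + 1)) (v : V), ⁅gl F B x, v⁆ = ⁅phi F N x, v⁆)
    (h₁ : ∀ m r, intCenOp F V (B.1.mulVec m) r ≠ 0 → m (Fin.last N) = 0)
    {l r : Fin (N + 1) → ℤ} (hl : intCenOp F V l r ≠ 0) : l ∈ centralDegrees F N V B := by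
  obtain ⟨m, rfl⟩ : ∃ m, l = B.1.mulVec m := ⟨_, (mulVec_inv_mulVec B l).symm⟩
  obtain ⟨s, rfl⟩ : ∃ s, r = B.1.mulVec s := ⟨_, (mulVec_inv_mulVec B r).symm⟩
  have hm := h₁ m _ hl
  have hK : LieModule.toEnd ℂ (JD F N) V (JD.K F fun i => m i.castSucc) ≠ 0 := fun h0 => by
    refine hl (LinearMap.ext fun v => ?_)
    have e : ⁅(JD.K F fun i => m i.castSucc : JD F N), v⁆ = 0 := congrArg (fun g => g v) h0
    rw [intCenOp_apply, ← castVec_mulVec, cenOp_apply, ← gl_cen, h, phi_cen F hm, smul_lie, e,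
      smul_zero, LinearMap.zero_apply]
  have hq := isQuasiCentral_K (F := F) (V := V) fun i => m i.castSucc
  obtain ⟨z, hz⟩ := (Module.End.isUnit_iff _).mpr (hq.bijective hV hK)
  refine ⟨z, ?_, ?_⟩
  · rw [hz]
    exact IsCentralOp.central _
  · rw [hz, inv_mulVec_mulVec]
    rwa [extZero_init hm] at hq

/-- Products and inverses of the `K_n ⊗ t^m` realise every element of the group generated by their
degrees; by `h₃` this group contains, after applying `B⁻¹`, a positive multiple of each of the first
`N` unit vectors. -/
lemma exists_centralOps (hV : LieModule.IsIrreducible ℂ (JD F N) V)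
    (h : ∀ (x : Toroidal F (N + 1)) (v : V), ⁅gl F B x, v⁆ = ⁅phi F N x, v⁆)
    (h₁ : ∀ m r, intCenOp F V (B.1.mulVec m) r ≠ 0 → m (Fin.last N) = 0)
    (h₃ : ∀ i : Fin N, ∃ k : ℕ, 0 < k ∧
      k • B.1.mulVec (Pi.single i.castSucc 1) ∈ GradedHeisenberg.degrees (intCenOp F V)) :
    ∃ (k : Fin N → ℤ) (z : Fin N → Module.End ℂ V), ∀ i,
      k i ≠ 0 ∧ IsCentralOp F N (z i) ∧ z i ≠ 0 ∧
        HasDegree F N (z i) (Pi.single i.castSucc (k i)) := by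
  have : Nontrivial V := LieModule.nontrivial_of_isIrreducible ℂ (JD F N) V
  have hle : GradedHeisenberg.degrees (intCenOp F V) ≤ centralDegrees F N V B := by
    refine (AddSubgroup.closure_le _).mpr ?_
    rintro l ⟨r, hl⟩
    exact mem_centralDegrees hV h h₁ hl
  choose k hk hkB using h₃
  choose z hz hz' using fun i => hle (hkB i)
  refine ⟨fun i => (k i : ℤ), fun i => (z i).val, fun i => ⟨Int.natCast_ne_zero.mpr (hk i).ne', hz i,
    (z i).ne_zero, fun j v => ?_⟩⟩
  have hq := hz' i (JD.d F j) v
  have e : B⁻¹.1.mulVec (k i • B.1.mulVec (Pi.single i.castSucc 1)) =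
      Pi.single i.castSucc (k i : ℤ) := by
    rw [Matrix.mulVec_smul, inv_mulVec_mulVec, ← Pi.single_smul, nsmul_eq_mul, mul_one]
  have e' : Der.deg (JD.d F j : JD F N).right (Pi.single i.castSucc (k i : ℤ)) =
    ((Pi.single i.castSucc (k i : ℤ) : Fin (N + 1) → ℤ) j : ℂ) := Der.deg_d j _
  rw [e, e'] at hq
  exact hq

end Standard

section Reduction

variable {𝔤 : Type u} [LieRing 𝔤] [LieAlgebra ℂ 𝔤] [FiniteDimensional ℂ 𝔤]
  [LieAlgebra.IsSimple ℂ 𝔤] (F : InvForm 𝔤) (H : LieSubalgebra ℂ 𝔤) [H.IsCartanSubalgebra] {N : ℕ}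

/-- Up to an automorphism, an irreducible module of `τ` with non-trivial action of the centre comes
from a standard module. -/
lemma exists_isStandard (V : Type v) [AddCommGroup V] [Module ℂ V]
    [LieRingModule (Toroidal F (N + 1)) V] [LieModule ℂ (Toroidal F (N + 1)) V]
    (hV : LieModule.IsIrreducible ℂ (Toroidal F (N + 1)) V)
    (hf : HasFiniteWeights (Toroidal.cartan F H (n := N + 1)) V)
    (hK : ∃ (m : Fin (N + 1) → ℤ) (i : Fin (N + 1)) (v : V), ⁅Toroidal.K F m i, v⁆ ≠ 0) :
    ∃ (B : Matrix.GeneralLinearGroup (Fin (N + 1)) ℤ)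
      (_ : LieRingModule (JD F N) V) (_ : LieModule ℂ (JD F N) V),
      (∀ (x : Toroidal F (N + 1)) (v : V), ⁅gl F B x, v⁆ = ⁅phi F N x, v⁆) ∧
      IsStandard F N H V := by
  obtain ⟨m, i, v, hv⟩ := hK
  obtain ⟨U, a, hU⟩ := exists_gradedHeisenberg F V hV hf
  obtain ⟨B, h₁, h₂, h₃⟩ := hU.exists_gl (intCenOp_ne_zero F V hv)
  obtain ⟨i₁, i₂, h⟩ := exists_lieModule_of_section (V := V) (phi F N) (gl F B) (sec F N)
    (phi_sec F N) (gl_sec_phi_lie h₁ h₂)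
  have hirr := isIrreducible_of_gl hV h
  exact ⟨B, i₁, i₂, h, hirr, hasFiniteWeights_of_gl hf h, exists_centralOps hirr h h₁ h₃⟩

end Reduction

end ToroidalLie

end

theorem mainTheorem8
    {𝔤 : Type*} [LieRing 𝔤] [LieAlgebra ℂ 𝔤] [FiniteDimensional ℂ 𝔤] [LieAlgebra.IsSimple ℂ 𝔤]
    (F : InvForm 𝔤) (H : LieSubalgebra ℂ 𝔤) [H.IsCartanSubalgebra] (N : ℕ) (hN : 1 ≤ N) :
    (∀ (V : Type*) [AddCommGroup V] [Module ℂ V] [LieRingModule (JD F N) V]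
        [LieModule ℂ (JD F N) V], IsStandard F N H V →
      (∃ W : LieSubmodule ℂ (JD.sub F N) V, IsGoodMaximal F N H W) ∧
      ∀ W : LieSubmodule ℂ (JD.sub F N) V, IsGoodMaximal F N H W →
        (∀ m : Fin N → ℤ, ∃ c : ℂ, (∀ v : V ⧸ W, ⁅JD.subK F m, v⁆ = c • v) ∧
          ((∃ v : V, ⁅JD.K F m, v⁆ ≠ 0) → c ≠ 0)) ∧
        ∃ α : Fin N → ℂ, IsComponent (JD F N) V (LoopModule F α (V ⧸ W))) ∧
    (∀ (V : Type*) [AddCommGroup V] [Module ℂ V] [LieRingModule (Toroidal F (N + 1)) V]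
        [LieModule ℂ (Toroidal F (N + 1)) V],
      LieModule.IsIrreducible ℂ (Toroidal F (N + 1)) V →
      HasFiniteWeights (Toroidal.cartan F H (n := N + 1)) V →
      (∃ (m : Fin (N + 1) → ℤ) (i : Fin (N + 1)) (v : V), ⁅Toroidal.K F m i, v⁆ ≠ 0) →
      ∃ (B : Matrix.GeneralLinearGroup (Fin (N + 1)) ℤ)
        (_ : LieRingModule (JD F N) V) (_ : LieModule ℂ (JD F N) V),
        (∀ (x : Toroidal F (N + 1)) (v : V), ⁅gl F B x, v⁆ = ⁅phi F N x, v⁆) ∧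
        IsStandard F N H V) := by 
  refine ⟨fun V _ _ _ _ hV => ⟨exists_isGoodMaximal hV, fun W hW =>
    ⟨fun m => ?_, hW.exists_isComponent hV⟩⟩, fun V _ _ _ _ hV hf hK =>
    exists_isStandard F H V hV hf hK⟩
  obtain ⟨c, hc⟩ := hW.exists_scalar_K m
  exact ⟨c, hc, fun h => hW.scalar_K_ne_zero hV.irreducible hc h⟩
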